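/- Let $m,n\ge 2$ be integers, $R=[0,m-1]\times[0,n-1]\subset\mathbb{R}^2$ and $G=R\cap\mathbb{Z}^2$, with two points of $G$ adjacent when they are at distance $1$. Call an integral point $(x,y)$ black if $x+y$ is even and white if $x+y$ is odd. Let $BW$ (resp. $WB$) be the black-to-white (resp. white-to-black) adjacency matrix of $G$ over the field $\mathbb{Z}/2$: its columns are indexed by the black (resp. white) points of $G$ and its rows by the points of the other colour, and an entry is $1$ if the two points are adjacent and $0$ otherwise. **Tiles.** Up to translations and rotations by multiples of $\pi/2$, the tiles are the following convex polygons, where $a,b$ are positive integers, all sides are horizontal, vertical or diagonal (of slope $\pm 1$), and the lengths of consecutive sides are listed. (1) Octagon, $2,a\sqrt2,2,b\sqrt2,2,a\sqrt2,2,b\sqrt2$, all angles $3\pi/4$, the sides of length $2$ being horizontal or vertical. (2) Hexagon, $2,a\sqrt2,2,2,a\sqrt2,2$, with two opposite right angles, each between two sides of length $2$, one horizontal and one vertical, and four angles $3\pi/4$. (3) Square of side $2$ with horizontal and vertical sides. (4) Square of side $\sqrt2$ with diagonal sides. (5) Isosceles trapezoid with parallel sides $2+2a$ and $2$, horizontal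 or vertical, and diagonal legs $a\sqrt2$. (6) Right isosceles triangle with short sides of length $a$, one horizontal and one vertical. The large base of a trapezoid and the two short sides of a triangle are called dashed and must lie on $\partial R$. A tiling of $R$ is a set of tiles with pairwise disjoint interiors and union $R$. A tile is black (resp. white) if its vertices, not counting the right-angle vertex of a triangle, are integral black (resp. white) points. Let $\mathcal{T}_b$ (resp. $\mathcal{T}_w$) be the set of tilings of $R$ all of whose tiles are black (resp. white). **The maps.** For $u\in\ker BW\setminus\{0\}$ call a black point $p$ of $G$ active if $u(p)=1$. Two distinct active points are joined if they have a common white neighbour $w$ in $G$ such that either they form a right angle at $w$, or they are the only active neighbours of $w$. Let $\Phi_b(u)$ be the set of closures of the connected components of $\mathrm{int}(R)$ minus the union of all straight line segments between joined active points. Define $\Phi_w(u)$ for $u\in\ker WB\setminus\{0\}$ in the same way, with the colours interchanged. **Theorem.** The map $\Phi_b$ is a bijection from $\ker BW\setminus\{0\}$ onto $\mathcal{T}_b$, and $\Phi_w$ is a bijection from $\ker WB\setminus\{0\}$ onto $\mathcal{T}_w$. Consequently, with $c=\gcd(m+1,n+1)-1$, the sets $\mathcal{T}_b$ and $\mathcal{T}_w$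 are finite, with $|\mathcal{T}_b|=2^{\lceil c/2\rceil}-1$ and $|\mathcal{T}_w|=2^{\lfloor c/2\rfloor}-1$. -/

import Mathlib

namespace RectTiling

/-- The two colours of the chessboard colouring of the integral points of the plane. -/
inductive Colour
  | black
  | white

/-- The opposite colour. -/
def Colour.opp : Colour → Colour
  | .black => .white
  | .white => .black

/-- The integral point `(i, j)` has the given colour: it is black if `i + j` is even and white
if `i + j` is odd, so the origin is black. -/
def HasColour : Colour → ℤ × ℤ → Prop
  | .black, p => Even (p.1 + p.2)
  | .white, p => Odd (p.1 + p.2)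

/-! ### The rectangular graph and its adjacency matrices -/

/-- The integral point of the plane that corresponds to a point `(i, j)` of the `m × n`
rectangular graph, `0 ≤ i ≤ m - 1`, `0 ≤ j ≤ n - 1`. -/
def toInt {m n : ℕ} (p : Fin m × Fin n) : ℤ × ℤ := ((p.1 : ℕ), (p.2 : ℕ))

/-- The points of the given colour in the `m × n` rectangular graph. -/
abbrev Pt (m n : ℕ) (c : Colour) : Type := {p : Fin m × Fin n // HasColour c (toInt p)}

/-- The integral coordinates of a coloured point of the graph. -/
def Pt.coord {m n : ℕ} {c : Colour} (p : Pt m n c) : ℤ × ℤ := toInt p.1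

/-- Horizontal or vertical neighbours in `ℤ × ℤ`. -/
def Adj (p q : ℤ × ℤ) : Prop :=
  (p.1 = q.1 ∧ (p.2 = q.2 + 1 ∨ p.2 = q.2 - 1)) ∨
    (p.2 = q.2 ∧ (p.1 = q.1 + 1 ∨ p.1 = q.1 - 1))

open Classical in
/-- The adjacency matrix over `ℤ/2` from the points of colour `c` (columns) to the points of the
opposite colour (rows). -/
noncomputable def adjMatrix (m n : ℕ) (c : Colour) :
    Matrix (Pt m n c.opp) (Pt m n c) (ZMod 2) :=
  Matrix.of fun w b => if Adj b.coord w.coord then 1 else 0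

open Classical in
/-- The kernel of the adjacency matrix `adjMatrix m n c`, viewed as a linear map. -/
noncomputable def kernel (m n : ℕ) (c : Colour) : Submodule (ZMod 2) (Pt m n c → ZMod 2) :=
  LinearMap.ker (Matrix.mulVecLin (adjMatrix m n c))

/-- The kernel of the black-to-white adjacency matrix over `ℤ/2`. -/
noncomputable abbrev kerBW (m n : ℕ) : Submodule (ZMod 2) (Pt m n .black → ZMod 2) :=
  kernel m n .black

/-- The kernel of the white-to-black adjacency matrix over `ℤ/2`. -/
noncomputable abbrev kerWB (m n : ℕ) : Submodule (ZMod 2) (Pt m n .white → ZMod 2) :=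
  kernel m n .white

/-! ### Tiles and tilings -/

/-- The point of the real plane with given integral coordinates. -/
def toReal (p : ℤ × ℤ) : ℝ × ℝ := ((p.1 : ℝ), (p.2 : ℝ))

/-- The rectangle `R = [0, m - 1] × [0, n - 1]`. -/
def rect (m n : ℕ) : Set (ℝ × ℝ) := Set.Icc 0 ((m : ℝ) - 1) ×ˢ Set.Icc 0 ((n : ℝ) - 1)

/-- The list of tile shapes, up to translations and quarter turns; `a` and `b` are positive
integers. Going around the boundary, the side lengths are
* octagon: `2, a√2, 2, b√2, 2, a√2, 2, b√2`, all angles being `3π/4`;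
* hexagon: `2, a√2, 2, 2, a√2, 2`, with two opposite right angles between sides of length `2`
  and four angles `3π/4`;
* square: `2, 2, 2, 2`, with horizontal and vertical sides;
* tilted square: `√2, √2, √2, √2`, with diagonal sides;
* trapezoid: `2 + 2a, a√2, 2, a√2`, the parallel sides being horizontal or vertical, with
  two angles `π/4` and two angles `3π/4`;
* triangle: `a, a√2, a`, the right angle having a horizontal and a vertical side. -/
inductive Shape
  | octagon (a b : ℕ) (ha : 0 < a) (hb : 0 < b)
  | hexagon (a : ℕ) (ha : 0 < a)
  | square
  | tiltedSquare
  | trapezoid (a : ℕ) (ha : 0 < a)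
  | triangle (a : ℕ) (ha : 0 < a)

/-- The vertices of a shape in a reference position. -/
def Shape.vertices : Shape → Set (ℝ × ℝ)
  | .octagon a b _ _ =>
      {(0, 0), (2, 0), (2 + (a : ℝ), (a : ℝ)), (2 + (a : ℝ), 2 + (a : ℝ)),
        (2 + (a : ℝ) - (b : ℝ), 2 + (a : ℝ) + (b : ℝ)), ((a : ℝ) - (b : ℝ), 2 + (a : ℝ) + (b : ℝ)),
        (-(b : ℝ), 2 + (b : ℝ)), (-(b : ℝ), (b : ℝ))}
  | .hexagon a _ =>
      {(0, 0), (2, 0), (2 + (a : ℝ), (a : ℝ)), (2 + (a : ℝ), 2 + (a : ℝ)), ((a : ℝ), 2 + (a : ℝ)),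
        (0, 2)}
  | .square => {(0, 0), (2, 0), (2, 2), (0, 2)}
  | .tiltedSquare => {(0, 0), (1, 1), (0, 2), (-1, 1)}
  | .trapezoid a _ => {(0, 0), (2 + 2 * (a : ℝ), 0), (2 + (a : ℝ), (a : ℝ)), ((a : ℝ), (a : ℝ))}
  | .triangle a _ => {(0, 0), ((a : ℝ), 0), (0, (a : ℝ))}

/-- The union of the dashed sides of a shape in its reference position: the large base of a
trapezoid and the two short sides of a triangle. -/
def Shape.dashed : Shape → Set (ℝ × ℝ)
  | .trapezoid a _ => segment ℝ (0, 0) (2 + 2 * (a : ℝ), 0)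
  | .triangle a _ => segment ℝ (0, 0) ((a : ℝ), 0) ∪ segment ℝ (0, 0) (0, (a : ℝ))
  | _ => ∅

/-- The vertices of a shape whose colour is the colour of the tile: all the vertices, except for
the right-angle vertex in the case of a triangle. -/
def Shape.colourVertices : Shape → Set (ℝ × ℝ)
  | .triangle a _ => {((a : ℝ), 0), (0, (a : ℝ))}
  | s => s.vertices

/-- The counterclockwise rotation by `π/2` about the origin. -/
def quarterTurn (p : ℝ × ℝ) : ℝ × ℝ := (-p.2, p.1)

/-- Rotation by `k` quarter turns followed by the translation by an arbitrary real vector `v`. -/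
def place (k : Fin 4) (v : ℝ × ℝ) (p : ℝ × ℝ) : ℝ × ℝ := quarterTurn^[(k : ℕ)] p + v

/-- `t` is the tile obtained by placing the shape `s` by means of `place k v`; its dashed sides
lie on the boundary of the `m × n` rectangle. -/
def IsPlacement (m n : ℕ) (t : Set (ℝ × ℝ)) (s : Shape) (k : Fin 4) (v : ℝ × ℝ) : Prop :=
  t = place k v '' convexHull ℝ s.vertices ∧ place k v '' s.dashed ⊆ frontier (rect m n)

/-- `t` is an admissible tile. -/
def IsTile (m n : ℕ) (t : Set (ℝ × ℝ)) : Prop :=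
  ∃ (s : Shape) (k : Fin 4) (v : ℝ × ℝ), IsPlacement m n t s k v

/-- `t` is an admissible tile of colour `c`: its vertices (other than the right-angle vertex of a
triangle) are integral points of colour `c`. -/
def IsColouredTile (m n : ℕ) (c : Colour) (t : Set (ℝ × ℝ)) : Prop :=
  ∃ (s : Shape) (k : Fin 4) (v : ℝ × ℝ), IsPlacement m n t s k v ∧
    ∀ p ∈ s.colourVertices, ∃ q : ℤ × ℤ, HasColour c q ∧ place k v p = toReal q

/-- A tiling of the rectangle `R`: a set of admissible tiles that cover exactly `R` and have
pairwise disjoint interiors. -/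
structure IsTiling (m n : ℕ) (T : Set (Set (ℝ × ℝ))) : Prop where
  isTile : ∀ t ∈ T, IsTile m n t
  disjoint : T.PairwiseDisjoint interior
  cover : ⋃₀ T = rect m n

/-- The tilings of `R` all of whose tiles have colour `c`. -/
def tilings (m n : ℕ) (c : Colour) : Set (Set (Set (ℝ × ℝ))) :=
  {T | IsTiling m n T ∧ ∀ t ∈ T, IsColouredTile m n c t}

/-- The black tilings. -/
abbrev tilingsB (m n : ℕ) : Set (Set (Set (ℝ × ℝ))) := tilings m n .black

/-- The white tilings. -/
abbrev tilingsW (m n : ℕ) : Set (Set (Set (ℝ × ℝ))) := tilings m n .white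

/-! ### From vectors to tilings -/

/-- Adjacency of active points (points where `u` takes the value `1`): `b₁` and `b₂` are distinct
active points with a common neighbour `w` in the graph such that either they form a right angle
with `w`, or they are the only active neighbours of `w`. -/
def ActiveAdj {m n : ℕ} {c : Colour} (u : Pt m n c → ZMod 2) (b₁ b₂ : Pt m n c) : Prop :=
  b₁ ≠ b₂ ∧ u b₁ = 1 ∧ u b₂ = 1 ∧
    ∃ w : Pt m n c.opp, Adj b₁.coord w.coord ∧ Adj b₂.coord w.coord ∧
      ((b₁.coord.1 - w.coord.1) * (b₂.coord.1 - w.coord.1) +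
          (b₁.coord.2 - w.coord.2) * (b₂.coord.2 - w.coord.2) = 0 ∨
        ∀ b : Pt m n c, u b = 1 → Adj b.coord w.coord → b = b₁ ∨ b = b₂)

/-- The union of the straight line segments joining adjacent active points. -/
def activeSegments {m n : ℕ} {c : Colour} (u : Pt m n c → ZMod 2) : Set (ℝ × ℝ) :=
  ⋃ (b₁ : Pt m n c) (b₂ : Pt m n c) (_ : ActiveAdj u b₁ b₂),
    segment ℝ (toReal b₁.coord) (toReal b₂.coord)

/-- The splitting of `R` induced by `u`: the closures of the connected components of the interior
of `R` minus the active segments. -/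
def Phi {m n : ℕ} {c : Colour} (u : Pt m n c → ZMod 2) : Set (Set (ℝ × ℝ)) :=
  {t | ∃ x ∈ interior (rect m n) \ activeSegments u,
    t = closure (connectedComponentIn (interior (rect m n) \ activeSegments u) x)}

end RectTiling

/-! Shift coordinates by one, so that the graph occupies `1 ≤ X ≤ m`, `1 ≤ Y ≤ n`, and extend a
kernel vector to the plane by zero on the lines `X = 0`, `X = m + 1`, `Y = 0`, `Y = n + 1` and by
reflection in them. Modulo 2 the sum over the four neighbours then vanishes at every point of the
opposite colour (`unfolded_sum_eq_zero`). In the coordinates `X + Y` and `X - Y` this is a discrete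
wave equation, and d'Alembert's formula gives `γ (X + Y) + γ (X - Y)` for a single function `γ`, the
profile (`unfolded_eq_add`). Vanishing on the four lines says exactly that `γ` is even with periods
`2 * (m + 1)` and `2 * (n + 1)` (`isProfile_profile`). A point is inactive when the two values of
`γ` agree. Hence the inactive points form blocks, products of two maximal runs on which `γ` has the
same value, and the points on the four sides of such a tilted rectangle, apart from its corners, are
active while the corners are inactive. Cutting off the corners gives the octagon of the block. If a
side of `R` cuts this octagon, the symmetry of `γ` makes the block symmetric about the mirror line
one step outside that side (`isBlock_of_isRun`), which is what produces trapezoids and triangles.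
The remaining tiles are tilted squares around points with four active neighbours. Local analysis of
half unit squares shows that such tiles cover `R` (`exists_fits_mem`). A tile whose interior avoids
the active segments and whose boundary inside `R` consists of them is the closure of a component
(`Fits.connectedComponentIn_eq`). Therefore `Phi u` equals any covering by such tiles
(`Phi_eq_of_fits`), and the map lands in the tilings. Injectivity: the tiling determines the active
segments in the interior of `R`, and these determine the vector except for points all of whose
segments lie on the boundary. Such points are corners, and following them around leaves only the `3
× 3` graph with the other vector zero (`eq_zero_of_ext_ne`). Surjectivity: every coloured tile in
`R` is a tilted square or a truncated octagon (`IsColouredTile.eq_diamond_or_block`). The vector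
that vanishes exactly on the blocks of a tiling lies in the kernel, because around a point of an
octagon its values are a sum of an indicator in `x + y` and an indicator in `x - y`
(`IsBlockSystem.ext_neighbour`). Counting: by Bézout a profile has period `2 * G` with `G = gcd (m +
1) (n + 1)`, so it is given by its values in `[0, G]` on one parity class, and the vector only
depends on it up to a constant (`bijective_diagonalValues`). -/

namespace RectTiling

/-! ### Colours, coordinates and extension by zero -/

/-- The parity of `x + y` at a point `(x, y)` of the given colour. -/
def Colour.parity : Colour → ℤ
  | .black => 0
  | .white => 1

theorem Colour.parity_cases (c : Colour) : c.parity = 0 ∨ c.parity = 1 := by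
  cases c <;> simp [Colour.parity]

theorem hasColour_iff (c : Colour) (x y : ℤ) :
    HasColour c (x, y) ↔ (x + y - c.parity) % 2 = 0 := by
  cases c
  · simp only [HasColour, Colour.parity, Int.even_iff]; omega
  · simp only [HasColour, Colour.parity, Int.odd_iff]; omega

theorem hasColour_opp_iff (c : Colour) (x y : ℤ) :
    HasColour c.opp (x, y) ↔ (x + y - c.parity) % 2 = 1 := by
  cases c
  · simp only [HasColour, Colour.opp, Colour.parity, Int.odd_iff]; omega
  · simp only [HasColour, Colour.opp, Colour.parity, Int.even_iff]; omega

/-- The integral point `(x, y)` lies in the rectangle `[0, m - 1] × [0, n - 1]`. -/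
def InRect (m n : ℕ) (x y : ℤ) : Prop := 0 ≤ x ∧ x + 1 ≤ m ∧ 0 ≤ y ∧ y + 1 ≤ n

theorem Pt.coord_inRect {m n : ℕ} {c : Colour} (b : Pt m n c) :
    InRect m n b.coord.1 b.coord.2 := by
  obtain ⟨⟨i, j⟩, h⟩ := b
  simp only [Pt.coord, toInt, InRect]
  omega

theorem Pt.coord_colour {m n : ℕ} {c : Colour} (b : Pt m n c) :
    (b.coord.1 + b.coord.2 - c.parity) % 2 = 0 := (hasColour_iff _ _ _).1 b.2

theorem Pt.coord_injective {m n : ℕ} {c : Colour} :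
    Function.Injective (Pt.coord : Pt m n c → ℤ × ℤ) := by
  rintro ⟨⟨i, j⟩, h⟩ ⟨⟨i', j'⟩, h'⟩ e
  simp only [Pt.coord, toInt, Prod.mk.injEq] at e
  apply Subtype.ext
  ext <;> simp <;> omega

theorem Pt.exists_coord {m n : ℕ} {c : Colour} {x y : ℤ} (h : InRect m n x y)
    (hc : (x + y - c.parity) % 2 = 0) : ∃ b : Pt m n c, b.coord = (x, y) := by
  obtain ⟨h1, h2, h3, h4⟩ := h
  have e : toInt ((⟨x.toNat, by omega⟩, ⟨y.toNat, by omega⟩) : Fin m × Fin n) = (x, y) := by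
    simp only [toInt, Prod.mk.injEq]; omega
  exact ⟨⟨_, by rw [e]; exact (hasColour_iff _ _ _).2 hc⟩, e⟩

theorem Pt.exists_coord_opp {m n : ℕ} {c : Colour} {x y : ℤ} (h : InRect m n x y)
    (hc : (x + y - c.parity) % 2 = 1) : ∃ b : Pt m n c.opp, b.coord = (x, y) := by
  apply Pt.exists_coord h
  cases c <;> simp only [Colour.opp, Colour.parity] at * <;> omega

theorem Pt.coord_colour_opp {m n : ℕ} {c : Colour} (b : Pt m n c.opp) :
    (b.coord.1 + b.coord.2 - c.parity) % 2 = 1 := (hasColour_opp_iff _ _ _).1 b.2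

open Classical in
/-- The extension by zero of a function on the coloured points of the graph. -/
noncomputable def ext {m n : ℕ} {c : Colour} (u : Pt m n c → ZMod 2) (x y : ℤ) : ZMod 2 :=
  ∑ b : Pt m n c, if b.coord = (x, y) then u b else 0

section ext
variable {m n : ℕ} {c : Colour} (u : Pt m n c → ZMod 2)

theorem ext_coord (b : Pt m n c) : ext u b.coord.1 b.coord.2 = u b := by
  classical
  unfold ext
  rw [Finset.sum_eq_single b]
  · simp
  · intro b' _ hb'
    rw [if_neg]
    intro h
    exact hb' (Pt.coord_injective h)
  · simp

theorem ext_of_coord {b : Pt m n c} {x y : ℤ} (h : b.coord = (x, y)) : ext u x y = u b := by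
  have := ext_coord u b
  rwa [h] at this

theorem ext_eq_zero_of_not {x y : ℤ} (h : ¬ InRect m n x y) : ext u x y = 0 := by
  classical
  unfold ext
  apply Finset.sum_eq_zero
  intro b _
  rw [if_neg]
  intro e
  have := b.coord_inRect
  rw [e] at this
  exact h this

theorem ext_eq_zero_of_colour {x y : ℤ} (h : (x + y - c.parity) % 2 ≠ 0) : ext u x y = 0 := by
  classical
  unfold ext
  apply Finset.sum_eq_zero
  intro b _
  rw [if_neg]
  intro e
  have := b.coord_colour
  rw [e] at this
  exact h this

theorem exists_of_ext_ne {x y : ℤ} (h : ext u x y ≠ 0) :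
    InRect m n x y ∧ (x + y - c.parity) % 2 = 0 := by
  by_contra h'
  rw [not_and_or] at h'
  rcases h' with h' | h'
  · exact h (ext_eq_zero_of_not u h')
  · exact h (ext_eq_zero_of_colour u h')

theorem ext_add (v : Pt m n c → ZMod 2) (x y : ℤ) : ext (u + v) x y = ext u x y + ext v x y := by
  classical
  unfold ext
  rw [← Finset.sum_add_distrib]
  apply Finset.sum_congr rfl
  intro b _
  split_ifs <;> simp

theorem ite_or_mul_eq_sum {R : Type*} [Semiring R] {P P₁ P₂ P₃ P₄ : Prop} [Decidable P]
    [Decidable P₁] [Decidable P₂] [Decidable P₃] [Decidable P₄] (a : R)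
    (h : P ↔ P₁ ∨ P₂ ∨ P₃ ∨ P₄) (h12 : ¬ (P₁ ∧ P₂)) (h13 : ¬ (P₁ ∧ P₃)) (h14 : ¬ (P₁ ∧ P₄))
    (h23 : ¬ (P₂ ∧ P₃)) (h24 : ¬ (P₂ ∧ P₄)) (h34 : ¬ (P₃ ∧ P₄)) :
    (if P then 1 else 0) * a = (if P₁ then a else 0) + (if P₂ then a else 0) +
      (if P₃ then a else 0) + (if P₄ then a else 0) := by
  by_cases h1 : P₁ <;> by_cases h2 : P₂ <;> by_cases h3 : P₃ <;> by_cases h4 : P₄ <;>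
    simp_all

open Classical in
theorem mulVec_adjMatrix (w : Pt m n c.opp) :
    (adjMatrix m n c).mulVec u w =
      ext u (w.coord.1 + 1) w.coord.2 + ext u (w.coord.1 - 1) w.coord.2 +
        ext u w.coord.1 (w.coord.2 + 1) + ext u w.coord.1 (w.coord.2 - 1) := by
  classical
  unfold ext
  simp only [Matrix.mulVec, dotProduct, adjMatrix, Matrix.of_apply]
  rw [← Finset.sum_add_distrib, ← Finset.sum_add_distrib, ← Finset.sum_add_distrib]
  apply Finset.sum_congr rfl
  intro b _
  generalize w.coord = q
  generalize b.coord = p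
  obtain ⟨x, y⟩ := q
  obtain ⟨x', y'⟩ := p
  have hA : Adj (x', y') (x, y) ↔ (x', y') = (x + 1, y) ∨ (x', y') = (x - 1, y) ∨
      (x', y') = (x, y + 1) ∨ (x', y') = (x, y - 1) := by
    simp only [Adj, Prod.mk.injEq]; omega
  have h12 : ¬ ((x', y') = (x + 1, y) ∧ (x', y') = (x - 1, y)) := by
    simp only [Prod.mk.injEq]; omega
  have h13 : ¬ ((x', y') = (x + 1, y) ∧ (x', y') = (x, y + 1)) := by
    simp only [Prod.mk.injEq]; omega
  have h14 : ¬ ((x', y') = (x + 1, y) ∧ (x', y') = (x, y - 1)) := by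
    simp only [Prod.mk.injEq]; omega
  have h23 : ¬ ((x', y') = (x - 1, y) ∧ (x', y') = (x, y + 1)) := by
    simp only [Prod.mk.injEq]; omega
  have h24 : ¬ ((x', y') = (x - 1, y) ∧ (x', y') = (x, y - 1)) := by
    simp only [Prod.mk.injEq]; omega
  have h34 : ¬ ((x', y') = (x, y + 1) ∧ (x', y') = (x, y - 1)) := by
    simp only [Prod.mk.injEq]; omega
  exact ite_or_mul_eq_sum _ hA h12 h13 h14 h23 h24 h34

-- Because missing neighbours contribute zero to the extension, the rows at boundary points have the
-- same four-term form as the interior ones.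
open Classical in
theorem mem_kernel_iff : u ∈ kernel m n c ↔ ∀ x y : ℤ, InRect m n x y →
    (x + y - c.parity) % 2 = 1 →
    ext u (x + 1) y + ext u (x - 1) y + ext u x (y + 1) + ext u x (y - 1) = 0 := by
  simp only [kernel, LinearMap.mem_ker, Matrix.mulVecLin_apply]
  constructor
  · intro h x y hr hc
    obtain ⟨b, hb⟩ := Pt.exists_coord_opp hr hc
    have := congrFun h b
    rw [mulVec_adjMatrix, hb] at this
    exact this
  · intro h
    funext w
    rw [mulVec_adjMatrix]
    exact h _ _ w.coord_inRect w.coord_colour_opp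

theorem eq_of_ext_eq {v : Pt m n c → ZMod 2} (h : ∀ x y, ext u x y = ext v x y) : u = v := by
  funext b
  rw [← ext_coord u b, ← ext_coord v b, h]

theorem zmod2_cases (a : ZMod 2) : a = 0 ∨ a = 1 := by
  revert a; decide

/-! ### The active segments in terms of integral coordinates -/

/-- Diagonal neighbours that are active are always joined: the point that takes one coordinate from
each of them is in the rectangle and sees them at a right angle. -/
theorem segment_diag_subset {x y x' y' : ℤ} (h1 : ext u x y = 1) (h2 : ext u x' y' = 1)
    (hx : x' = x + 1 ∨ x' = x - 1) (hy : y' = y + 1 ∨ y' = y - 1) :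
    segment ℝ ((x : ℝ), (y : ℝ)) ((x' : ℝ), (y' : ℝ)) ⊆ activeSegments u := by
  obtain ⟨r1, c1⟩ := exists_of_ext_ne u (h1.trans_ne one_ne_zero)
  obtain ⟨r2, c2⟩ := exists_of_ext_ne u (h2.trans_ne one_ne_zero)
  obtain ⟨b₁, e1⟩ := Pt.exists_coord r1 c1
  obtain ⟨b₂, e2⟩ := Pt.exists_coord r2 c2
  have r3 : InRect m n x' y := by unfold InRect at *; omega
  obtain ⟨w, e3⟩ := Pt.exists_coord_opp (c := c) r3 (by omega)
  have : ActiveAdj u b₁ b₂ := by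
    refine ⟨?_, ?_, ?_, w, ?_, ?_, Or.inl ?_⟩
    · rintro rfl
      rw [e1, Prod.mk.injEq] at e2
      omega
    · rw [← ext_of_coord u e1, h1]
    · rw [← ext_of_coord u e2, h2]
    · rw [e1, e3]; exact Or.inr ⟨rfl, by simp only; omega⟩
    · rw [e2, e3]; exact Or.inl ⟨rfl, by simp only; omega⟩
    · rw [e1, e2, e3]; simp
  intro z hz
  simp only [activeSegments, Set.mem_iUnion]
  refine ⟨b₁, b₂, this, ?_⟩
  rw [e1, e2]
  exact hz

/-- Here `(dx, dy)` is a unit vector along an axis and `(dy, dx)` is perpendicular to it, so the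
last two hypotheses say that the two lateral neighbours of the midpoint are inactive. One statement
then serves horizontal and vertical segments. -/
theorem segment_straight_subset {x y dx dy : ℤ} (hd : dx = 0 ∧ (dy = 1 ∨ dy = -1) ∨
      dy = 0 ∧ (dx = 1 ∨ dx = -1)) (hw : InRect m n x y)
    (h1 : ext u (x + dx) (y + dy) = 1) (h2 : ext u (x - dx) (y - dy) = 1)
    (h3 : ext u (x + dy) (y + dx) = 0) (h4 : ext u (x - dy) (y - dx) = 0) :
    segment ℝ (((x + dx : ℤ) : ℝ), ((y + dy : ℤ) : ℝ)) (((x - dx : ℤ) : ℝ), ((y - dy : ℤ) : ℝ)) ⊆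
      activeSegments u := by
  obtain ⟨r1, c1⟩ := exists_of_ext_ne u (h1.trans_ne one_ne_zero)
  obtain ⟨r2, c2⟩ := exists_of_ext_ne u (h2.trans_ne one_ne_zero)
  obtain ⟨b₁, e1⟩ := Pt.exists_coord r1 c1
  obtain ⟨b₂, e2⟩ := Pt.exists_coord r2 c2
  obtain ⟨w, e3⟩ := Pt.exists_coord_opp (c := c) hw (by omega)
  have : ActiveAdj u b₁ b₂ := by
    refine ⟨?_, ?_, ?_, w, ?_, ?_, Or.inr ?_⟩
    · rintro rfl
      rw [e1, Prod.mk.injEq] at e2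
      omega
    · rw [← ext_of_coord u e1, h1]
    · rw [← ext_of_coord u e2, h2]
    · rw [e1, e3]; simp only [Adj]; omega
    · rw [e2, e3]; simp only [Adj]; omega
    · intro b hb hadj
      rw [e3] at hadj
      rcases hq : b.coord with ⟨x', y'⟩
      have hb' := ext_of_coord u hq
      rw [hb] at hb'
      rw [hq] at hadj
      simp only [Adj] at hadj
      have n3 : ¬ (x' = x + dy ∧ y' = y + dx) := by
        rintro ⟨rfl, rfl⟩; rw [h3] at hb'; exact zero_ne_one hb'
      have n4 : ¬ (x' = x - dy ∧ y' = y - dx) := by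
        rintro ⟨rfl, rfl⟩; rw [h4] at hb'; exact zero_ne_one hb'
      have : (x' = x + dx ∧ y' = y + dy) ∨ (x' = x - dx ∧ y' = y - dy) := by omega
      rcases this with ⟨rfl, rfl⟩ | ⟨rfl, rfl⟩
      · exact Or.inl (Pt.coord_injective (hq.trans e1.symm))
      · exact Or.inr (Pt.coord_injective (hq.trans e2.symm))
  intro z hz
  simp only [activeSegments, Set.mem_iUnion]
  refine ⟨b₁, b₂, this, ?_⟩
  rw [e1, e2]
  exact hz

/-- Two joined points either form a right angle at their common neighbour, hence differ diagonally,
or lie opposite each other. In the second case the scalar product is `-1`, so the other clause of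
the definition must hold and the lateral neighbours are inactive. -/
theorem mem_activeSegments {z : ℝ × ℝ} (hz : z ∈ activeSegments u) :
    (∃ x y x' y' : ℤ, ext u x y = 1 ∧ ext u x' y' = 1 ∧ (x' = x + 1 ∨ x' = x - 1) ∧
      (y' = y + 1 ∨ y' = y - 1) ∧ z ∈ segment ℝ ((x : ℝ), (y : ℝ)) ((x' : ℝ), (y' : ℝ))) ∨
    (∃ x y dx dy : ℤ, (dx = 0 ∧ (dy = 1 ∨ dy = -1) ∨ dy = 0 ∧ (dx = 1 ∨ dx = -1)) ∧
      InRect m n x y ∧ ext u (x + dx) (y + dy) = 1 ∧ ext u (x - dx) (y - dy) = 1 ∧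
      ext u (x + dy) (y + dx) = 0 ∧ ext u (x - dy) (y - dx) = 0 ∧
      z ∈ segment ℝ (((x + dx : ℤ) : ℝ), ((y + dy : ℤ) : ℝ))
        (((x - dx : ℤ) : ℝ), ((y - dy : ℤ) : ℝ))) := by
  simp only [activeSegments, Set.mem_iUnion] at hz
  obtain ⟨b₁, b₂, ⟨hne, h1, h2, w, a1, a2, h⟩, hz⟩ := hz
  rcases e1 : b₁.coord with ⟨x₁, y₁⟩
  rcases e2 : b₂.coord with ⟨x₂, y₂⟩
  rcases e3 : w.coord with ⟨x, y⟩
  have hne' : ¬ (x₁ = x₂ ∧ y₁ = y₂) := by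
    rintro ⟨rfl, rfl⟩
    exact hne (Pt.coord_injective (e1.trans e2.symm))
  rw [e1, e2] at hz
  rw [e1, e3] at a1
  rw [e2, e3] at a2
  have hw := w.coord_inRect
  rw [e3] at hw
  rw [e1, e2, e3] at h
  simp only [Adj] at a1 a2
  rw [← ext_of_coord u e1] at h1
  rw [← ext_of_coord u e2] at h2
  by_cases hd : (x₂ = x₁ + 1 ∨ x₂ = x₁ - 1) ∧ (y₂ = y₁ + 1 ∨ y₂ = y₁ - 1)
  · exact Or.inl ⟨x₁, y₁, x₂, y₂, h1, h2, hd.1, hd.2, hz⟩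
  right
  obtain ⟨dx, rfl⟩ : ∃ dx, x₁ = x + dx := ⟨x₁ - x, by ring⟩
  obtain ⟨dy, rfl⟩ : ∃ dy, y₁ = y + dy := ⟨y₁ - y, by ring⟩
  obtain rfl : x₂ = x - dx := by omega
  obtain rfl : y₂ = y - dy := by omega
  have hdd : dx = 0 ∧ (dy = 1 ∨ dy = -1) ∨ dy = 0 ∧ (dx = 1 ∨ dx = -1) := by omega
  have key : ∀ x' y', ((x' = x + dy ∧ y' = y + dx) ∨ (x' = x - dy ∧ y' = y - dx)) →
      ext u x' y' = 0 := by
    intro x' y' hh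
    rcases zmod2_cases (ext u x' y') with h0 | h0
    · exact h0
    exfalso
    obtain ⟨r, c'⟩ := exists_of_ext_ne u (h0.trans_ne one_ne_zero)
    obtain ⟨b, e⟩ := Pt.exists_coord r c'
    rcases h with h | h
    · simp only at h
      rcases hdd with ⟨rfl, rfl | rfl⟩ | ⟨rfl, rfl | rfl⟩ <;> norm_num at h
    · have := h b (by rw [← ext_of_coord u e, h0]) (by rw [e]; simp only [Adj]; omega)
      rcases this with rfl | rfl
      · rw [e1, Prod.mk.injEq] at e; omega
      · rw [e2, Prod.mk.injEq] at e; omega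
  exact ⟨x, y, dx, dy, hdd, hw, h1, h2, key _ _ (Or.inl ⟨rfl, rfl⟩), key _ _ (Or.inr ⟨rfl, rfl⟩),
    hz⟩

end ext

/-! ### Polygons with horizontal, vertical and diagonal sides -/

/-- The convex polygon given by bounds on `x`, `y`, `x + y` and `x - y`. -/
def poly (x₁ x₂ y₁ y₂ s₁ s₂ d₁ d₂ : ℝ) : Set (ℝ × ℝ) :=
  {z | (x₁ ≤ z.1 ∧ z.1 ≤ x₂) ∧ (y₁ ≤ z.2 ∧ z.2 ≤ y₂) ∧ (s₁ ≤ z.1 + z.2 ∧ z.1 + z.2 ≤ s₂) ∧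
    d₁ ≤ z.1 - z.2 ∧ z.1 - z.2 ≤ d₂}

/-- The interior of `poly`. -/
def polyInt (x₁ x₂ y₁ y₂ s₁ s₂ d₁ d₂ : ℝ) : Set (ℝ × ℝ) :=
  {z | (x₁ < z.1 ∧ z.1 < x₂) ∧ (y₁ < z.2 ∧ z.2 < y₂) ∧ (s₁ < z.1 + z.2 ∧ z.1 + z.2 < s₂) ∧
    d₁ < z.1 - z.2 ∧ z.1 - z.2 < d₂}

theorem Convex.add_smul_mem_of_le {E : Type*} [AddCommGroup E] [Module ℝ E] {C : Set E}
    (hC : Convex ℝ C) {p v : E} {r T : ℝ} (hp : p ∈ C) (hq : p + T • v ∈ C) (hr : 0 ≤ r)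
    (hrT : r ≤ T) : p + r • v ∈ C := by
  rcases hr.eq_or_lt with rfl | h0
  · simpa using hp
  have hT : 0 < T := h0.trans_le hrT
  have := hC.add_smul_mem hp hq (t := r / T) ⟨by positivity, (div_le_one hT).2 hrT⟩
  rwa [smul_smul, div_mul_cancel₀ _ hT.ne'] at this

section poly
variable {x₁ x₂ y₁ y₂ s₁ s₂ d₁ d₂ : ℝ}

theorem convex_poly : Convex ℝ (poly x₁ x₂ y₁ y₂ s₁ s₂ d₁ d₂) := by
  rintro ⟨a, b⟩ h ⟨a', b'⟩ h' α β hα hβ hs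
  simp only [poly, Set.mem_ofPred_eq, Prod.smul_mk, Prod.mk_add_mk, smul_eq_mul] at *
  obtain rfl : β = 1 - α := by linarith
  obtain ⟨⟨h1, h2⟩, ⟨h3, h4⟩, ⟨h5, h6⟩, h7, h8⟩ := h
  obtain ⟨⟨k1, k2⟩, ⟨k3, k4⟩, ⟨k5, k6⟩, k7, k8⟩ := h'
  refine ⟨⟨?_, ?_⟩, ⟨?_, ?_⟩, ⟨?_, ?_⟩, ?_, ?_⟩
  · linear_combination α * h1 + (1 - α) * k1
  · linear_combination α * h2 + (1 - α) * k2
  · linear_combination α * h3 + (1 - α) * k3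
  · linear_combination α * h4 + (1 - α) * k4
  · linear_combination α * h5 + (1 - α) * k5
  · linear_combination α * h6 + (1 - α) * k6
  · linear_combination α * h7 + (1 - α) * k7
  · linear_combination α * h8 + (1 - α) * k8

theorem isClosed_poly : IsClosed (poly x₁ x₂ y₁ y₂ s₁ s₂ d₁ d₂) := by
  unfold poly
  simp only [Set.ofPred_and]
  refine ((isClosed_le ?_ ?_).inter (isClosed_le ?_ ?_)).inter
    (((isClosed_le ?_ ?_).inter (isClosed_le ?_ ?_)).inter
    (((isClosed_le ?_ ?_).inter (isClosed_le ?_ ?_)).inter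
    ((isClosed_le ?_ ?_).inter (isClosed_le ?_ ?_)))) <;> fun_prop

theorem isOpen_polyInt : IsOpen (polyInt x₁ x₂ y₁ y₂ s₁ s₂ d₁ d₂) := by
  unfold polyInt
  simp only [Set.ofPred_and]
  refine ((isOpen_lt ?_ ?_).inter (isOpen_lt ?_ ?_)).inter
    (((isOpen_lt ?_ ?_).inter (isOpen_lt ?_ ?_)).inter
    (((isOpen_lt ?_ ?_).inter (isOpen_lt ?_ ?_)).inter
    ((isOpen_lt ?_ ?_).inter (isOpen_lt ?_ ?_)))) <;> fun_prop

theorem exists_add_smul_mem_of_mem_interior {A : Set (ℝ × ℝ)} {z : ℝ × ℝ} (hz : z ∈ interior A)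
    (v : ℝ × ℝ) : ∃ ε : ℝ, 0 < ε ∧ z + ε • v ∈ A := by
  have hc : Filter.Tendsto (fun t : ℝ => z + t • v) (nhdsWithin 0 (Set.Ioi 0)) (nhds z) := by
    have : Continuous fun t : ℝ => z + t • v := by fun_prop
    have := (this.tendsto 0).mono_left (nhdsWithin_le_nhds (s := Set.Ioi 0))
    simpa using this
  have h1 := hc.eventually (mem_interior_iff_mem_nhds.1 hz)
  obtain ⟨ε, h2, h3⟩ := (h1.and self_mem_nhdsWithin).exists
  exact ⟨ε, h3, h2⟩

theorem interior_poly :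
    interior (poly x₁ x₂ y₁ y₂ s₁ s₂ d₁ d₂) = polyInt x₁ x₂ y₁ y₂ s₁ s₂ d₁ d₂ := by
  apply Set.Subset.antisymm
  -- Each of the eight linear bounds becomes tighter along one of the four axis directions, so small
  -- moves in these directions suffice, whether or not some bounds are redundant.
  · intro z hz
    obtain ⟨e1, p1, h1⟩ := exists_add_smul_mem_of_mem_interior hz (1, 0)
    obtain ⟨e2, p2, h2⟩ := exists_add_smul_mem_of_mem_interior hz (-1, 0)
    obtain ⟨e3, p3, h3⟩ := exists_add_smul_mem_of_mem_interior hz (0, 1)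
    obtain ⟨e4, p4, h4⟩ := exists_add_smul_mem_of_mem_interior hz (0, -1)
    obtain ⟨x, y⟩ := z
    simp only [poly, Set.mem_ofPred_eq, Prod.smul_mk, Prod.mk_add_mk, smul_eq_mul] at h1 h2 h3 h4
    simp only [polyInt, Set.mem_ofPred_eq]
    refine ⟨⟨?_, ?_⟩, ⟨?_, ?_⟩, ⟨?_, ?_⟩, ?_, ?_⟩ <;> linarith
  · apply interior_maximal _ isOpen_polyInt
    rintro z ⟨⟨h1, h2⟩, ⟨h3, h4⟩, ⟨h5, h6⟩, h7, h8⟩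
    exact ⟨⟨h1.le, h2.le⟩, ⟨h3.le, h4.le⟩, ⟨h5.le, h6.le⟩, h7.le, h8.le⟩

/-- A polygon is contained in every convex set that contains its vertices. -/
theorem poly_subset_of_convex {C : Set (ℝ × ℝ)} (hC : Convex ℝ C)
    (hl₁ : y₁ ≤ s₁ - x₁) (hl₂ : s₁ - x₁ ≤ x₁ - d₁) (hl₃ : x₁ - d₁ ≤ y₂)
    (hr₁ : y₁ ≤ x₂ - d₂) (hr₂ : x₂ - d₂ ≤ s₂ - x₂) (hr₃ : s₂ - x₂ ≤ y₂)
    (v₁ : (s₁ - y₁, y₁) ∈ C) (v₂ : (d₂ + y₁, y₁) ∈ C) (v₃ : (x₂, x₂ - d₂) ∈ C)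
    (v₄ : (x₂, s₂ - x₂) ∈ C) (v₅ : (s₂ - y₂, y₂) ∈ C) (v₆ : (d₁ + y₂, y₂) ∈ C)
    (v₇ : (x₁, x₁ - d₁) ∈ C) (v₈ : (x₁, s₁ - x₁) ∈ C) :
    poly x₁ x₂ y₁ y₂ s₁ s₂ d₁ d₂ ⊆ C := by
  have key : ∀ {a b c d : ℝ} (e f T r : ℝ), (a, b) ∈ C → (a + T * e, b + T * f) ∈ C → 0 ≤ r →
      r ≤ T → c = a + r * e → d = b + r * f → (c, d) ∈ C := by
    intro a b c d e f T r h1 h2 h3 h4 h5 h6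
    have := Convex.add_smul_mem_of_le hC (p := (a, b)) (v := (e, f)) (r := r) (T := T) h1
      (by simpa using h2) h3 h4
    rw [h5, h6]
    simpa using this
  rintro ⟨x, y⟩ ⟨⟨h1, h2⟩, ⟨h3, h4⟩, ⟨h5, h6⟩, h7, h8⟩
  simp only at h1 h2 h3 h4 h5 h6 h7 h8
  -- The horizontal line through the point meets the left chain of three edges and the right chain
  -- of three edges; the point lies between these two intersections.
  have left : ∃ l, l ≤ x ∧ (l, y) ∈ C := by
    rcases le_total y (s₁ - x₁) with h | h
    · refine ⟨s₁ - y, by linarith, key (-1) 1 (s₁ - x₁ - y₁) (y - y₁) v₁ ?_ ?_ ?_ ?_ ?_⟩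
      · convert v₈ using 2 <;> ring
      all_goals linarith
    rcases le_total y (x₁ - d₁) with h' | h'
    · refine ⟨x₁, by linarith, key 0 1 (x₁ - d₁ - (s₁ - x₁)) (y - (s₁ - x₁)) v₈ ?_ ?_ ?_ ?_ ?_⟩
      · convert v₇ using 2 <;> ring
      all_goals linarith
    · refine ⟨d₁ + y, by linarith, key 1 1 (y₂ - (x₁ - d₁)) (y - (x₁ - d₁)) v₇ ?_ ?_ ?_ ?_ ?_⟩
      · convert v₆ using 2 <;> ring
      all_goals linarith
  have right : ∃ r, x ≤ r ∧ (r, y) ∈ C := by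
    rcases le_total y (x₂ - d₂) with h | h
    · refine ⟨d₂ + y, by linarith, key 1 1 (x₂ - d₂ - y₁) (y - y₁) v₂ ?_ ?_ ?_ ?_ ?_⟩
      · convert v₃ using 2 <;> ring
      all_goals linarith
    rcases le_total y (s₂ - x₂) with h' | h'
    · refine ⟨x₂, by linarith, key 0 1 (s₂ - x₂ - (x₂ - d₂)) (y - (x₂ - d₂)) v₃ ?_ ?_ ?_ ?_ ?_⟩
      · convert v₄ using 2 <;> ring
      all_goals linarith
    · refine ⟨s₂ - y, by linarith, key (-1) 1 (y₂ - (s₂ - x₂)) (y - (s₂ - x₂)) v₄ ?_ ?_ ?_ ?_ ?_⟩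
      · convert v₅ using 2 <;> ring
      all_goals linarith
  obtain ⟨l, hl, hlC⟩ := left
  obtain ⟨r, hr, hrC⟩ := right
  refine key 1 0 (r - l) (x - l) hlC ?_ ?_ ?_ ?_ ?_
  · convert hrC using 2 <;> ring
  all_goals linarith

/-- The eight corners are allowed to coincide, so squares, hexagons, trapezoids and triangles are
treated as degenerate octagons. -/
theorem convexHull_eq_poly {V : Set (ℝ × ℝ)} (hV : V ⊆ poly x₁ x₂ y₁ y₂ s₁ s₂ d₁ d₂)
    (hl₁ : y₁ ≤ s₁ - x₁) (hl₂ : s₁ - x₁ ≤ x₁ - d₁) (hl₃ : x₁ - d₁ ≤ y₂)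
    (hr₁ : y₁ ≤ x₂ - d₂) (hr₂ : x₂ - d₂ ≤ s₂ - x₂) (hr₃ : s₂ - x₂ ≤ y₂)
    (v₁ : (s₁ - y₁, y₁) ∈ V) (v₂ : (d₂ + y₁, y₁) ∈ V) (v₃ : (x₂, x₂ - d₂) ∈ V)
    (v₄ : (x₂, s₂ - x₂) ∈ V) (v₅ : (s₂ - y₂, y₂) ∈ V) (v₆ : (d₁ + y₂, y₂) ∈ V)
    (v₇ : (x₁, x₁ - d₁) ∈ V) (v₈ : (x₁, s₁ - x₁) ∈ V) :
    convexHull ℝ V = poly x₁ x₂ y₁ y₂ s₁ s₂ d₁ d₂ := by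
  have hs := subset_convexHull ℝ V
  exact Set.Subset.antisymm (convexHull_min hV convex_poly)
    (poly_subset_of_convex (convex_convexHull ℝ V) hl₁ hl₂ hl₃ hr₁ hr₂ hr₃ (hs v₁) (hs v₂) (hs v₃)
      (hs v₄) (hs v₅) (hs v₆) (hs v₇) (hs v₈))

end poly

/-! ### Placements -/

theorem place_zero (v p : ℝ × ℝ) : place 0 v p = (p.1 + v.1, p.2 + v.2) := rfl

theorem place_one (v p : ℝ × ℝ) : place 1 v p = (-p.2 + v.1, p.1 + v.2) := rfl

theorem place_two (v p : ℝ × ℝ) : place 2 v p = (-p.1 + v.1, -p.2 + v.2) := rfl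

theorem place_three (v p : ℝ × ℝ) : place 3 v p = (p.2 + v.1, -p.1 + v.2) := by
  change (- -p.2 + v.1, -p.1 + v.2) = _
  rw [neg_neg]

theorem mem_image_place_zero {v z : ℝ × ℝ} {A : Set (ℝ × ℝ)} :
    z ∈ place 0 v '' A ↔ (z.1 - v.1, z.2 - v.2) ∈ A := by
  constructor
  · rintro ⟨p, hp, rfl⟩
    simpa [place_zero] using hp
  · intro h
    exact ⟨_, h, by simp [place_zero]⟩

theorem mem_image_place_one {v z : ℝ × ℝ} {A : Set (ℝ × ℝ)} :
    z ∈ place 1 v '' A ↔ (z.2 - v.2, v.1 - z.1) ∈ A := by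
  constructor
  · rintro ⟨p, hp, rfl⟩
    simpa [place_one] using hp
  · intro h
    exact ⟨_, h, by simp [place_one]⟩

theorem mem_image_place_two {v z : ℝ × ℝ} {A : Set (ℝ × ℝ)} :
    z ∈ place 2 v '' A ↔ (v.1 - z.1, v.2 - z.2) ∈ A := by
  constructor
  · rintro ⟨p, hp, rfl⟩
    simpa [place_two] using hp
  · intro h
    exact ⟨_, h, by simp [place_two]⟩

theorem mem_image_place_three {v z : ℝ × ℝ} {A : Set (ℝ × ℝ)} :
    z ∈ place 3 v '' A ↔ (v.2 - z.2, z.1 - v.1) ∈ A := by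
  constructor
  · rintro ⟨p, hp, rfl⟩
    simpa [place_three] using hp
  · intro h
    exact ⟨_, h, by simp [place_three]⟩

section place
variable (x₁ x₂ y₁ y₂ s₁ s₂ d₁ d₂ : ℝ)

/-- A quarter turn permutes the linear forms `x`, `y`, `x + y`, `x - y` up to sign, so this family
of polygons is stable under all placements. -/
theorem place_zero_poly (v : ℝ × ℝ) : place 0 v '' poly x₁ x₂ y₁ y₂ s₁ s₂ d₁ d₂ =
    poly (v.1 + x₁) (v.1 + x₂) (v.2 + y₁) (v.2 + y₂) (v.1 + v.2 + s₁) (v.1 + v.2 + s₂)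
      (v.1 - v.2 + d₁) (v.1 - v.2 + d₂) := by
  ext z
  simp only [mem_image_place_zero, poly, Set.mem_ofPred_eq]
  constructor <;> rintro ⟨⟨h1, h2⟩, ⟨h3, h4⟩, ⟨h5, h6⟩, h7, h8⟩ <;>
    refine ⟨⟨?_, ?_⟩, ⟨?_, ?_⟩, ⟨?_, ?_⟩, ?_, ?_⟩ <;> linarith

theorem place_one_poly (v : ℝ × ℝ) : place 1 v '' poly x₁ x₂ y₁ y₂ s₁ s₂ d₁ d₂ =
    poly (v.1 - y₂) (v.1 - y₁) (v.2 + x₁) (v.2 + x₂) (v.1 + v.2 + d₁) (v.1 + v.2 + d₂)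
      (v.1 - v.2 - s₂) (v.1 - v.2 - s₁) := by
  ext z
  simp only [mem_image_place_one, poly, Set.mem_ofPred_eq]
  constructor <;> rintro ⟨⟨h1, h2⟩, ⟨h3, h4⟩, ⟨h5, h6⟩, h7, h8⟩ <;>
    refine ⟨⟨?_, ?_⟩, ⟨?_, ?_⟩, ⟨?_, ?_⟩, ?_, ?_⟩ <;> linarith

theorem place_two_poly (v : ℝ × ℝ) : place 2 v '' poly x₁ x₂ y₁ y₂ s₁ s₂ d₁ d₂ =
    poly (v.1 - x₂) (v.1 - x₁) (v.2 - y₂) (v.2 - y₁) (v.1 + v.2 - s₂) (v.1 + v.2 - s₁)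
      (v.1 - v.2 - d₂) (v.1 - v.2 - d₁) := by
  ext z
  simp only [mem_image_place_two, poly, Set.mem_ofPred_eq]
  constructor <;> rintro ⟨⟨h1, h2⟩, ⟨h3, h4⟩, ⟨h5, h6⟩, h7, h8⟩ <;>
    refine ⟨⟨?_, ?_⟩, ⟨?_, ?_⟩, ⟨?_, ?_⟩, ?_, ?_⟩ <;> linarith

theorem place_three_poly (v : ℝ × ℝ) : place 3 v '' poly x₁ x₂ y₁ y₂ s₁ s₂ d₁ d₂ =
    poly (v.1 + y₁) (v.1 + y₂) (v.2 - x₂) (v.2 - x₁) (v.1 + v.2 - d₂) (v.1 + v.2 - d₁)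
      (v.1 - v.2 + s₁) (v.1 - v.2 + s₂) := by
  ext z
  simp only [mem_image_place_three, poly, Set.mem_ofPred_eq]
  constructor <;> rintro ⟨⟨h1, h2⟩, ⟨h3, h4⟩, ⟨h5, h6⟩, h7, h8⟩ <;>
    refine ⟨⟨?_, ?_⟩, ⟨?_, ?_⟩, ⟨?_, ?_⟩, ?_, ?_⟩ <;> linarith

end place

theorem convex_place (k : Fin 4) (v : ℝ × ℝ) {A : Set (ℝ × ℝ)} (hA : Convex ℝ A) :
    Convex ℝ (place k v '' A) := by
  rintro _ ⟨p, hp, rfl⟩ _ ⟨q, hq, rfl⟩ a b ha hb hab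
  refine ⟨_, hA hp hq ha hb hab, ?_⟩
  obtain rfl : b = 1 - a := by linarith
  fin_cases k
  · simp only [Fin.zero_eta, place_zero]; ext <;> simp <;> ring
  · simp only [Fin.mk_one, place_one]; ext <;> simp <;> ring
  · simp only [Fin.reduceFinMk, place_two]; ext <;> simp <;> ring
  · simp only [Fin.reduceFinMk, place_three]; ext <;> simp <;> ring

theorem isClosed_place (k : Fin 4) (v : ℝ × ℝ) {A : Set (ℝ × ℝ)} (hA : IsClosed A) :
    IsClosed (place k v '' A) := by
  fin_cases k
  · have : place 0 v '' A = (fun z : ℝ × ℝ => (z.1 - v.1, z.2 - v.2)) ⁻¹' A :=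
      Set.ext fun z => mem_image_place_zero
    exact this ▸ hA.preimage (by fun_prop)
  · have : place 1 v '' A = (fun z : ℝ × ℝ => (z.2 - v.2, v.1 - z.1)) ⁻¹' A :=
      Set.ext fun z => mem_image_place_one
    exact this ▸ hA.preimage (by fun_prop)
  · have : place 2 v '' A = (fun z : ℝ × ℝ => (v.1 - z.1, v.2 - z.2)) ⁻¹' A :=
      Set.ext fun z => mem_image_place_two
    exact this ▸ hA.preimage (by fun_prop)
  · have : place 3 v '' A = (fun z : ℝ × ℝ => (v.2 - z.2, z.1 - v.1)) ⁻¹' A :=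
      Set.ext fun z => mem_image_place_three
    exact this ▸ hA.preimage (by fun_prop)

theorem isOpen_place (k : Fin 4) (v : ℝ × ℝ) {A : Set (ℝ × ℝ)} (hA : IsOpen A) :
    IsOpen (place k v '' A) := by
  fin_cases k
  · have : place 0 v '' A = (fun z : ℝ × ℝ => (z.1 - v.1, z.2 - v.2)) ⁻¹' A :=
      Set.ext fun z => mem_image_place_zero
    exact this ▸ hA.preimage (by fun_prop)
  · have : place 1 v '' A = (fun z : ℝ × ℝ => (z.2 - v.2, v.1 - z.1)) ⁻¹' A :=
      Set.ext fun z => mem_image_place_one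
    exact this ▸ hA.preimage (by fun_prop)
  · have : place 2 v '' A = (fun z : ℝ × ℝ => (v.1 - z.1, v.2 - z.2)) ⁻¹' A :=
      Set.ext fun z => mem_image_place_two
    exact this ▸ hA.preimage (by fun_prop)
  · have : place 3 v '' A = (fun z : ℝ × ℝ => (v.2 - z.2, z.1 - v.1)) ⁻¹' A :=
      Set.ext fun z => mem_image_place_three
    exact this ▸ hA.preimage (by fun_prop)

/-! ### The shapes as polygons -/

theorem convexHull_octagon (a b : ℕ) (ha : 0 < a) (hb : 0 < b) :
    convexHull ℝ (Shape.octagon a b ha hb).vertices =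
      poly (-b) (2 + a) 0 (2 + a + b) 0 (4 + 2 * a) (-2 - 2 * b) 2 := by
  have ha' : (0 : ℝ) ≤ a := a.cast_nonneg
  have hb' : (0 : ℝ) ≤ b := b.cast_nonneg
  apply convexHull_eq_poly
  · intro z hz
    simp only [Shape.vertices, Set.mem_insert_iff, Set.mem_singleton_iff] at hz
    rcases hz with rfl | rfl | rfl | rfl | rfl | rfl | rfl | rfl <;>
    refine ⟨⟨?_, ?_⟩, ⟨?_, ?_⟩, ⟨?_, ?_⟩, ?_, ?_⟩ <;> simp only <;> linarith
  any_goals linarith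
  all_goals simp only [Shape.vertices, Set.mem_insert_iff, Set.mem_singleton_iff]
  · exact Or.inl (congrArg₂ Prod.mk (by ring) (by ring))
  · exact Or.inr <| Or.inl (congrArg₂ Prod.mk (by ring) (by ring))
  · exact Or.inr <| Or.inr <| Or.inl (congrArg₂ Prod.mk (by ring) (by ring))
  · exact Or.inr <| Or.inr <| Or.inr <| Or.inl (congrArg₂ Prod.mk (by ring) (by ring))
  · exact Or.inr <| Or.inr <| Or.inr <| Or.inr <| Or.inl (congrArg₂ Prod.mk (by ring) (by ring))
  · exact Or.inr <| Or.inr <| Or.inr <| Or.inr <| Or.inr <| Or.inl (congrArg₂ Prod.mk (by ring) (by ring))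
  · exact Or.inr <| Or.inr <| Or.inr <| Or.inr <| Or.inr <| Or.inr <| Or.inl
      (congrArg₂ Prod.mk (by ring) (by ring))
  · exact Or.inr <| Or.inr <| Or.inr <| Or.inr <| Or.inr <| Or.inr <| Or.inr
      (congrArg₂ Prod.mk (by ring) (by ring))

theorem convexHull_hexagon (a : ℕ) (ha : 0 < a) :
    convexHull ℝ (Shape.hexagon a ha).vertices =
      poly 0 (2 + a) 0 (2 + a) 0 (4 + 2 * a) (-2) 2 := by
  have ha' : (0 : ℝ) ≤ a := a.cast_nonneg
  apply convexHull_eq_poly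
  · intro z hz
    simp only [Shape.vertices, Set.mem_insert_iff, Set.mem_singleton_iff] at hz
    rcases hz with rfl | rfl | rfl | rfl | rfl | rfl <;>
    refine ⟨⟨?_, ?_⟩, ⟨?_, ?_⟩, ⟨?_, ?_⟩, ?_, ?_⟩ <;> simp only <;> linarith
  any_goals linarith
  all_goals simp only [Shape.vertices, Set.mem_insert_iff, Set.mem_singleton_iff]
  · exact Or.inl (congrArg₂ Prod.mk (by ring) (by ring))
  · exact Or.inr <| Or.inl (congrArg₂ Prod.mk (by ring) (by ring))
  · exact Or.inr <| Or.inr <| Or.inl (congrArg₂ Prod.mk (by ring) (by ring))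
  · exact Or.inr <| Or.inr <| Or.inr <| Or.inl (congrArg₂ Prod.mk (by ring) (by ring))
  · exact Or.inr <| Or.inr <| Or.inr <| Or.inl (congrArg₂ Prod.mk (by ring) (by ring))
  · exact Or.inr <| Or.inr <| Or.inr <| Or.inr <| Or.inl (congrArg₂ Prod.mk (by ring) (by ring))
  · exact Or.inr <| Or.inr <| Or.inr <| Or.inr <| Or.inr (congrArg₂ Prod.mk (by ring) (by ring))
  · exact Or.inl (congrArg₂ Prod.mk (by ring) (by ring))

theorem convexHull_square :
    convexHull ℝ Shape.square.vertices = poly 0 2 0 2 0 4 (-2) 2 := by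
  apply convexHull_eq_poly
  · intro z hz
    simp only [Shape.vertices, Set.mem_insert_iff, Set.mem_singleton_iff] at hz
    rcases hz with rfl | rfl | rfl | rfl <;>
    refine ⟨⟨?_, ?_⟩, ⟨?_, ?_⟩, ⟨?_, ?_⟩, ?_, ?_⟩ <;> norm_num
  all_goals norm_num [Shape.vertices]

theorem convexHull_tiltedSquare :
    convexHull ℝ Shape.tiltedSquare.vertices = poly (-1) 1 0 2 0 2 (-2) 0 := by
  apply convexHull_eq_poly
  · intro z hz
    simp only [Shape.vertices, Set.mem_insert_iff, Set.mem_singleton_iff] at hz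
    rcases hz with rfl | rfl | rfl | rfl <;>
    refine ⟨⟨?_, ?_⟩, ⟨?_, ?_⟩, ⟨?_, ?_⟩, ?_, ?_⟩ <;> norm_num
  all_goals norm_num [Shape.vertices]

theorem convexHull_trapezoid (a : ℕ) (ha : 0 < a) :
    convexHull ℝ (Shape.trapezoid a ha).vertices =
      poly 0 (2 + 2 * a) 0 a 0 (2 + 2 * a) 0 (2 + 2 * a) := by
  have ha' : (0 : ℝ) ≤ a := a.cast_nonneg
  apply convexHull_eq_poly
  · intro z hz
    simp only [Shape.vertices, Set.mem_insert_iff, Set.mem_singleton_iff] at hz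
    rcases hz with rfl | rfl | rfl | rfl <;>
    refine ⟨⟨?_, ?_⟩, ⟨?_, ?_⟩, ⟨?_, ?_⟩, ?_, ?_⟩ <;> simp only <;> linarith
  any_goals linarith
  all_goals simp only [Shape.vertices, Set.mem_insert_iff, Set.mem_singleton_iff]
  · exact Or.inl (congrArg₂ Prod.mk (by ring) (by ring))
  · exact Or.inr <| Or.inl (congrArg₂ Prod.mk (by ring) (by ring))
  · exact Or.inr <| Or.inl (congrArg₂ Prod.mk (by ring) (by ring))
  · exact Or.inr <| Or.inl (congrArg₂ Prod.mk (by ring) (by ring))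
  · exact Or.inr <| Or.inr <| Or.inl (congrArg₂ Prod.mk (by ring) (by ring))
  · exact Or.inr <| Or.inr <| Or.inr (congrArg₂ Prod.mk (by ring) (by ring))
  · exact Or.inl (congrArg₂ Prod.mk (by ring) (by ring))
  · exact Or.inl (congrArg₂ Prod.mk (by ring) (by ring))

theorem convexHull_triangle (a : ℕ) (ha : 0 < a) :
    convexHull ℝ (Shape.triangle a ha).vertices = poly 0 a 0 a 0 a (-a) a := by
  have ha' : (0 : ℝ) ≤ a := a.cast_nonneg
  apply convexHull_eq_poly
  · intro z hz
    simp only [Shape.vertices, Set.mem_insert_iff, Set.mem_singleton_iff] at hz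
    rcases hz with rfl | rfl | rfl <;>
    refine ⟨⟨?_, ?_⟩, ⟨?_, ?_⟩, ⟨?_, ?_⟩, ?_, ?_⟩ <;> simp only <;> linarith
  any_goals linarith
  all_goals simp only [Shape.vertices, Set.mem_insert_iff, Set.mem_singleton_iff]
  · exact Or.inl (congrArg₂ Prod.mk (by ring) (by ring))
  · exact Or.inr <| Or.inl (congrArg₂ Prod.mk (by ring) (by ring))
  · exact Or.inr <| Or.inl (congrArg₂ Prod.mk (by ring) (by ring))
  · exact Or.inr <| Or.inl (congrArg₂ Prod.mk (by ring) (by ring))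
  · exact Or.inr <| Or.inr (congrArg₂ Prod.mk (by ring) (by ring))
  · exact Or.inr <| Or.inr (congrArg₂ Prod.mk (by ring) (by ring))
  · exact Or.inr <| Or.inr (congrArg₂ Prod.mk (by ring) (by ring))
  · exact Or.inl (congrArg₂ Prod.mk (by ring) (by ring))

theorem isClosed_convexHull_vertices (s : Shape) : IsClosed (convexHull ℝ s.vertices) := by
  cases s
  · rw [convexHull_octagon]; exact isClosed_poly
  · rw [convexHull_hexagon]; exact isClosed_poly
  · rw [convexHull_square]; exact isClosed_poly
  · rw [convexHull_tiltedSquare]; exact isClosed_poly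
  · rw [convexHull_trapezoid]; exact isClosed_poly
  · rw [convexHull_triangle]; exact isClosed_poly

theorem interior_convexHull_vertices_nonempty (s : Shape) :
    (interior (convexHull ℝ s.vertices)).Nonempty := by
  rcases s with ⟨a, b, ha, hb⟩ | ⟨a, ha⟩ | _ | _ | ⟨a, ha⟩ | ⟨a, ha⟩
  · rw [convexHull_octagon, interior_poly]
    have ha' : (0 : ℝ) < a := by exact_mod_cast ha
    have hb' : (0 : ℝ) < b := by exact_mod_cast hb
    refine ⟨(1, 1), ⟨?_, ?_⟩, ⟨?_, ?_⟩, ⟨?_, ?_⟩, ?_, ?_⟩ <;> simp only <;> linarith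
  · rw [convexHull_hexagon, interior_poly]
    have ha' : (0 : ℝ) < a := by exact_mod_cast ha
    refine ⟨(1, 1), ⟨?_, ?_⟩, ⟨?_, ?_⟩, ⟨?_, ?_⟩, ?_, ?_⟩ <;> simp only <;> linarith
  · rw [convexHull_square, interior_poly]
    refine ⟨(1, 1), ⟨?_, ?_⟩, ⟨?_, ?_⟩, ⟨?_, ?_⟩, ?_, ?_⟩ <;> simp only <;> linarith
  · rw [convexHull_tiltedSquare, interior_poly]
    refine ⟨(0, 1), ⟨?_, ?_⟩, ⟨?_, ?_⟩, ⟨?_, ?_⟩, ?_, ?_⟩ <;> simp only <;> linarith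
  · rw [convexHull_trapezoid, interior_poly]
    have ha' : (0 : ℝ) < a := by exact_mod_cast ha
    refine ⟨(a + 1, a / 2), ⟨?_, ?_⟩, ⟨?_, ?_⟩, ⟨?_, ?_⟩, ?_, ?_⟩ <;> simp only <;> linarith
  · rw [convexHull_triangle, interior_poly]
    have ha' : (0 : ℝ) < a := by exact_mod_cast ha
    refine ⟨(a / 3, a / 3), ⟨?_, ?_⟩, ⟨?_, ?_⟩, ⟨?_, ?_⟩, ?_, ?_⟩ <;> simp only <;> linarith

section IsTile
variable {m n : ℕ} {t : Set (ℝ × ℝ)}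

theorem IsTile.convex (h : IsTile m n t) : Convex ℝ t := by
  obtain ⟨s, k, v, rfl, -⟩ := h
  exact convex_place k v (convex_convexHull ℝ _)

theorem IsTile.isClosed (h : IsTile m n t) : IsClosed t := by
  obtain ⟨s, k, v, rfl, -⟩ := h
  exact isClosed_place k v (isClosed_convexHull_vertices s)

theorem IsTile.interior_nonempty (h : IsTile m n t) : (interior t).Nonempty := by
  obtain ⟨s, k, v, rfl, -⟩ := h
  obtain ⟨p, hp⟩ := interior_convexHull_vertices_nonempty s
  exact ⟨place k v p, interior_maximal (Set.image_mono interior_subset)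
    (isOpen_place k v isOpen_interior) (Set.mem_image_of_mem _ hp)⟩

theorem IsTile.closure_interior (h : IsTile m n t) : closure (interior t) = t := by
  rw [h.convex.closure_interior_eq_closure_of_nonempty_interior h.interior_nonempty,
    h.isClosed.closure_eq]

theorem IsColouredTile.isTile {c : Colour} (h : IsColouredTile m n c t) : IsTile m n t := by
  obtain ⟨s, k, v, h, -⟩ := h
  exact ⟨s, k, v, h⟩

end IsTile

/-! ### Rectangles -/

section rect
variable {m n : ℕ}

theorem mem_rect {z : ℝ × ℝ} : z ∈ rect m n ↔
    (0 ≤ z.1 ∧ z.1 ≤ (m : ℝ) - 1) ∧ (0 ≤ z.2 ∧ z.2 ≤ (n : ℝ) - 1) := Iff.rfl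

theorem isClosed_rect : IsClosed (rect m n) := isClosed_Icc.prod isClosed_Icc

theorem mem_interior_rect {z : ℝ × ℝ} : z ∈ interior (rect m n) ↔
    (0 < z.1 ∧ z.1 < (m : ℝ) - 1) ∧ (0 < z.2 ∧ z.2 < (n : ℝ) - 1) := by
  rw [rect, interior_prod_eq, interior_Icc, interior_Icc]
  exact Iff.rfl

theorem mem_frontier_rect {z : ℝ × ℝ} : z ∈ frontier (rect m n) ↔
    z ∈ rect m n ∧ (z.1 = 0 ∨ z.1 = (m : ℝ) - 1 ∨ z.2 = 0 ∨ z.2 = (n : ℝ) - 1) := by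
  rw [frontier, isClosed_rect.closure_eq, Set.mem_sdiff, mem_interior_rect]
  constructor
  · rintro ⟨h, h'⟩
    refine ⟨h, ?_⟩
    by_contra hc
    push Not at hc
    obtain ⟨c1, c2, c3, c4⟩ := hc
    exact h' ⟨⟨h.1.1.lt_of_ne' c1, h.1.2.lt_of_ne c2⟩, h.2.1.lt_of_ne' c3, h.2.2.lt_of_ne c4⟩
  · rintro ⟨h, h'⟩
    refine ⟨h, ?_⟩
    rintro ⟨⟨h1, h2⟩, h3, h4⟩
    rcases h' with h' | h' | h' | h' <;> linarith

theorem intCast_mem_rect {x y : ℤ} :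
    ((x : ℝ), (y : ℝ)) ∈ rect m n ↔ InRect m n x y := by
  rw [mem_rect, InRect]
  have h1 : (x : ℝ) ≤ (m : ℝ) - 1 ↔ x + 1 ≤ m := by
    rw [le_sub_iff_add_le]; exact_mod_cast Iff.rfl
  have h2 : (y : ℝ) ≤ (n : ℝ) - 1 ↔ y + 1 ≤ n := by
    rw [le_sub_iff_add_le]; exact_mod_cast Iff.rfl
  simp only [h1, h2, Int.cast_nonneg_iff]
  tauto

theorem intCast_mem_interior_rect {x y : ℤ} :
    ((x : ℝ), (y : ℝ)) ∈ interior (rect m n) ↔ 0 < x ∧ x + 1 < m ∧ 0 < y ∧ y + 1 < n := by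
  rw [mem_interior_rect]
  have h1 : (x : ℝ) < (m : ℝ) - 1 ↔ x + 1 < m := by
    rw [lt_sub_iff_add_lt]; exact_mod_cast Iff.rfl
  have h2 : (y : ℝ) < (n : ℝ) - 1 ↔ y + 1 < n := by
    rw [lt_sub_iff_add_lt]; exact_mod_cast Iff.rfl
  simp only [h1, h2, Int.cast_pos]
  tauto

end rect

/-! ### Blocks and diamonds -/

/-- A product of two integral intervals in the coordinates `x + y` and `x - y`, given by the
endpoints that are excluded. -/
structure Block where
  s₁ : ℤ
  s₂ : ℤ
  d₁ : ℤ
  d₂ : ℤ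

/-- The integral point `(x, y)` lies in the block. -/
def Block.Mem (B : Block) (x y : ℤ) : Prop :=
  (B.s₁ < x + y ∧ x + y < B.s₂) ∧ B.d₁ < x - y ∧ x - y < B.d₂

/-- The octagon around a block. -/
def Block.oct (B : Block) : Set (ℝ × ℝ) :=
  {z | (B.s₁ + B.d₁ + 2 ≤ 2 * z.1 ∧ 2 * z.1 ≤ B.s₂ + B.d₂ - 2) ∧
    (B.s₁ - B.d₂ + 2 ≤ 2 * z.2 ∧ 2 * z.2 ≤ B.s₂ - B.d₁ - 2) ∧
    (B.s₁ ≤ z.1 + z.2 ∧ z.1 + z.2 ≤ B.s₂) ∧ B.d₁ ≤ z.1 - z.2 ∧ z.1 - z.2 ≤ B.d₂}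

/-- The open octagon around a block. -/
def Block.octInt (B : Block) : Set (ℝ × ℝ) :=
  {z | (B.s₁ + B.d₁ + 2 < 2 * z.1 ∧ 2 * z.1 < B.s₂ + B.d₂ - 2) ∧
    (B.s₁ - B.d₂ + 2 < 2 * z.2 ∧ 2 * z.2 < B.s₂ - B.d₁ - 2) ∧
    (B.s₁ < z.1 + z.2 ∧ z.1 + z.2 < B.s₂) ∧ B.d₁ < z.1 - z.2 ∧ z.1 - z.2 < B.d₂}

theorem Block.oct_eq_poly (B : Block) : B.oct = poly ((B.s₁ + B.d₁ + 2) / 2)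
    ((B.s₂ + B.d₂ - 2) / 2) ((B.s₁ - B.d₂ + 2) / 2) ((B.s₂ - B.d₁ - 2) / 2)
    B.s₁ B.s₂ B.d₁ B.d₂ := by
  ext z
  simp only [oct, poly, Set.mem_ofPred_eq]
  rw [div_le_iff₀ two_pos, div_le_iff₀ two_pos, le_div_iff₀ two_pos, le_div_iff₀ two_pos,
    mul_comm z.1, mul_comm z.2]

theorem Block.interior_oct (B : Block) : interior B.oct = B.octInt := by
  rw [oct_eq_poly, interior_poly]
  ext z
  simp only [octInt, polyInt, Set.mem_ofPred_eq]
  rw [div_lt_iff₀ two_pos, div_lt_iff₀ two_pos, lt_div_iff₀ two_pos, lt_div_iff₀ two_pos,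
    mul_comm z.1, mul_comm z.2]

/-- The block has the parity of colour `c` and its octagon cuts out of `R` a tile: every side of
`R` either does not cut the octagon, or is at distance one from an axis of symmetry of it. -/
structure IsBlock (m n : ℕ) (c : Colour) (B : Block) : Prop where
  ps₁ : (B.s₁ - c.parity) % 2 = 0
  ps₂ : (B.s₂ - c.parity) % 2 = 0
  pd₁ : (B.d₁ - c.parity) % 2 = 0
  pd₂ : (B.d₂ - c.parity) % 2 = 0
  hs : B.s₁ + 4 ≤ B.s₂
  hd : B.d₁ + 4 ≤ B.d₂
  left : 0 ≤ B.s₁ + B.d₁ + 2 ∨ (B.s₁ + B.d₂ = -2 ∧ B.s₂ + B.d₁ = -2)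
  right : B.s₂ + B.d₂ ≤ 2 * m ∨ (B.s₁ + B.d₂ = 2 * m ∧ B.s₂ + B.d₁ = 2 * m)
  bottom : 0 ≤ B.s₁ - B.d₂ + 2 ∨ (B.s₁ - B.d₁ = -2 ∧ B.s₂ - B.d₂ = -2)
  top : B.s₂ - B.d₁ ≤ 2 * n ∨ (B.s₁ - B.d₁ = 2 * n ∧ B.s₂ - B.d₂ = 2 * n)
  nd₁ : 4 ≤ B.s₂ + B.d₂
  nd₂ : B.s₁ + B.d₁ + 6 ≤ 2 * m
  nd₃ : 4 ≤ B.s₂ - B.d₁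
  nd₄ : B.s₁ - B.d₂ + 6 ≤ 2 * n

/-- The tilted square with centre `(x, y)`. -/
def diamond (x y : ℤ) : Set (ℝ × ℝ) :=
  {z | (x + y - 1 ≤ z.1 + z.2 ∧ z.1 + z.2 ≤ x + y + 1) ∧
    x - y - 1 ≤ z.1 - z.2 ∧ z.1 - z.2 ≤ x - y + 1}

theorem diamond_eq_poly (x y : ℤ) : diamond x y = poly (x - 1) (x + 1) (y - 1) (y + 1)
    (x + y - 1) (x + y + 1) (x - y - 1) (x - y + 1) := by
  ext z
  simp only [diamond, poly, Set.mem_ofPred_eq]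
  constructor
  · rintro ⟨⟨h1, h2⟩, h3, h4⟩
    exact ⟨⟨by linarith, by linarith⟩, ⟨by linarith, by linarith⟩, ⟨h1, h2⟩, h3, h4⟩
  · rintro ⟨-, -, h⟩
    exact h

theorem interior_diamond (x y : ℤ) : interior (diamond x y) =
    {z : ℝ × ℝ | ((x + y - 1 : ℝ) < z.1 + z.2 ∧ z.1 + z.2 < x + y + 1) ∧
    (x - y - 1 : ℝ) < z.1 - z.2 ∧ z.1 - z.2 < x - y + 1} := by
  rw [diamond_eq_poly, interior_poly]
  ext z
  simp only [polyInt, Set.mem_ofPred_eq]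
  constructor
  · rintro ⟨-, -, h⟩
    exact h
  · rintro ⟨⟨h1, h2⟩, h3, h4⟩
    exact ⟨⟨by linarith, by linarith⟩, ⟨by linarith, by linarith⟩, ⟨h1, h2⟩, h3, h4⟩

/-! ### Colours of the vertices -/

/-- The sum of the coordinates of the coloured vertices of a shape in reference position, up to
parity. -/
def Shape.parity : Shape → ℤ
  | .triangle a _ => a
  | _ => 0

/-- All coloured vertices of a shape have coordinate sums of the same parity, so the colour of the
whole tile is decided by its position. -/
theorem Shape.exists_int_of_mem_colourVertices {s : Shape} {p : ℝ × ℝ}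
    (hp : p ∈ s.colourVertices) :
    ∃ e f : ℤ, p = ((e : ℝ), (f : ℝ)) ∧ (e + f - s.parity) % 2 = 0 := by
  have key : ∀ (e f : ℤ), p = ((e : ℝ), (f : ℝ)) → (e + f - s.parity) % 2 = 0 →
    ∃ e f : ℤ, p = ((e : ℝ), (f : ℝ)) ∧ (e + f - s.parity) % 2 = 0 :=
    fun e f h h' => ⟨e, f, h, h'⟩
  rcases s with ⟨a, b, ha, hb⟩ | ⟨a, ha⟩ | _ | _ | ⟨a, ha⟩ | ⟨a, ha⟩ <;>
    simp only [Shape.colourVertices, Shape.vertices, Set.mem_insert_iff,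
      Set.mem_singleton_iff] at hp
  · rcases hp with h | h | h | h | h | h | h | h
    · exact key 0 0 (by simp [h]) (by simp [parity])
    · exact key 2 0 (by simp [h]) (by simp [parity])
    · exact key (2 + a) a (by simp [h]) (by simp only [parity]; omega)
    · exact key (2 + a) (2 + a) (by simp [h]) (by simp only [parity]; omega)
    · exact key (2 + a - b) (2 + a + b) (by simp [h]) (by simp only [parity]; omega)
    · exact key (a - b) (2 + a + b) (by simp [h]) (by simp only [parity]; omega)
    · exact key (-b) (2 + b) (by simp [h]) (by simp only [parity]; omega)
    · exact key (-b) b (by simp [h]) (by simp only [parity]; omega)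
  · rcases hp with h | h | h | h | h | h
    · exact key 0 0 (by simp [h]) (by simp [parity])
    · exact key 2 0 (by simp [h]) (by simp [parity])
    · exact key (2 + a) a (by simp [h]) (by simp only [parity]; omega)
    · exact key (2 + a) (2 + a) (by simp [h]) (by simp only [parity]; omega)
    · exact key a (2 + a) (by simp [h]) (by simp only [parity]; omega)
    · exact key 0 2 (by simp [h]) (by simp [parity])
  · rcases hp with h | h | h | h
    · exact key 0 0 (by simp [h]) (by simp [parity])
    · exact key 2 0 (by simp [h]) (by simp [parity])
    · exact key 2 2 (by simp [h]) (by simp [parity])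
    · exact key 0 2 (by simp [h]) (by simp [parity])
  · rcases hp with h | h | h | h
    · exact key 0 0 (by simp [h]) (by simp [parity])
    · exact key 1 1 (by simp [h]) (by simp [parity])
    · exact key 0 2 (by simp [h]) (by simp [parity])
    · exact key (-1) 1 (by simp [h]) (by simp [parity])
  · rcases hp with h | h | h | h
    · exact key 0 0 (by simp [h]) (by simp [parity])
    · exact key (2 + 2 * a) 0 (by simp [h]) (by simp only [parity]; omega)
    · exact key (2 + a) a (by simp [h]) (by simp only [parity]; omega)
    · exact key a a (by simp [h]) (by simp only [parity]; omega)
  · rcases hp with h | h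
    · exact key a 0 (by simp [h]) (by simp [parity])
    · exact key 0 a (by simp [h]) (by simp [parity])

theorem Shape.exists_mem_colourVertices (s : Shape) : ∃ p, p ∈ s.colourVertices := by
  cases s <;> exact ⟨_, Or.inl rfl⟩

/-- Rotations preserve the parity of the coordinate sum, since a coordinate and its negative have
the same parity. -/
theorem place_int (k : Fin 4) (i j e f : ℤ) : ∃ e' f' : ℤ,
    place k ((i : ℝ), (j : ℝ)) ((e : ℝ), (f : ℝ)) = ((e' : ℝ), (f' : ℝ)) ∧
    (e' + f' - (i + j + e + f)) % 2 = 0 := by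
  fin_cases k
  · exact ⟨e + i, f + j, by simp [place_zero], by omega⟩
  · exact ⟨-f + i, e + j, by simp [place_one], by omega⟩
  · exact ⟨-e + i, -f + j, by simp [place_two], by omega⟩
  · exact ⟨f + i, -e + j, by simp [place_three], by omega⟩

theorem exists_hasColour_of_mem_colourVertices {c : Colour} {s : Shape} {i j : ℤ} (k : Fin 4)
    (h : (i + j + s.parity - c.parity) % 2 = 0) : ∀ p ∈ s.colourVertices,
    ∃ q : ℤ × ℤ, HasColour c q ∧ place k ((i : ℝ), (j : ℝ)) p = toReal q := by
  intro p hp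
  obtain ⟨e, f, rfl, hef⟩ := Shape.exists_int_of_mem_colourVertices hp
  obtain ⟨e', f', h1, h2⟩ := place_int k i j e f
  exact ⟨(e', f'), (hasColour_iff _ _ _).2 (by omega), h1⟩

/-- A single coloured vertex already forces the translation vector to be integral and fixes its
parity. -/
theorem exists_int_of_isColoured {c : Colour} {s : Shape} {k : Fin 4} {v : ℝ × ℝ}
    (h : ∀ p ∈ s.colourVertices, ∃ q : ℤ × ℤ, HasColour c q ∧ place k v p = toReal q) :
    ∃ i j : ℤ, v = ((i : ℝ), (j : ℝ)) ∧ (i + j + s.parity - c.parity) % 2 = 0 := by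
  obtain ⟨p, hp⟩ := s.exists_mem_colourVertices
  obtain ⟨⟨x, y⟩, hq, hpq⟩ := h p hp
  obtain ⟨e, f, rfl, hef⟩ := Shape.exists_int_of_mem_colourVertices hp
  rw [hasColour_iff] at hq
  obtain ⟨v₁, v₂⟩ := v
  have key : ∀ i j : ℤ, v₁ = i → v₂ = j → (i + j + s.parity - c.parity) % 2 = 0 →
    ∃ i j : ℤ, (v₁, v₂) = ((i : ℝ), (j : ℝ)) ∧ (i + j + s.parity - c.parity) % 2 = 0 :=
    fun i j h1 h2 h3 => ⟨i, j, by rw [h1, h2], h3⟩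
  fin_cases k
  · simp only [Fin.zero_eta, place_zero, toReal, Prod.mk.injEq] at hpq
    refine key (x - e) (y - f) ?_ ?_ (by omega) <;> push_cast <;> linarith
  · simp only [Fin.mk_one, place_one, toReal, Prod.mk.injEq] at hpq
    refine key (x + f) (y - e) ?_ ?_ (by omega) <;> push_cast <;> linarith
  · simp only [Fin.reduceFinMk, place_two, toReal, Prod.mk.injEq] at hpq
    refine key (x + e) (y + f) ?_ ?_ (by omega) <;> push_cast <;> linarith
  · simp only [Fin.reduceFinMk, place_three, toReal, Prod.mk.injEq] at hpq
    refine key (x - f) (y + e) ?_ ?_ (by omega) <;> push_cast <;> linarith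

/-! ### Dashed sides -/

theorem mem_dashed_trapezoid {a : ℕ} {ha : 0 < a} {p : ℝ × ℝ}
    (hp : p ∈ (Shape.trapezoid a ha).dashed) :
    p ∈ convexHull ℝ (Shape.trapezoid a ha).vertices ∧ p.2 = 0 := by
  constructor
  · refine (convex_convexHull ℝ _).segment_subset (subset_convexHull ℝ _ ?_)
      (subset_convexHull ℝ _ ?_) hp <;> simp [Shape.vertices]
  · obtain ⟨α, β, -, -, -, rfl⟩ := hp
    simp

theorem mem_dashed_triangle {a : ℕ} {ha : 0 < a} {p : ℝ × ℝ}
    (hp : p ∈ (Shape.triangle a ha).dashed) :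
    p ∈ convexHull ℝ (Shape.triangle a ha).vertices ∧ (p.1 = 0 ∨ p.2 = 0) := by
  constructor
  · rcases hp with hp | hp
    · refine (convex_convexHull ℝ _).segment_subset (subset_convexHull ℝ _ ?_)
        (subset_convexHull ℝ _ ?_) hp <;> simp [Shape.vertices]
    · refine (convex_convexHull ℝ _).segment_subset (subset_convexHull ℝ _ ?_)
        (subset_convexHull ℝ _ ?_) hp <;> simp [Shape.vertices]
  · rcases hp with ⟨α, β, -, -, -, rfl⟩ | ⟨α, β, -, -, -, rfl⟩
    · right; simp
    · left; simp

section builders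
variable {m n : ℕ} {c : Colour} {t : Set (ℝ × ℝ)} (k : Fin 4) (i j : ℤ)

theorem isColouredTile_of_dashed_eq_empty {s : Shape} (hs : s.dashed = ∅)
    (h : (i + j + s.parity - c.parity) % 2 = 0)
    (ht : t = place k ((i : ℝ), (j : ℝ)) '' convexHull ℝ s.vertices) : IsColouredTile m n c t := by
  refine ⟨s, k, _, ⟨ht, ?_⟩, exists_hasColour_of_mem_colourVertices k h⟩
  rw [hs, Set.image_empty]
  exact Set.empty_subset _

/-- It is enough that the line of the large base is carried to the line of a side of `R`;
containment of the tile in `R` then puts the base on the boundary. -/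
theorem isColouredTile_trapezoid {a : ℕ} (ha : 0 < a) (h : (i + j - c.parity) % 2 = 0)
    (ht : t = place k ((i : ℝ), (j : ℝ)) '' convexHull ℝ (Shape.trapezoid a ha).vertices)
    (hr : t ⊆ rect m n)
    (hb : ∀ x : ℝ, (place k ((i : ℝ), (j : ℝ)) (x, 0)).1 = 0 ∨
      (place k ((i : ℝ), (j : ℝ)) (x, 0)).1 = (m : ℝ) - 1 ∨
      (place k ((i : ℝ), (j : ℝ)) (x, 0)).2 = 0 ∨
      (place k ((i : ℝ), (j : ℝ)) (x, 0)).2 = (n : ℝ) - 1) : IsColouredTile m n c t := by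
  refine ⟨_, k, _, ⟨ht, ?_⟩, exists_hasColour_of_mem_colourVertices k
    (by simpa only [Shape.parity, add_zero] using h)⟩
  rintro _ ⟨⟨x, y⟩, hp, rfl⟩
  obtain ⟨h1, h2⟩ := mem_dashed_trapezoid hp
  obtain rfl : y = 0 := h2
  exact mem_frontier_rect.2 ⟨hr (ht ▸ Set.mem_image_of_mem _ h1), hb x⟩

theorem isColouredTile_triangle {a : ℕ} (ha : 0 < a) (h : (i + j + a - c.parity) % 2 = 0)
    (ht : t = place k ((i : ℝ), (j : ℝ)) '' convexHull ℝ (Shape.triangle a ha).vertices)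
    (hr : t ⊆ rect m n)
    (hb : ∀ p : ℝ × ℝ, p.1 = 0 ∨ p.2 = 0 → (place k ((i : ℝ), (j : ℝ)) p).1 = 0 ∨
      (place k ((i : ℝ), (j : ℝ)) p).1 = (m : ℝ) - 1 ∨
      (place k ((i : ℝ), (j : ℝ)) p).2 = 0 ∨
      (place k ((i : ℝ), (j : ℝ)) p).2 = (n : ℝ) - 1) : IsColouredTile m n c t := by
  refine ⟨_, k, _, ⟨ht, ?_⟩, exists_hasColour_of_mem_colourVertices k
    (by simpa only [Shape.parity, add_zero] using h)⟩
  rintro _ ⟨p, hp, rfl⟩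
  obtain ⟨h1, h2⟩ := mem_dashed_triangle hp
  exact mem_frontier_rect.2 ⟨hr (ht ▸ Set.mem_image_of_mem _ h1), hb p h2⟩

end builders

theorem isColouredTile_diamond {m n : ℕ} {c : Colour} {x y : ℤ}
    (h : (x + y - c.parity) % 2 = 1) : IsColouredTile m n c (diamond x y) := by
  refine isColouredTile_of_dashed_eq_empty 0 x (y - 1) (s := .tiltedSquare) rfl
    (by simp only [Shape.parity]; omega) ?_
  rw [convexHull_tiltedSquare, place_zero_poly, diamond_eq_poly]
  push_cast
  congr 1 <;> ring

/-! ### The tiles inside `R` are diamonds and truncated octagons of blocks -/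

section blocks
variable {m n : ℕ} {c : Colour}

/-- The parameters may vanish: both zero gives the square, exactly one zero gives one of the two
orientations of the hexagon. -/
theorem isColouredTile_octagon {a b : ℕ} {i j : ℤ} {t : Set (ℝ × ℝ)}
    (hc : (i + j - c.parity) % 2 = 0)
    (ht : t = poly (i - b) (i + 2 + a) j (j + 2 + a + b) (i + j) (i + j + 4 + 2 * a)
      (i - j - 2 - 2 * b) (i - j + 2)) : IsColouredTile m n c t := by
  rcases Nat.eq_zero_or_pos a with rfl | ha <;> rcases Nat.eq_zero_or_pos b with rfl | hb
  · refine isColouredTile_of_dashed_eq_empty 0 i j (s := .square) rfl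
      (by simpa only [Shape.parity, add_zero] using hc) ?_
    rw [ht, convexHull_square, place_zero_poly]
    push_cast
    congr 1 <;> ring
  · refine isColouredTile_of_dashed_eq_empty 1 (i + 2) j (s := .hexagon b hb) rfl
      (by simp only [Shape.parity]; omega) ?_
    rw [ht, convexHull_hexagon, place_one_poly]
    push_cast
    congr 1 <;> ring
  · refine isColouredTile_of_dashed_eq_empty 0 i j (s := .hexagon a ha) rfl
      (by simpa only [Shape.parity, add_zero] using hc) ?_
    rw [ht, convexHull_hexagon, place_zero_poly]
    push_cast
    congr 1 <;> ring
  · refine isColouredTile_of_dashed_eq_empty 0 i j (s := .octagon a b ha hb) rfl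
      (by simpa only [Shape.parity, add_zero] using hc) ?_
    rw [ht, convexHull_octagon, place_zero_poly]
    push_cast
    congr 1 <;> ring

/-- The cases are distinguished by the sides of `R` that cut the octagon. Symmetry about a
horizontal or vertical axis forces `a = b`, and a cut at distance one from that axis runs through
the ends of the two sides of length two that cross the axis, leaving a trapezoid. Cuts by two
adjacent sides leave a triangle; cuts by two opposite sides are contradictory. -/
theorem IsBlock.isColouredTile {B : Block} (hB : IsBlock m n c B) :
    IsColouredTile m n c (B.oct ∩ rect m n) := by
  obtain ⟨ps₁, ps₂, pd₁, pd₂, hs, hd, left, right, bottom, top, nd₁, nd₂, nd₃, nd₄⟩ := hB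
  have hsub : B.oct ∩ rect m n ⊆ rect m n := Set.inter_subset_right
  obtain ⟨s₁, s₂, d₁, d₂⟩ := B
  simp only at *
  -- The point `(i, j)` is the left end of the bottom side of the octagon, and `a`, `b` measure the
  -- excess of the two widths of the block over the minimal width 4.
  obtain ⟨i, j, a, b, rfl, rfl, rfl, rfl⟩ : ∃ (i j : ℤ) (a b : ℕ), s₁ = i + j ∧
      s₂ = i + j + 4 + 2 * a ∧ d₁ = i - j - 2 - 2 * b ∧ d₂ = i - j + 2 :=
    ⟨(s₁ + d₂) / 2 - 1, (s₁ - d₂) / 2 + 1, ((s₂ - s₁) / 2 - 2).toNat, ((d₂ - d₁) / 2 - 2).toNat,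
      by omega, by omega, by omega, by omega⟩
  have ha0 : (0 : ℝ) ≤ a := a.cast_nonneg
  have hm : (i + a + 3 ≤ m ∨ i = m - 1) ∧ (j + a + b + 3 ≤ n ∨ j + b = n - 1) ∧
      (0 ≤ i - b ∨ i = -2) ∧ (0 ≤ j ∨ j = -2 - b) := by omega
  rcases left with hl | ⟨hl, hl'⟩
  · rcases right with hr | ⟨hr, hr'⟩
    · rcases bottom with hb | ⟨hb, hb'⟩
      · rcases top with ht | ⟨ht, ht'⟩
        · apply isColouredTile_octagon (a := a) (b := b) (i := i) (j := j) (by omega)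
          have h1 : (0 : ℝ) ≤ i - b := by exact_mod_cast (show (0 : ℤ) ≤ i - b by omega)
          have h2 : (i : ℝ) + 2 + a ≤ m - 1 := by
            exact_mod_cast (show (i : ℤ) + 2 + a ≤ m - 1 by omega)
          have h3 : (0 : ℝ) ≤ j := by exact_mod_cast (show (0 : ℤ) ≤ j by omega)
          have h4 : (j : ℝ) + 2 + a + b ≤ n - 1 := by
            exact_mod_cast (show (j : ℤ) + 2 + a + b ≤ n - 1 by omega)
          ext z
          simp only [Block.oct, poly, Set.mem_inter_iff, mem_rect, Set.mem_ofPred_eq]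
          push_cast
          constructor
          · rintro ⟨⟨⟨_, _⟩, ⟨_, _⟩, ⟨_, _⟩, _, _⟩, -⟩
            refine ⟨⟨?_, ?_⟩, ⟨?_, ?_⟩, ⟨?_, ?_⟩, ?_, ?_⟩ <;> linarith
          · rintro ⟨⟨_, _⟩, ⟨_, _⟩, ⟨_, _⟩, _, _⟩
            refine ⟨⟨⟨?_, ?_⟩, ⟨?_, ?_⟩, ⟨?_, ?_⟩, ?_, ?_⟩, ⟨?_, ?_⟩, ?_, ?_⟩ <;> linarith
        · obtain rfl : a = b := by omega
          obtain rfl : j = n - 1 - a := by omega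
          have h1 : (0 : ℝ) ≤ i - a := by exact_mod_cast (show (0 : ℤ) ≤ i - a by omega)
          have h2 : (i : ℝ) + 2 + a ≤ m - 1 := by
            exact_mod_cast (show (i : ℤ) + 2 + a ≤ m - 1 by omega)
          have h3 : (0 : ℝ) ≤ n - 1 - a := by
            exact_mod_cast (show (0 : ℤ) ≤ (n : ℤ) - 1 - a by omega)
          refine isColouredTile_trapezoid 2 (i + 2 + a) (n - 1) (a := a) (by omega) (by omega) ?_
            hsub ?_
          · rw [convexHull_trapezoid, place_two_poly]
            ext z
            simp only [Block.oct, poly, Set.mem_inter_iff, mem_rect, Set.mem_ofPred_eq]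
            push_cast
            constructor
            · rintro ⟨⟨⟨_, _⟩, ⟨_, _⟩, ⟨_, _⟩, _, _⟩, ⟨_, _⟩, _, _⟩
              refine ⟨⟨?_, ?_⟩, ⟨?_, ?_⟩, ⟨?_, ?_⟩, ?_, ?_⟩ <;> linarith
            · rintro ⟨⟨_, _⟩, ⟨_, _⟩, ⟨_, _⟩, _, _⟩
              refine ⟨⟨⟨?_, ?_⟩, ⟨?_, ?_⟩, ⟨?_, ?_⟩, ?_, ?_⟩, ⟨?_, ?_⟩, ?_, ?_⟩ <;> linarith
          · intro x
            simp [place_two]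
      · rcases top with ht | ⟨ht, ht'⟩
        · obtain rfl : a = b := by omega
          obtain rfl : j = -2 - a := by omega
          have h1 : (0 : ℝ) ≤ i - a := by exact_mod_cast (show (0 : ℤ) ≤ i - a by omega)
          have h2 : (i : ℝ) + 2 + a ≤ m - 1 := by
            exact_mod_cast (show (i : ℤ) + 2 + a ≤ m - 1 by omega)
          have h3 : (a : ℝ) ≤ n - 1 := by exact_mod_cast (show (a : ℤ) ≤ n - 1 by omega)
          refine isColouredTile_trapezoid 0 (i - a) 0 (a := a) (by omega) (by omega) ?_
            hsub ?_
          · rw [convexHull_trapezoid, place_zero_poly]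
            ext z
            simp only [Block.oct, poly, Set.mem_inter_iff, mem_rect, Set.mem_ofPred_eq]
            push_cast
            constructor
            · rintro ⟨⟨⟨_, _⟩, ⟨_, _⟩, ⟨_, _⟩, _, _⟩, ⟨_, _⟩, _, _⟩
              refine ⟨⟨?_, ?_⟩, ⟨?_, ?_⟩, ⟨?_, ?_⟩, ?_, ?_⟩ <;> linarith
            · rintro ⟨⟨_, _⟩, ⟨_, _⟩, ⟨_, _⟩, _, _⟩
              refine ⟨⟨⟨?_, ?_⟩, ⟨?_, ?_⟩, ⟨?_, ?_⟩, ?_, ?_⟩, ⟨?_, ?_⟩, ?_, ?_⟩ <;> linarith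
          · intro x
            simp [place_zero]
        · omega
    · rcases bottom with hb | ⟨hb, hb'⟩
      · rcases top with ht | ⟨ht, ht'⟩
        · obtain rfl : a = b := by omega
          obtain rfl : i = m - 1 := by omega
          have h1 : (0 : ℝ) ≤ m - 1 - a := by
            exact_mod_cast (show (0 : ℤ) ≤ (m : ℤ) - 1 - a by omega)
          have h2 : (0 : ℝ) ≤ j := by exact_mod_cast (show (0 : ℤ) ≤ j by omega)
          have h3 : (j : ℝ) + 2 + 2 * a ≤ n - 1 := by
            exact_mod_cast (show (j : ℤ) + 2 + 2 * a ≤ n - 1 by omega)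
          refine isColouredTile_trapezoid 1 (m - 1) j (a := a) (by omega) (by omega) ?_
            hsub ?_
          · rw [convexHull_trapezoid, place_one_poly]
            ext z
            simp only [Block.oct, poly, Set.mem_inter_iff, mem_rect, Set.mem_ofPred_eq]
            push_cast
            constructor
            · rintro ⟨⟨⟨_, _⟩, ⟨_, _⟩, ⟨_, _⟩, _, _⟩, ⟨_, _⟩, _, _⟩
              refine ⟨⟨?_, ?_⟩, ⟨?_, ?_⟩, ⟨?_, ?_⟩, ?_, ?_⟩ <;> linarith
            · rintro ⟨⟨_, _⟩, ⟨_, _⟩, ⟨_, _⟩, _, _⟩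
              refine ⟨⟨⟨?_, ?_⟩, ⟨?_, ?_⟩, ⟨?_, ?_⟩, ?_, ?_⟩, ⟨?_, ?_⟩, ?_, ?_⟩ <;> linarith
          · intro x
            simp [place_one]
        · obtain rfl : a = b := by omega
          obtain rfl : i = m - 1 := by omega
          obtain rfl : j = n - 1 - a := by omega
          have h1 : (0 : ℝ) ≤ m - 1 - a := by
            exact_mod_cast (show (0 : ℤ) ≤ (m : ℤ) - 1 - a by omega)
          have h2 : (0 : ℝ) ≤ n - 1 - a := by
            exact_mod_cast (show (0 : ℤ) ≤ (n : ℤ) - 1 - a by omega)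
          refine isColouredTile_triangle 2 (m - 1) (n - 1) (a := a) (by omega) (by omega) ?_
            hsub ?_
          · rw [convexHull_triangle, place_two_poly]
            ext z
            simp only [Block.oct, poly, Set.mem_inter_iff, mem_rect, Set.mem_ofPred_eq]
            push_cast
            constructor
            · rintro ⟨⟨⟨_, _⟩, ⟨_, _⟩, ⟨_, _⟩, _, _⟩, ⟨_, _⟩, _, _⟩
              refine ⟨⟨?_, ?_⟩, ⟨?_, ?_⟩, ⟨?_, ?_⟩, ?_, ?_⟩ <;> linarith
            · rintro ⟨⟨_, _⟩, ⟨_, _⟩, ⟨_, _⟩, _, _⟩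
              refine ⟨⟨⟨?_, ?_⟩, ⟨?_, ?_⟩, ⟨?_, ?_⟩, ?_, ?_⟩, ⟨?_, ?_⟩, ?_, ?_⟩ <;> linarith
          · rintro p (hp | hp) <;> simp [place_two, hp]
      · rcases top with ht | ⟨ht, ht'⟩
        · obtain rfl : a = b := by omega
          obtain rfl : i = m - 1 := by omega
          obtain rfl : j = -2 - a := by omega
          have h1 : (0 : ℝ) ≤ m - 1 - a := by
            exact_mod_cast (show (0 : ℤ) ≤ (m : ℤ) - 1 - a by omega)
          have h2 : (a : ℝ) ≤ n - 1 := by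
            exact_mod_cast (show (a : ℤ) ≤ (n : ℤ) - 1 by omega)
          refine isColouredTile_triangle 1 (m - 1) 0 (a := a) (by omega) (by omega) ?_
            hsub ?_
          · rw [convexHull_triangle, place_one_poly]
            ext z
            simp only [Block.oct, poly, Set.mem_inter_iff, mem_rect, Set.mem_ofPred_eq]
            push_cast
            constructor
            · rintro ⟨⟨⟨_, _⟩, ⟨_, _⟩, ⟨_, _⟩, _, _⟩, ⟨_, _⟩, _, _⟩
              refine ⟨⟨?_, ?_⟩, ⟨?_, ?_⟩, ⟨?_, ?_⟩, ?_, ?_⟩ <;> linarith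
            · rintro ⟨⟨_, _⟩, ⟨_, _⟩, ⟨_, _⟩, _, _⟩
              refine ⟨⟨⟨?_, ?_⟩, ⟨?_, ?_⟩, ⟨?_, ?_⟩, ?_, ?_⟩, ⟨?_, ?_⟩, ?_, ?_⟩ <;> linarith
          · rintro p (hp | hp) <;> simp [place_one, hp]
        · omega
  · rcases right with hr | ⟨hr, hr'⟩
    · rcases bottom with hb | ⟨hb, hb'⟩
      · rcases top with ht | ⟨ht, ht'⟩
        · obtain rfl : a = b := by omega
          obtain rfl : i = -2 := by omega
          have h1 : (a : ℝ) ≤ m - 1 := by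
            exact_mod_cast (show (a : ℤ) ≤ (m : ℤ) - 1 by omega)
          have h2 : (0 : ℝ) ≤ j := by exact_mod_cast (show (0 : ℤ) ≤ j by omega)
          have h3 : (j : ℝ) + 2 + 2 * a ≤ n - 1 := by
            exact_mod_cast (show (j : ℤ) + 2 + 2 * a ≤ n - 1 by omega)
          refine isColouredTile_trapezoid 3 0 (j + 2 + 2 * a) (a := a) (by omega) (by omega) ?_
            hsub ?_
          · rw [convexHull_trapezoid, place_three_poly]
            ext z
            simp only [Block.oct, poly, Set.mem_inter_iff, mem_rect, Set.mem_ofPred_eq]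
            push_cast
            constructor
            · rintro ⟨⟨⟨_, _⟩, ⟨_, _⟩, ⟨_, _⟩, _, _⟩, ⟨_, _⟩, _, _⟩
              refine ⟨⟨?_, ?_⟩, ⟨?_, ?_⟩, ⟨?_, ?_⟩, ?_, ?_⟩ <;> linarith
            · rintro ⟨⟨_, _⟩, ⟨_, _⟩, ⟨_, _⟩, _, _⟩
              refine ⟨⟨⟨?_, ?_⟩, ⟨?_, ?_⟩, ⟨?_, ?_⟩, ?_, ?_⟩, ⟨?_, ?_⟩, ?_, ?_⟩ <;> linarith
          · intro x
            simp [place_three]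
        · obtain rfl : a = b := by omega
          obtain rfl : i = -2 := by omega
          obtain rfl : j = n - 1 - a := by omega
          have h1 : (a : ℝ) ≤ m - 1 := by
            exact_mod_cast (show (a : ℤ) ≤ (m : ℤ) - 1 by omega)
          have h2 : (0 : ℝ) ≤ n - 1 - a := by
            exact_mod_cast (show (0 : ℤ) ≤ (n : ℤ) - 1 - a by omega)
          refine isColouredTile_triangle 3 0 (n - 1) (a := a) (by omega) (by omega) ?_
            hsub ?_
          · rw [convexHull_triangle, place_three_poly]
            ext z
            simp only [Block.oct, poly, Set.mem_inter_iff, mem_rect, Set.mem_ofPred_eq]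
            push_cast
            constructor
            · rintro ⟨⟨⟨_, _⟩, ⟨_, _⟩, ⟨_, _⟩, _, _⟩, ⟨_, _⟩, _, _⟩
              refine ⟨⟨?_, ?_⟩, ⟨?_, ?_⟩, ⟨?_, ?_⟩, ?_, ?_⟩ <;> linarith
            · rintro ⟨⟨_, _⟩, ⟨_, _⟩, ⟨_, _⟩, _, _⟩
              refine ⟨⟨⟨?_, ?_⟩, ⟨?_, ?_⟩, ⟨?_, ?_⟩, ?_, ?_⟩, ⟨?_, ?_⟩, ?_, ?_⟩ <;> linarith
          · rintro p (hp | hp) <;> simp [place_three, hp]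
      · rcases top with ht | ⟨ht, ht'⟩
        · obtain rfl : a = b := by omega
          obtain rfl : i = -2 := by omega
          obtain rfl : j = -2 - a := by omega
          have h1 : (a : ℝ) ≤ m - 1 := by
            exact_mod_cast (show (a : ℤ) ≤ (m : ℤ) - 1 by omega)
          have h2 : (a : ℝ) ≤ n - 1 := by
            exact_mod_cast (show (a : ℤ) ≤ (n : ℤ) - 1 by omega)
          refine isColouredTile_triangle 0 0 0 (a := a) (by omega) (by omega) ?_
            hsub ?_
          · rw [convexHull_triangle, place_zero_poly]
            ext z
            simp only [Block.oct, poly, Set.mem_inter_iff, mem_rect, Set.mem_ofPred_eq]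
            push_cast
            constructor
            · rintro ⟨⟨⟨_, _⟩, ⟨_, _⟩, ⟨_, _⟩, _, _⟩, ⟨_, _⟩, _, _⟩
              refine ⟨⟨?_, ?_⟩, ⟨?_, ?_⟩, ⟨?_, ?_⟩, ?_, ?_⟩ <;> linarith
            · rintro ⟨⟨_, _⟩, ⟨_, _⟩, ⟨_, _⟩, _, _⟩
              refine ⟨⟨⟨?_, ?_⟩, ⟨?_, ?_⟩, ⟨?_, ?_⟩, ?_, ?_⟩, ⟨?_, ?_⟩, ?_, ?_⟩ <;> linarith
          · rintro p (hp | hp) <;> simp [place_zero, hp]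
        · omega
    · omega

end blocks

section converse
variable {m n : ℕ} {c : Colour}

theorem inRect_of_mem {t : Set (ℝ × ℝ)} (hr : t ⊆ rect m n) {z : ℝ × ℝ} (hz : z ∈ t) {x y : ℤ}
    (hx : z.1 = x) (hy : z.2 = y) : InRect m n x y := by
  rw [← intCast_mem_rect, ← hx, ← hy]
  exact hr hz

theorem exists_block_of_octagon {a b : ℕ} {i j : ℤ} {t : Set (ℝ × ℝ)} (hr : t ⊆ rect m n)
    (hc : (i + j - c.parity) % 2 = 0)
    (ht : t = poly (i - b) (i + 2 + a) j (j + 2 + a + b) (i + j) (i + j + 4 + 2 * a)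
      (i - j - 2 - 2 * b) (i - j + 2)) : ∃ B, IsBlock m n c B ∧ t = B.oct ∩ rect m n := by
  have ha : (0 : ℝ) ≤ a := a.cast_nonneg
  have hb : (0 : ℝ) ≤ b := b.cast_nonneg
  have m1 : InRect m n (i - b) (j + b) := by
    refine inRect_of_mem hr (z := ((i - b : ℝ), (j + b : ℝ))) ?_ (by push_cast; rfl)
      (by push_cast; rfl)
    rw [ht]
    refine ⟨⟨?_, ?_⟩, ⟨?_, ?_⟩, ⟨?_, ?_⟩, ?_, ?_⟩ <;> simp only <;> linarith
  have m2 : InRect m n i j := by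
    refine inRect_of_mem hr (z := ((i : ℝ), (j : ℝ))) ?_ rfl rfl
    rw [ht]
    refine ⟨⟨?_, ?_⟩, ⟨?_, ?_⟩, ⟨?_, ?_⟩, ?_, ?_⟩ <;> simp only <;> linarith
  have m3 : InRect m n (i + 2 + a) (j + 2 + a) := by
    refine inRect_of_mem hr (z := ((i + 2 + a : ℝ), (j + 2 + a : ℝ))) ?_ (by push_cast; rfl)
      (by push_cast; rfl)
    rw [ht]
    refine ⟨⟨?_, ?_⟩, ⟨?_, ?_⟩, ⟨?_, ?_⟩, ?_, ?_⟩ <;> simp only <;> linarith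
  have m4 : InRect m n (i + a - b) (j + 2 + a + b) := by
    refine inRect_of_mem hr (z := ((i + a - b : ℝ), (j + 2 + a + b : ℝ))) ?_ (by push_cast; rfl)
      (by push_cast; rfl)
    rw [ht]
    refine ⟨⟨?_, ?_⟩, ⟨?_, ?_⟩, ⟨?_, ?_⟩, ?_, ?_⟩ <;> simp only <;> linarith
  unfold InRect at *
  refine ⟨⟨i + j, i + j + 4 + 2 * a, i - j - 2 - 2 * b, i - j + 2⟩, ?_, ?_⟩
  · constructor <;> simp only <;> omega
  · rw [← Set.inter_eq_self_of_subset_left hr]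
    congr 1
    rw [ht, Block.oct_eq_poly]
    push_cast
    congr 1 <;> ring

theorem exists_block_of_trapezoid {k : Fin 4} {i j : ℤ} {a : ℕ} (ha : 0 < a) {t : Set (ℝ × ℝ)}
    (hr : t ⊆ rect m n) (hc : (i + j - c.parity) % 2 = 0)
    (ht : t = place k ((i : ℝ), (j : ℝ)) '' convexHull ℝ (Shape.trapezoid a ha).vertices)
    (hf : place k ((i : ℝ), (j : ℝ)) '' (Shape.trapezoid a ha).dashed ⊆ frontier (rect m n)) :
    ∃ B, IsBlock m n c B ∧ t = B.oct ∩ rect m n := by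
  have ha0 : (0 : ℝ) < a := by exact_mod_cast ha
  have v1 : place k ((i : ℝ), (j : ℝ)) (0, 0) ∈ rect m n := by
    apply hr; rw [ht]
    exact Set.mem_image_of_mem _ (subset_convexHull ℝ _ (by simp [Shape.vertices]))
  have v2 : place k ((i : ℝ), (j : ℝ)) (2 + 2 * (a : ℝ), 0) ∈ rect m n := by
    apply hr; rw [ht]
    exact Set.mem_image_of_mem _ (subset_convexHull ℝ _ (by simp [Shape.vertices]))
  have v3 : place k ((i : ℝ), (j : ℝ)) ((a : ℝ), (a : ℝ)) ∈ rect m n := by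
    apply hr; rw [ht]
    exact Set.mem_image_of_mem _ (subset_convexHull ℝ _ (by simp [Shape.vertices]))
  -- The midpoint of the large base is integral and lies strictly between the ends of the base, both
  -- in `R`. Being on the boundary, it forces the base onto a side of `R`; the vertex off the base
  -- decides which of the two parallel sides it is.
  have v4 : place k ((i : ℝ), (j : ℝ)) (1 + (a : ℝ), 0) ∉ interior (rect m n) := by
    have : place k ((i : ℝ), (j : ℝ)) (1 + (a : ℝ), 0) ∈ frontier (rect m n) := by
      apply hf
      refine Set.mem_image_of_mem _ ⟨1 / 2, 1 / 2, by norm_num, by norm_num, by norm_num, ?_⟩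
      simp only [Prod.smul_mk, Prod.mk_add_mk, smul_eq_mul]
      exact congrArg₂ Prod.mk (by ring) (by ring)
    exact this.2
  rw [convexHull_trapezoid] at ht
  fin_cases k
  · simp only [Fin.zero_eta, place_zero] at *
    rw [place_zero_poly] at ht
    simp only at ht
    have w1 := intCast_mem_rect (m := m) (n := n) (x := 0 + i) (y := 0 + j)
    have w2 := intCast_mem_rect (m := m) (n := n) (x := 2 + 2 * a + i) (y := 0 + j)
    have w3 := intCast_mem_rect (m := m) (n := n) (x := a + i) (y := a + j)
    have w4 := intCast_mem_interior_rect (m := m) (n := n) (x := 1 + a + i) (y := 0 + j)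
    push_cast at w1 w2 w3 w4
    rw [w1] at v1; rw [w2] at v2; rw [w3] at v3; rw [w4] at v4
    unfold InRect at *
    obtain rfl : j = 0 := by omega
    refine ⟨⟨i - 2, i + 2 + 2 * a, i, i + 4 + 2 * a⟩, ?_, ?_⟩
    · constructor <;> simp only <;> omega
    · rw [← Set.inter_eq_self_of_subset_left hr, ht]
      ext z
      simp only [Block.oct, poly, Set.mem_inter_iff, mem_rect, Set.mem_ofPred_eq]
      push_cast
      constructor
      · rintro ⟨⟨⟨_, _⟩, ⟨_, _⟩, ⟨_, _⟩, _, _⟩, ⟨_, _⟩, _, _⟩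
        refine ⟨⟨⟨?_, ?_⟩, ⟨?_, ?_⟩, ⟨?_, ?_⟩, ?_, ?_⟩, ⟨?_, ?_⟩, ?_, ?_⟩ <;> linarith
      · rintro ⟨⟨⟨_, _⟩, ⟨_, _⟩, ⟨_, _⟩, _, _⟩, ⟨_, _⟩, _, _⟩
        refine ⟨⟨⟨?_, ?_⟩, ⟨?_, ?_⟩, ⟨?_, ?_⟩, ?_, ?_⟩, ⟨?_, ?_⟩, ?_, ?_⟩ <;> linarith
  · simp only [Fin.mk_one, place_one] at *
    rw [place_one_poly] at ht
    simp only at ht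
    have w1 := intCast_mem_rect (m := m) (n := n) (x := -0 + i) (y := 0 + j)
    have w2 := intCast_mem_rect (m := m) (n := n) (x := -0 + i) (y := 2 + 2 * a + j)
    have w3 := intCast_mem_rect (m := m) (n := n) (x := -a + i) (y := a + j)
    have w4 := intCast_mem_interior_rect (m := m) (n := n) (x := -0 + i) (y := 1 + a + j)
    push_cast at w1 w2 w3 w4
    rw [w1] at v1; rw [w2] at v2; rw [w3] at v3; rw [w4] at v4
    unfold InRect at *
    obtain rfl : i = m - 1 := by omega
    refine ⟨⟨m - 1 + j, m + 3 + j + 2 * a, m - 3 - j - 2 * a, m + 1 - j⟩, ?_, ?_⟩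
    · constructor <;> simp only <;> omega
    · rw [← Set.inter_eq_self_of_subset_left hr, ht]
      ext z
      simp only [Block.oct, poly, Set.mem_inter_iff, mem_rect, Set.mem_ofPred_eq]
      push_cast
      constructor
      · rintro ⟨⟨⟨_, _⟩, ⟨_, _⟩, ⟨_, _⟩, _, _⟩, ⟨_, _⟩, _, _⟩
        refine ⟨⟨⟨?_, ?_⟩, ⟨?_, ?_⟩, ⟨?_, ?_⟩, ?_, ?_⟩, ⟨?_, ?_⟩, ?_, ?_⟩ <;> linarith
      · rintro ⟨⟨⟨_, _⟩, ⟨_, _⟩, ⟨_, _⟩, _, _⟩, ⟨_, _⟩, _, _⟩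
        refine ⟨⟨⟨?_, ?_⟩, ⟨?_, ?_⟩, ⟨?_, ?_⟩, ?_, ?_⟩, ⟨?_, ?_⟩, ?_, ?_⟩ <;> linarith
  · simp only [Fin.reduceFinMk, place_two] at *
    rw [place_two_poly] at ht
    simp only at ht
    have w1 := intCast_mem_rect (m := m) (n := n) (x := -0 + i) (y := -0 + j)
    have w2 := intCast_mem_rect (m := m) (n := n) (x := -(2 + 2 * a) + i) (y := -0 + j)
    have w3 := intCast_mem_rect (m := m) (n := n) (x := -a + i) (y := -a + j)
    have w4 := intCast_mem_interior_rect (m := m) (n := n) (x := -(1 + a) + i) (y := -0 + j)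
    push_cast at w1 w2 w3 w4
    rw [w1] at v1; rw [w2] at v2; rw [w3] at v3; rw [w4] at v4
    unfold InRect at *
    obtain rfl : j = n - 1 := by omega
    refine ⟨⟨i + n - 3 - 2 * a, i + n + 1, i - n - 3 - 2 * a, i - n + 1⟩, ?_, ?_⟩
    · constructor <;> simp only <;> omega
    · rw [← Set.inter_eq_self_of_subset_left hr, ht]
      ext z
      simp only [Block.oct, poly, Set.mem_inter_iff, mem_rect, Set.mem_ofPred_eq]
      push_cast
      constructor
      · rintro ⟨⟨⟨_, _⟩, ⟨_, _⟩, ⟨_, _⟩, _, _⟩, ⟨_, _⟩, _, _⟩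
        refine ⟨⟨⟨?_, ?_⟩, ⟨?_, ?_⟩, ⟨?_, ?_⟩, ?_, ?_⟩, ⟨?_, ?_⟩, ?_, ?_⟩ <;> linarith
      · rintro ⟨⟨⟨_, _⟩, ⟨_, _⟩, ⟨_, _⟩, _, _⟩, ⟨_, _⟩, _, _⟩
        refine ⟨⟨⟨?_, ?_⟩, ⟨?_, ?_⟩, ⟨?_, ?_⟩, ?_, ?_⟩, ⟨?_, ?_⟩, ?_, ?_⟩ <;> linarith
  · simp only [Fin.reduceFinMk, place_three_poly] at ht
    simp only [Fin.reduceFinMk, place_three] at *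
    have w1 := intCast_mem_rect (m := m) (n := n) (x := 0 + i) (y := -0 + j)
    have w2 := intCast_mem_rect (m := m) (n := n) (x := 0 + i) (y := -(2 + 2 * a) + j)
    have w3 := intCast_mem_rect (m := m) (n := n) (x := a + i) (y := -a + j)
    have w4 := intCast_mem_interior_rect (m := m) (n := n) (x := 0 + i) (y := -(1 + a) + j)
    push_cast at w1 w2 w3 w4
    rw [w1] at v1; rw [w2] at v2; rw [w3] at v3; rw [w4] at v4
    unfold InRect at *
    obtain rfl : i = 0 := by omega
    refine ⟨⟨j - 4 - 2 * a, j, -j - 2, -j + 2 + 2 * a⟩, ?_, ?_⟩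
    · constructor <;> simp only <;> omega
    · rw [← Set.inter_eq_self_of_subset_left hr, ht]
      ext z
      simp only [Block.oct, poly, Set.mem_inter_iff, mem_rect, Set.mem_ofPred_eq]
      push_cast
      constructor
      · rintro ⟨⟨⟨_, _⟩, ⟨_, _⟩, ⟨_, _⟩, _, _⟩, ⟨_, _⟩, _, _⟩
        refine ⟨⟨⟨?_, ?_⟩, ⟨?_, ?_⟩, ⟨?_, ?_⟩, ?_, ?_⟩, ⟨?_, ?_⟩, ?_, ?_⟩ <;> linarith
      · rintro ⟨⟨⟨_, _⟩, ⟨_, _⟩, ⟨_, _⟩, _, _⟩, ⟨_, _⟩, _, _⟩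
        refine ⟨⟨⟨?_, ?_⟩, ⟨?_, ?_⟩, ⟨?_, ?_⟩, ?_, ?_⟩, ⟨?_, ?_⟩, ?_, ?_⟩ <;> linarith

theorem exists_block_of_triangle {k : Fin 4} {i j : ℤ} {a : ℕ} (ha : 0 < a) {t : Set (ℝ × ℝ)}
    (hr : t ⊆ rect m n) (hc : (i + j + a - c.parity) % 2 = 0)
    (ht : t = place k ((i : ℝ), (j : ℝ)) '' convexHull ℝ (Shape.triangle a ha).vertices)
    (hf : place k ((i : ℝ), (j : ℝ)) '' (Shape.triangle a ha).dashed ⊆ frontier (rect m n)) :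
    ∃ B, IsBlock m n c B ∧ t = B.oct ∩ rect m n := by
  have ha0 : (0 : ℝ) < a := by exact_mod_cast ha
  have v1 : place k ((i : ℝ), (j : ℝ)) (0, 0) ∈ rect m n := by
    apply hr; rw [ht]
    exact Set.mem_image_of_mem _ (subset_convexHull ℝ _ (by simp [Shape.vertices]))
  have v2 : place k ((i : ℝ), (j : ℝ)) ((a : ℝ), 0) ∈ rect m n := by
    apply hr; rw [ht]
    exact Set.mem_image_of_mem _ (subset_convexHull ℝ _ (by simp [Shape.vertices]))
  have v3 : place k ((i : ℝ), (j : ℝ)) (0, (a : ℝ)) ∈ rect m n := by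
    apply hr; rw [ht]
    exact Set.mem_image_of_mem _ (subset_convexHull ℝ _ (by simp [Shape.vertices]))
  -- The midpoints of the two short sides are used, because an endpoint could be on the boundary on
  -- account of the wrong side of `R`. A midpoint is strictly between the extremes in one
  -- coordinate, so only the other coordinate can be extremal.
  have v4 : place k ((i : ℝ), (j : ℝ)) ((a : ℝ) / 2, 0) ∈ frontier (rect m n) := by
    apply hf
    refine Set.mem_image_of_mem _ (Or.inl ⟨1 / 2, 1 / 2, by norm_num, by norm_num, by norm_num, ?_⟩)
    simp only [Prod.smul_mk, Prod.mk_add_mk, smul_eq_mul]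
    exact congrArg₂ Prod.mk (by ring) (by ring)
  have v5 : place k ((i : ℝ), (j : ℝ)) (0, (a : ℝ) / 2) ∈ frontier (rect m n) := by
    apply hf
    refine Set.mem_image_of_mem _ (Or.inr ⟨1 / 2, 1 / 2, by norm_num, by norm_num, by norm_num, ?_⟩)
    simp only [Prod.smul_mk, Prod.mk_add_mk, smul_eq_mul]
    exact congrArg₂ Prod.mk (by ring) (by ring)
  rw [convexHull_triangle] at ht
  rw [mem_frontier_rect] at v4 v5
  rw [mem_rect] at v1 v2 v3
  replace v4 := v4.2
  replace v5 := v5.2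
  fin_cases k
  · simp only [Fin.zero_eta, place_zero] at *
    rw [place_zero_poly] at ht
    simp only at ht
    have ei : (i : ℝ) = 0 := by rcases v5 with v | v | v | v <;> linarith
    have ej : (j : ℝ) = 0 := by rcases v4 with v | v | v | v <;> linarith
    obtain rfl : i = 0 := by exact_mod_cast ei
    obtain rfl : j = 0 := by exact_mod_cast ej
    have w2 : (a : ℤ) ≤ m - 1 := by
      have : (a : ℝ) ≤ m - 1 := by linarith
      exact_mod_cast this
    have w3 : (a : ℤ) ≤ n - 1 := by
      have : (a : ℝ) ≤ n - 1 := by linarith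
      exact_mod_cast this
    refine ⟨⟨-4 - a, a, -2 - a, 2 + a⟩, ?_, ?_⟩
    · constructor <;> simp only <;> omega
    · rw [← Set.inter_eq_self_of_subset_left hr, ht]
      ext z
      simp only [Block.oct, poly, Set.mem_inter_iff, mem_rect, Set.mem_ofPred_eq]
      push_cast
      constructor
      · rintro ⟨⟨⟨_, _⟩, ⟨_, _⟩, ⟨_, _⟩, _, _⟩, ⟨_, _⟩, _, _⟩
        refine ⟨⟨⟨?_, ?_⟩, ⟨?_, ?_⟩, ⟨?_, ?_⟩, ?_, ?_⟩, ⟨?_, ?_⟩, ?_, ?_⟩ <;> linarith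
      · rintro ⟨⟨⟨_, _⟩, ⟨_, _⟩, ⟨_, _⟩, _, _⟩, ⟨_, _⟩, _, _⟩
        refine ⟨⟨⟨?_, ?_⟩, ⟨?_, ?_⟩, ⟨?_, ?_⟩, ?_, ?_⟩, ⟨?_, ?_⟩, ?_, ?_⟩ <;> linarith
  · simp only [Fin.mk_one, place_one] at *
    rw [place_one_poly] at ht
    simp only at ht
    have ei : (i : ℝ) = m - 1 := by rcases v4 with v | v | v | v <;> linarith
    have ej : (j : ℝ) = 0 := by rcases v5 with v | v | v | v <;> linarith
    obtain rfl : i = m - 1 := by exact_mod_cast ei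
    obtain rfl : j = 0 := by exact_mod_cast ej
    have w2 : (a : ℤ) ≤ m - 1 := by
      have : (a : ℝ) ≤ m - 1 := by linarith
      exact_mod_cast this
    have w3 : (a : ℤ) ≤ n - 1 := by
      have : (a : ℝ) ≤ n - 1 := by linarith
      exact_mod_cast this
    refine ⟨⟨m - 3 - a, m + 1 + a, m - 1 - a, m + 3 + a⟩, ?_, ?_⟩
    · constructor <;> simp only <;> omega
    · rw [← Set.inter_eq_self_of_subset_left hr, ht]
      ext z
      simp only [Block.oct, poly, Set.mem_inter_iff, mem_rect, Set.mem_ofPred_eq]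
      push_cast
      constructor
      · rintro ⟨⟨⟨_, _⟩, ⟨_, _⟩, ⟨_, _⟩, _, _⟩, ⟨_, _⟩, _, _⟩
        refine ⟨⟨⟨?_, ?_⟩, ⟨?_, ?_⟩, ⟨?_, ?_⟩, ?_, ?_⟩, ⟨?_, ?_⟩, ?_, ?_⟩ <;> linarith
      · rintro ⟨⟨⟨_, _⟩, ⟨_, _⟩, ⟨_, _⟩, _, _⟩, ⟨_, _⟩, _, _⟩
        refine ⟨⟨⟨?_, ?_⟩, ⟨?_, ?_⟩, ⟨?_, ?_⟩, ?_, ?_⟩, ⟨?_, ?_⟩, ?_, ?_⟩ <;> linarith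
  · simp only [Fin.reduceFinMk, place_two] at *
    rw [place_two_poly] at ht
    simp only at ht
    have ei : (i : ℝ) = m - 1 := by rcases v5 with v | v | v | v <;> linarith
    have ej : (j : ℝ) = n - 1 := by rcases v4 with v | v | v | v <;> linarith
    obtain rfl : i = m - 1 := by exact_mod_cast ei
    obtain rfl : j = n - 1 := by exact_mod_cast ej
    have w2 : (a : ℤ) ≤ m - 1 := by
      have : (a : ℝ) ≤ m - 1 := by push_cast at *; linarith
      exact_mod_cast this
    have w3 : (a : ℤ) ≤ n - 1 := by
      have : (a : ℝ) ≤ n - 1 := by push_cast at *; linarith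
      exact_mod_cast this
    refine ⟨⟨m + n - 2 - a, m + n + 2 + a, m - n - 2 - a, m - n + 2 + a⟩, ?_, ?_⟩
    · constructor <;> simp only <;> omega
    · rw [← Set.inter_eq_self_of_subset_left hr, ht]
      ext z
      simp only [Block.oct, poly, Set.mem_inter_iff, mem_rect, Set.mem_ofPred_eq]
      push_cast
      constructor
      · rintro ⟨⟨⟨_, _⟩, ⟨_, _⟩, ⟨_, _⟩, _, _⟩, ⟨_, _⟩, _, _⟩
        refine ⟨⟨⟨?_, ?_⟩, ⟨?_, ?_⟩, ⟨?_, ?_⟩, ?_, ?_⟩, ⟨?_, ?_⟩, ?_, ?_⟩ <;> linarith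
      · rintro ⟨⟨⟨_, _⟩, ⟨_, _⟩, ⟨_, _⟩, _, _⟩, ⟨_, _⟩, _, _⟩
        refine ⟨⟨⟨?_, ?_⟩, ⟨?_, ?_⟩, ⟨?_, ?_⟩, ?_, ?_⟩, ⟨?_, ?_⟩, ?_, ?_⟩ <;> linarith
  · simp only [Fin.reduceFinMk, place_three_poly] at ht
    simp only [Fin.reduceFinMk, place_three] at *
    have ei : (i : ℝ) = 0 := by rcases v4 with v | v | v | v <;> linarith
    have ej : (j : ℝ) = n - 1 := by rcases v5 with v | v | v | v <;> linarith
    obtain rfl : i = 0 := by exact_mod_cast ei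
    obtain rfl : j = n - 1 := by exact_mod_cast ej
    have w2 : (a : ℤ) ≤ m - 1 := by
      have : (a : ℝ) ≤ m - 1 := by push_cast at *; linarith
      exact_mod_cast this
    have w3 : (a : ℤ) ≤ n - 1 := by
      have : (a : ℝ) ≤ n - 1 := by push_cast at *; linarith
      exact_mod_cast this
    refine ⟨⟨n - 3 - a, n + 1 + a, -n - 3 - a, -n + 1 + a⟩, ?_, ?_⟩
    · constructor <;> simp only <;> omega
    · rw [← Set.inter_eq_self_of_subset_left hr, ht]
      ext z
      simp only [Block.oct, poly, Set.mem_inter_iff, mem_rect, Set.mem_ofPred_eq]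
      push_cast
      constructor
      · rintro ⟨⟨⟨_, _⟩, ⟨_, _⟩, ⟨_, _⟩, _, _⟩, ⟨_, _⟩, _, _⟩
        refine ⟨⟨⟨?_, ?_⟩, ⟨?_, ?_⟩, ⟨?_, ?_⟩, ?_, ?_⟩, ⟨?_, ?_⟩, ?_, ?_⟩ <;> linarith
      · rintro ⟨⟨⟨_, _⟩, ⟨_, _⟩, ⟨_, _⟩, _, _⟩, ⟨_, _⟩, _, _⟩
        refine ⟨⟨⟨?_, ?_⟩, ⟨?_, ?_⟩, ⟨?_, ?_⟩, ?_, ?_⟩, ⟨?_, ?_⟩, ?_, ?_⟩ <;> linarith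

theorem exists_diamond_of_tiltedSquare {k : Fin 4} {i j : ℤ} {t : Set (ℝ × ℝ)}
    (hr : t ⊆ rect m n) (hc : (i + j - c.parity) % 2 = 0)
    (ht : t = place k ((i : ℝ), (j : ℝ)) '' convexHull ℝ Shape.tiltedSquare.vertices) :
    ∃ x y : ℤ, (x + y - c.parity) % 2 = 1 ∧ (1 ≤ x ∧ x + 2 ≤ m ∧ 1 ≤ y ∧ y + 2 ≤ n) ∧
      t = diamond x y := by
  have key : ∀ x y : ℤ, (x + y - c.parity) % 2 = 1 → t = diamond x y →
      ∃ x y : ℤ, (x + y - c.parity) % 2 = 1 ∧ (1 ≤ x ∧ x + 2 ≤ m ∧ 1 ≤ y ∧ y + 2 ≤ n) ∧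
      t = diamond x y := by
    intro x y h1 h2
    refine ⟨x, y, h1, ?_, h2⟩
    have m1 : InRect m n (x + 1) y := by
      refine inRect_of_mem hr (z := ((x + 1 : ℝ), (y : ℝ))) ?_ (by push_cast; rfl) rfl
      rw [h2]
      refine ⟨⟨?_, ?_⟩, ?_, ?_⟩ <;> simp only <;> linarith
    have m2 : InRect m n (x - 1) y := by
      refine inRect_of_mem hr (z := ((x - 1 : ℝ), (y : ℝ))) ?_ (by push_cast; rfl) rfl
      rw [h2]
      refine ⟨⟨?_, ?_⟩, ?_, ?_⟩ <;> simp only <;> linarith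
    have m3 : InRect m n x (y + 1) := by
      refine inRect_of_mem hr (z := ((x : ℝ), (y + 1 : ℝ))) ?_ rfl (by push_cast; rfl)
      rw [h2]
      refine ⟨⟨?_, ?_⟩, ?_, ?_⟩ <;> simp only <;> linarith
    have m4 : InRect m n x (y - 1) := by
      refine inRect_of_mem hr (z := ((x : ℝ), (y - 1 : ℝ))) ?_ rfl (by push_cast; rfl)
      rw [h2]
      refine ⟨⟨?_, ?_⟩, ?_, ?_⟩ <;> simp only <;> linarith
    unfold InRect at *
    omega
  rw [convexHull_tiltedSquare] at ht
  fin_cases k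
  · simp only [Fin.zero_eta, place_zero_poly] at ht
    apply key i (j + 1) (by omega)
    rw [ht, diamond_eq_poly]; push_cast; congr 1 <;> ring
  · simp only [Fin.mk_one, place_one_poly] at ht
    apply key (i - 1) j (by omega)
    rw [ht, diamond_eq_poly]; push_cast; congr 1 <;> ring
  · simp only [Fin.reduceFinMk, place_two_poly] at ht
    apply key i (j - 1) (by omega)
    rw [ht, diamond_eq_poly]; push_cast; congr 1 <;> ring
  · simp only [Fin.reduceFinMk, place_three_poly] at ht
    apply key (i + 1) j (by omega)
    rw [ht, diamond_eq_poly]; push_cast; congr 1 <;> ring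

/-- This reverses `IsBlock.isColouredTile`: a trapezoid or triangle is completed to a symmetric
octagon whose axes lie one step outside the sides of `R` that carry its dashed sides. -/
theorem IsColouredTile.eq_diamond_or_block {t : Set (ℝ × ℝ)} (h : IsColouredTile m n c t)
    (hr : t ⊆ rect m n) :
    (∃ x y : ℤ, (x + y - c.parity) % 2 = 1 ∧ (1 ≤ x ∧ x + 2 ≤ m ∧ 1 ≤ y ∧ y + 2 ≤ n) ∧
      t = diamond x y) ∨ ∃ B, IsBlock m n c B ∧ t = B.oct ∩ rect m n := by
  obtain ⟨s, k, v, ⟨ht, hf⟩, hp⟩ := h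
  obtain ⟨i, j, rfl, hc⟩ := exists_int_of_isColoured hp
  clear hp
  rcases s with ⟨a, b, ha, hb⟩ | ⟨a, ha⟩ | _ | _ | ⟨a, ha⟩ | ⟨a, ha⟩ <;>
    simp only [Shape.parity, add_zero] at hc
  · right
    rw [convexHull_octagon] at ht
    fin_cases k
    · simp only [Fin.zero_eta, place_zero_poly] at ht
      apply exists_block_of_octagon (a := a) (b := b) (i := i) (j := j) hr (by omega)
      rw [ht]; push_cast; congr 1 <;> ring
    · simp only [Fin.mk_one, place_one_poly] at ht
      apply exists_block_of_octagon (a := b) (b := a) (i := i - 2 - b) (j := j - b) hr (by omega)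
      rw [ht]; push_cast; congr 1 <;> ring
    · simp only [Fin.reduceFinMk, place_two_poly] at ht
      apply exists_block_of_octagon (a := a) (b := b) (i := i - 2 - a + b) (j := j - 2 - a - b)
        hr (by omega)
      rw [ht]; push_cast; congr 1 <;> ring
    · simp only [Fin.reduceFinMk, place_three_poly] at ht
      apply exists_block_of_octagon (a := b) (b := a) (i := i + a) (j := j - 2 - a)
        hr (by omega)
      rw [ht]; push_cast; congr 1 <;> ring
  · right
    rw [convexHull_hexagon] at ht
    fin_cases k
    · simp only [Fin.zero_eta, place_zero_poly] at ht
      apply exists_block_of_octagon (a := a) (b := 0) (i := i) (j := j) hr (by omega)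
      rw [ht]; push_cast; congr 1 <;> ring
    · simp only [Fin.mk_one, place_one_poly] at ht
      apply exists_block_of_octagon (a := 0) (b := a) (i := i - 2) (j := j) hr (by omega)
      rw [ht]; push_cast; congr 1 <;> ring
    · simp only [Fin.reduceFinMk, place_two_poly] at ht
      apply exists_block_of_octagon (a := a) (b := 0) (i := i - 2 - a) (j := j - 2 - a)
        hr (by omega)
      rw [ht]; push_cast; congr 1 <;> ring
    · simp only [Fin.reduceFinMk, place_three_poly] at ht
      apply exists_block_of_octagon (a := 0) (b := a) (i := i + a) (j := j - 2 - a)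
        hr (by omega)
      rw [ht]; push_cast; congr 1 <;> ring
  · right
    rw [convexHull_square] at ht
    fin_cases k
    · simp only [Fin.zero_eta, place_zero_poly] at ht
      apply exists_block_of_octagon (a := 0) (b := 0) (i := i) (j := j) hr (by omega)
      rw [ht]; push_cast; congr 1 <;> ring
    · simp only [Fin.mk_one, place_one_poly] at ht
      apply exists_block_of_octagon (a := 0) (b := 0) (i := i - 2) (j := j) hr (by omega)
      rw [ht]; push_cast; congr 1 <;> ring
    · simp only [Fin.reduceFinMk, place_two_poly] at ht
      apply exists_block_of_octagon (a := 0) (b := 0) (i := i - 2) (j := j - 2) hr (by omega)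
      rw [ht]; push_cast; congr 1 <;> ring
    · simp only [Fin.reduceFinMk, place_three_poly] at ht
      apply exists_block_of_octagon (a := 0) (b := 0) (i := i) (j := j - 2) hr (by omega)
      rw [ht]; push_cast; congr 1 <;> ring
  · exact Or.inl (exists_diamond_of_tiltedSquare hr hc ht)
  · exact Or.inr (exists_block_of_trapezoid ha hr hc ht hf)
  · exact Or.inr (exists_block_of_triangle ha hr hc ht hf)

end converse

/-! ### Tiles compatible with the active segments of a vector -/

section fits
variable {m n : ℕ} {c : Colour} (u : Pt m n c → ZMod 2)

/-- The interior of `t` avoids the active segments, and the part of its boundary inside `R` consists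
of active segments. -/
structure Fits (t : Set (ℝ × ℝ)) : Prop where
  subset : t ⊆ rect m n
  isColouredTile : IsColouredTile m n c t
  notMem : ∀ z ∈ interior t, z ∉ activeSegments u
  mem : ∀ z ∈ t, z ∉ interior t → z ∈ interior (rect m n) → z ∈ activeSegments u

variable {u} in
-- The component is connected and avoids the boundary of the tile, so it cannot pass from the
-- interior of the tile to its complement. Conversely the interior is convex, hence connected.
theorem Fits.connectedComponentIn_eq {t : Set (ℝ × ℝ)} (h : Fits u t) {x : ℝ × ℝ}
    (hx : x ∈ interior t) :
    connectedComponentIn (interior (rect m n) \ activeSegments u) x = interior t := by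
  have hsub : interior t ⊆ interior (rect m n) \ activeSegments u :=
    fun z hz => ⟨interior_mono h.subset hz, h.notMem z hz⟩
  have ht := h.isColouredTile.isTile
  apply Set.Subset.antisymm
  · apply isPreconnected_connectedComponentIn.subset_left_of_subset_union isOpen_interior
      ht.isClosed.isOpen_compl
    · exact Set.disjoint_left.2 fun z hz hz' => hz' (interior_subset hz)
    · intro z hz
      obtain ⟨h1, h2⟩ := connectedComponentIn_subset _ _ hz
      by_cases hzt : z ∈ t
      · left
        by_contra hc
        exact h2 (h.mem z hzt hc h1)
      · exact Or.inr hzt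
    · exact ⟨x, mem_connectedComponentIn (hsub hx), hx⟩
  · exact ht.convex.interior.isPreconnected.subset_connectedComponentIn hx hsub

/-- This is how the map is computed in both directions: no component is ever described directly, it
is enough to exhibit compatible tiles that cover `R`. -/
theorem Phi_eq_of_fits {T : Set (Set (ℝ × ℝ))} (hT : ∀ t ∈ T, Fits u t)
    (hcover : rect m n ⊆ ⋃₀ T) : Phi u = T := by
  ext t
  constructor
  · rintro ⟨x, ⟨hx, hx'⟩, rfl⟩
    obtain ⟨t, ht, hxt⟩ := hcover (interior_subset hx)
    have hxi : x ∈ interior t := by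
      by_contra hc
      exact hx' ((hT t ht).mem x hxt hc hx)
    rw [(hT t ht).connectedComponentIn_eq hxi, (hT t ht).isColouredTile.isTile.closure_interior]
    exact ht
  · intro ht
    have hf := hT t ht
    obtain ⟨x, hx⟩ := hf.isColouredTile.isTile.interior_nonempty
    refine ⟨x, ⟨interior_mono hf.subset hx, hf.notMem x hx⟩, ?_⟩
    rw [hf.connectedComponentIn_eq hx, hf.isColouredTile.isTile.closure_interior]

variable {u} in
theorem Fits.eq_of_mem_interior {t t' : Set (ℝ × ℝ)} (h : Fits u t) (h' : Fits u t') {x : ℝ × ℝ}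
    (hx : x ∈ interior t) (hx' : x ∈ interior t') : t = t' := by
  rw [← h.isColouredTile.isTile.closure_interior, ← h.connectedComponentIn_eq hx,
    h'.connectedComponentIn_eq hx', h'.isColouredTile.isTile.closure_interior]

/-! ### Segments -/

theorem mem_segment_of {z : ℝ × ℝ} {a b a' b' : ℝ} (τ : ℝ) (h0 : 0 ≤ τ) (h1 : τ ≤ 1)
    (e1 : z.1 = a + τ * (a' - a)) (e2 : z.2 = b + τ * (b' - b)) :
    z ∈ segment ℝ (a, b) (a', b') := by
  refine ⟨1 - τ, τ, by linarith, h0, by ring, ?_⟩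
  obtain ⟨x, y⟩ := z
  simp only at e1 e2
  simp only [Prod.smul_mk, Prod.mk_add_mk, smul_eq_mul]
  rw [e1, e2]
  exact congrArg₂ Prod.mk (by ring) (by ring)

theorem exists_of_mem_segment {z : ℝ × ℝ} {a b a' b' : ℝ} (h : z ∈ segment ℝ (a, b) (a', b')) :
    ∃ α β : ℝ, 0 ≤ α ∧ 0 ≤ β ∧ α + β = 1 ∧ z.1 = α * a + β * a' ∧ z.2 = α * b + β * b' := by
  obtain ⟨α, β, h1, h2, h3, rfl⟩ := h
  exact ⟨α, β, h1, h2, h3, rfl, rfl⟩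

/-- A strict integral bound at a point of a segment passes to one of its ends. Incidences between
segments and tiles thus become linear arithmetic on integral endpoints. -/
theorem lt_or_lt_of_lt_combo {α β r : ℝ} {K X Y : ℤ} (hα : 0 ≤ α) (hβ : 0 ≤ β) (h : α + β = 1)
    (hr : (K : ℝ) < r) (e : r = α * X + β * Y) : K < X ∨ K < Y := by
  by_contra hc
  push Not at hc
  have h1 : (X : ℝ) ≤ K := by exact_mod_cast hc.1
  have h2 : (Y : ℝ) ≤ K := by exact_mod_cast hc.2
  have h3 := mul_le_mul_of_nonneg_left h1 hα
  have h4 := mul_le_mul_of_nonneg_left h2 hβ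
  have h5 : α * (K : ℝ) + β * K = K := by rw [← add_mul, h, one_mul]
  linarith

theorem lt_or_lt_of_combo_lt {α β r : ℝ} {K X Y : ℤ} (hα : 0 ≤ α) (hβ : 0 ≤ β) (h : α + β = 1)
    (hr : r < (K : ℝ)) (e : r = α * X + β * Y) : X < K ∨ Y < K := by
  have := lt_or_lt_of_lt_combo (K := -K) (X := -X) (Y := -Y) (r := -r) hα hβ h
    (by push_cast; linarith) (by push_cast; linarith)
  omega

/-- Integral consequences of the fact that a segment meets an open octagon. -/
theorem Block.of_mem_segment_octInt {B : Block} {z : ℝ × ℝ} (hz : z ∈ B.octInt) {x y x' y' : ℤ}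
    (h : z ∈ segment ℝ ((x : ℝ), (y : ℝ)) ((x' : ℝ), (y' : ℝ))) :
    (B.s₁ + B.d₁ + 2 < 2 * x ∨ B.s₁ + B.d₁ + 2 < 2 * x') ∧
    (2 * x < B.s₂ + B.d₂ - 2 ∨ 2 * x' < B.s₂ + B.d₂ - 2) ∧
    (B.s₁ - B.d₂ + 2 < 2 * y ∨ B.s₁ - B.d₂ + 2 < 2 * y') ∧
    (2 * y < B.s₂ - B.d₁ - 2 ∨ 2 * y' < B.s₂ - B.d₁ - 2) ∧
    (B.s₁ < x + y ∨ B.s₁ < x' + y') ∧ (x + y < B.s₂ ∨ x' + y' < B.s₂) ∧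
    (B.d₁ < x - y ∨ B.d₁ < x' - y') ∧ (x - y < B.d₂ ∨ x' - y' < B.d₂) := by
  obtain ⟨α, β, h1, h2, h3, e1, e2⟩ := exists_of_mem_segment h
  obtain ⟨⟨k1, k2⟩, ⟨k3, k4⟩, ⟨k5, k6⟩, k7, k8⟩ := hz
  refine ⟨?_, ?_, ?_, ?_, ?_, ?_, ?_, ?_⟩
  · exact lt_or_lt_of_lt_combo h1 h2 h3 (r := 2 * z.1) (by push_cast; exact k1)
      (by rw [e1]; push_cast; ring)
  · exact lt_or_lt_of_combo_lt h1 h2 h3 (r := 2 * z.1) (by push_cast; exact k2)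
      (by rw [e1]; push_cast; ring)
  · exact lt_or_lt_of_lt_combo h1 h2 h3 (r := 2 * z.2) (by push_cast; exact k3)
      (by rw [e2]; push_cast; ring)
  · exact lt_or_lt_of_combo_lt h1 h2 h3 (r := 2 * z.2) (by push_cast; exact k4)
      (by rw [e2]; push_cast; ring)
  · exact lt_or_lt_of_lt_combo h1 h2 h3 k5 (by rw [e1, e2]; push_cast; ring)
  · exact lt_or_lt_of_combo_lt h1 h2 h3 k6 (by rw [e1, e2]; push_cast; ring)
  · exact lt_or_lt_of_lt_combo h1 h2 h3 k7 (by rw [e1, e2]; push_cast; ring)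
  · exact lt_or_lt_of_combo_lt h1 h2 h3 k8 (by rw [e1, e2]; push_cast; ring)

/-- Integral consequences of the fact that a segment meets the interior of a diamond. -/
theorem of_mem_segment_interior_diamond {a b : ℤ} {z : ℝ × ℝ} (hz : z ∈ interior (diamond a b))
    {x y x' y' : ℤ} (h : z ∈ segment ℝ ((x : ℝ), (y : ℝ)) ((x' : ℝ), (y' : ℝ))) :
    (a + b - 1 < x + y ∨ a + b - 1 < x' + y') ∧ (x + y < a + b + 1 ∨ x' + y' < a + b + 1) ∧
    (a - b - 1 < x - y ∨ a - b - 1 < x' - y') ∧ (x - y < a - b + 1 ∨ x' - y' < a - b + 1) := by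
  obtain ⟨α, β, h1, h2, h3, e1, e2⟩ := exists_of_mem_segment h
  rw [interior_diamond] at hz
  obtain ⟨⟨k5, k6⟩, k7, k8⟩ := hz
  refine ⟨?_, ?_, ?_, ?_⟩
  · exact lt_or_lt_of_lt_combo h1 h2 h3 (by push_cast; exact k5) (by rw [e1, e2]; push_cast; ring)
  · exact lt_or_lt_of_combo_lt h1 h2 h3 (by push_cast; exact k6) (by rw [e1, e2]; push_cast; ring)
  · exact lt_or_lt_of_lt_combo h1 h2 h3 (by push_cast; exact k7) (by rw [e1, e2]; push_cast; ring)
  · exact lt_or_lt_of_combo_lt h1 h2 h3 (by push_cast; exact k8) (by rw [e1, e2]; push_cast; ring)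

variable {u}

theorem fits_diamond {x y : ℤ} (hc : (x + y - c.parity) % 2 = 1)
    (h1 : ext u (x + 1) y = 1) (h2 : ext u (x - 1) y = 1) (h3 : ext u x (y + 1) = 1)
    (h4 : ext u x (y - 1) = 1) : Fits u (diamond x y) := by
  have r1 := (exists_of_ext_ne u (h1.trans_ne one_ne_zero)).1
  have r2 := (exists_of_ext_ne u (h2.trans_ne one_ne_zero)).1
  have r3 := (exists_of_ext_ne u (h3.trans_ne one_ne_zero)).1
  have r4 := (exists_of_ext_ne u (h4.trans_ne one_ne_zero)).1
  refine ⟨?_, isColouredTile_diamond hc, ?_, ?_⟩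
  · rintro z ⟨⟨k1, k2⟩, k3, k4⟩
    rw [← intCast_mem_rect, mem_rect] at r1 r2 r3 r4
    push_cast at r1 r2 r3 r4
    rw [mem_rect]
    refine ⟨⟨?_, ?_⟩, ?_, ?_⟩ <;> linarith [r1.1.2, r2.1.1, r3.2.2, r4.2.1]
  · intro z hz hs
    rcases mem_activeSegments u hs with ⟨a, b, a', b', e1, e2, e3, e4, hseg⟩ |
      ⟨a, b, dx, dy, hd, -, e1, e2, e3, e4, hseg⟩
    · have := of_mem_segment_interior_diamond hz hseg
      have c1 := (exists_of_ext_ne u (e1.trans_ne one_ne_zero)).2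
      omega
    · have := of_mem_segment_interior_diamond hz hseg
      have c1 := (exists_of_ext_ne u (e1.trans_ne one_ne_zero)).2
      -- By parity, a straight segment of length two that meets the open diamond is one of its two
      -- diagonals. It would require the other two vertices to be inactive, but all four are active.
      obtain rfl : a = x := by omega
      obtain rfl : b = y := by omega
      rcases hd with ⟨rfl, rfl | rfl⟩ | ⟨rfl, rfl | rfl⟩
      · rw [add_zero, h1] at e3; exact one_ne_zero e3
      · rw [sub_neg_eq_add, sub_zero, h1] at e4; exact one_ne_zero e4
      · rw [add_zero, h3] at e3; exact one_ne_zero e3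
      · rw [sub_neg_eq_add, sub_zero, h3] at e4; exact one_ne_zero e4
  · rintro z ⟨⟨k1, k2⟩, k3, k4⟩ hz -
    rw [interior_diamond] at hz
    by_cases l1 : z.1 + z.2 = x + y + 1
    · apply segment_diag_subset u h1 h3 (by omega) (by omega)
      apply mem_segment_of (z.2 - y) <;> push_cast <;> linarith
    by_cases l2 : z.1 + z.2 = x + y - 1
    · apply segment_diag_subset u h2 h4 (by omega) (by omega)
      apply mem_segment_of (y - z.2) <;> push_cast <;> linarith
    by_cases l3 : z.1 - z.2 = x - y + 1
    · apply segment_diag_subset u h1 h4 (by omega) (by omega)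
      apply mem_segment_of (y - z.2) <;> push_cast <;> linarith
    by_cases l4 : z.1 - z.2 = x - y - 1
    · apply segment_diag_subset u h2 h3 (by omega) (by omega)
      apply mem_segment_of (z.2 - y) <;> push_cast <;> linarith
    exact absurd ⟨⟨k1.lt_of_ne' l2, k2.lt_of_ne l1⟩, k3.lt_of_ne' l4, k4.lt_of_ne l3⟩ hz

/-- Take a horizontal neighbour in the graph, which exists since `m ≥ 2`. If no active point sees
the given one at a right angle from there, the kernel equation forces the opposite point to be
active, and the two are joined by a straight segment. -/
theorem intCast_mem_activeSegments (hm : 2 ≤ m) (hu : u ∈ kernel m n c) {x y : ℤ}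
    (h : ext u x y = 1) : ((x : ℝ), (y : ℝ)) ∈ activeSegments u := by
  obtain ⟨hr, hc⟩ := exists_of_ext_ne u (h.trans_ne one_ne_zero)
  have key : ∀ d : ℤ, (d = 1 ∨ d = -1) → InRect m n (x + d) y →
      ((x : ℝ), (y : ℝ)) ∈ activeSegments u := by
    intro d hd hw
    rcases zmod2_cases (ext u (x + d) (y + 1)) with h1 | h1
    swap
    · exact segment_diag_subset u h h1 (by omega) (by omega) (left_mem_segment ℝ _ _)
    rcases zmod2_cases (ext u (x + d) (y - 1)) with h2 | h2
    swap
    · exact segment_diag_subset u h h2 (by omega) (by omega) (left_mem_segment ℝ _ _)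
    have hk := (mem_kernel_iff u).1 hu _ _ hw (by omega)
    rw [h1, h2, add_zero, add_zero] at hk
    have h3 : ext u (x + d + d) y = 1 := by
      rcases hd with rfl | rfl
      · rw [add_sub_cancel_right, h] at hk
        rcases zmod2_cases (ext u (x + 1 + 1) y) with h3 | h3
        · rw [h3] at hk; exact absurd hk (by decide)
        · exact h3
      · rw [neg_add_cancel_right, h] at hk
        rcases zmod2_cases (ext u (x + -1 - 1) y) with h3 | h3
        · rw [h3] at hk; exact absurd hk (by decide)
        · exact h3
    have := segment_straight_subset u (x := x + d) (y := y) (dx := d) (dy := 0) (by omega) hw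
      (by rw [add_zero]; exact h3) (by rw [add_sub_cancel_right, sub_zero]; exact h)
      (by rcases hd with rfl | rfl
          · rw [add_zero]; exact h1
          · rw [add_zero, ← sub_eq_add_neg]; exact h2)
      (by rcases hd with rfl | rfl
          · rw [sub_zero]; exact h2
          · rw [sub_zero, sub_neg_eq_add]; exact h1)
    apply this
    rw [add_sub_cancel_right, sub_zero]
    exact right_mem_segment ℝ _ _
  unfold InRect at *
  by_cases hx : x + 2 ≤ m
  · exact key 1 (by omega) (by omega)
  · exact key (-1) (by omega) (by omega)

/-- Consecutive points of a diagonal are joined as soon as both are active. Only the points inside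
the rectangle need to be active, since `z` is in its interior. -/
theorem mem_activeSegments_of_antidiagonal (hm : 2 ≤ m) (hu : u ∈ kernel m n c) {z : ℝ × ℝ}
    (hz : z ∈ interior (rect m n)) {s lo hi : ℤ} (hs : (s - lo) % 2 = 0) (hp : (hi - lo) % 2 = 0)
    (e : z.1 + z.2 = s) (h1 : lo ≤ z.1 - z.2) (h2 : z.1 - z.2 ≤ hi)
    (H : ∀ x y : ℤ, InRect m n x y → x + y = s → lo ≤ x - y → x - y ≤ hi → ext u x y = 1) :
    z ∈ activeSegments u := by
  -- Lattice points on the line are two apart in `x - y`; `k` is the index of the last one not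
  -- beyond `z`. Either `z` is this point or it lies on the segment to the next one.
  set k := ⌊(z.1 - z.2 - lo) / 2⌋ with hk
  have k1 : (k : ℝ) ≤ (z.1 - z.2 - lo) / 2 := Int.floor_le _
  have k2 : (z.1 - z.2 - lo) / 2 < k + 1 := Int.lt_floor_add_one _
  have k3 : 0 ≤ k := Int.floor_nonneg.2 (by linarith)
  obtain ⟨x, hx⟩ : ∃ x : ℤ, 2 * x = s + lo + 2 * k := ⟨(s + lo + 2 * k) / 2, by omega⟩
  have hx' : 2 * (x : ℝ) = s + lo + 2 * k := by exact_mod_cast hx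
  have k4 : lo + 2 * k ≤ hi := by
    have : (lo : ℝ) + 2 * k ≤ hi := by linarith
    exact_mod_cast this
  rw [mem_interior_rect] at hz
  obtain ⟨⟨r1, r2⟩, r3, r4⟩ := hz
  rcases k1.eq_or_lt with k1 | k1
  · have ex : z.1 = x := by linarith
    have ey : z.2 = (s - x : ℤ) := by push_cast; linarith
    have hin : InRect m n x (s - x) := by
      rw [← intCast_mem_rect, ← ex, ← ey]
      exact ⟨⟨r1.le, r2.le⟩, r3.le, r4.le⟩
    have := intCast_mem_activeSegments hm hu (H x (s - x) hin (by ring) (by omega) (by omega))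
    rwa [← ex, ← ey] at this
  · have k5 : lo + 2 * k < hi := by
      have : (lo : ℝ) + 2 * k < hi := by linarith
      exact_mod_cast this
    have b1 : 0 < x + 1 := by
      have : (0 : ℝ) < x + 1 := by linarith
      exact_mod_cast this
    have b2 : x < (m : ℤ) - 1 := by
      have : (x : ℝ) < m - 1 := by linarith
      exact_mod_cast this
    have b3 : 0 < s - x := by
      have : (0 : ℝ) < s - x := by linarith
      exact_mod_cast this
    have b4 : s - x - 1 < (n : ℤ) - 1 := by
      have : (s : ℝ) - x - 1 < n - 1 := by linarith
      exact_mod_cast this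
    have a1 := H x (s - x) (by unfold InRect; omega) (by ring) (by omega) (by omega)
    have a2 := H (x + 1) (s - x - 1) (by unfold InRect; omega) (by ring) (by omega) (by omega)
    apply segment_diag_subset u a1 a2 (by omega) (by omega)
    apply mem_segment_of (z.1 - x) <;> push_cast <;> linarith

theorem mem_activeSegments_of_diagonal (hm : 2 ≤ m) (hu : u ∈ kernel m n c) {z : ℝ × ℝ}
    (hz : z ∈ interior (rect m n)) {d lo hi : ℤ} (hs : (d - lo) % 2 = 0) (hp : (hi - lo) % 2 = 0)
    (e : z.1 - z.2 = d) (h1 : lo ≤ z.1 + z.2) (h2 : z.1 + z.2 ≤ hi)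
    (H : ∀ x y : ℤ, InRect m n x y → x - y = d → lo ≤ x + y → x + y ≤ hi → ext u x y = 1) :
    z ∈ activeSegments u := by
  set k := ⌊(z.1 + z.2 - lo) / 2⌋ with hk
  have k1 : (k : ℝ) ≤ (z.1 + z.2 - lo) / 2 := Int.floor_le _
  have k2 : (z.1 + z.2 - lo) / 2 < k + 1 := Int.lt_floor_add_one _
  have k3 : 0 ≤ k := Int.floor_nonneg.2 (by linarith)
  obtain ⟨x, hx⟩ : ∃ x : ℤ, 2 * x = d + lo + 2 * k := ⟨(d + lo + 2 * k) / 2, by omega⟩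
  have hx' : 2 * (x : ℝ) = d + lo + 2 * k := by exact_mod_cast hx
  have k4 : lo + 2 * k ≤ hi := by
    have : (lo : ℝ) + 2 * k ≤ hi := by linarith
    exact_mod_cast this
  rw [mem_interior_rect] at hz
  obtain ⟨⟨r1, r2⟩, r3, r4⟩ := hz
  rcases k1.eq_or_lt with k1 | k1
  · have ex : z.1 = x := by linarith
    have ey : z.2 = (x - d : ℤ) := by push_cast; linarith
    have hin : InRect m n x (x - d) := by
      rw [← intCast_mem_rect, ← ex, ← ey]
      exact ⟨⟨r1.le, r2.le⟩, r3.le, r4.le⟩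
    have := intCast_mem_activeSegments hm hu (H x (x - d) hin (by ring) (by omega) (by omega))
    rwa [← ex, ← ey] at this
  · have k5 : lo + 2 * k < hi := by
      have : (lo : ℝ) + 2 * k < hi := by linarith
      exact_mod_cast this
    have b1 : 0 < x + 1 := by
      have : (0 : ℝ) < x + 1 := by linarith
      exact_mod_cast this
    have b2 : x < (m : ℤ) - 1 := by
      have : (x : ℝ) < m - 1 := by linarith
      exact_mod_cast this
    have b3 : 0 < x - d + 1 := by
      have : (0 : ℝ) < x - d + 1 := by linarith
      exact_mod_cast this
    have b4 : x - d < (n : ℤ) - 1 := by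
      have : (x : ℝ) - d < n - 1 := by linarith
      exact_mod_cast this
    have a1 := H x (x - d) (by unfold InRect; omega) (by ring) (by omega) (by omega)
    have a2 := H (x + 1) (x - d + 1) (by unfold InRect; omega) (by ring) (by omega) (by omega)
    apply segment_diag_subset u a1 a2 (by omega) (by omega)
    apply mem_segment_of (z.1 - x) <;> push_cast <;> linarith

end fits

/-! ### Blocks of inactive points yield compatible tiles -/

section fits
variable {m n : ℕ} {c : Colour} {u : Pt m n c → ZMod 2}

/-- The integral points of the octagon of a block. -/
theorem Block.intCast_mem_oct {B : Block} {x y : ℤ} : ((x : ℝ), (y : ℝ)) ∈ B.oct ↔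
    (B.s₁ + B.d₁ + 2 ≤ 2 * x ∧ 2 * x ≤ B.s₂ + B.d₂ - 2) ∧
    (B.s₁ - B.d₂ + 2 ≤ 2 * y ∧ 2 * y ≤ B.s₂ - B.d₁ - 2) ∧
    (B.s₁ ≤ x + y ∧ x + y ≤ B.s₂) ∧ B.d₁ ≤ x - y ∧ x - y ≤ B.d₂ := by
  simp only [Block.oct, Set.mem_ofPred_eq]
  norm_cast

/-- A diagonal segment of length `√2` that meets an open octagon has an endpoint in the block. -/
theorem diagonal_avoids {s₁ s₂ d₁ d₂ S D S' D' : ℤ} (hs : s₁ + 4 ≤ s₂) (hd : d₁ + 4 ≤ d₂)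
    (f5 : s₁ < S ∨ s₁ < S') (f6 : S < s₂ ∨ S' < s₂) (f7 : d₁ < D ∨ d₁ < D')
    (f8 : D < d₂ ∨ D' < d₂)
    (h : (S' = S ∧ (D' = D + 2 ∨ D' = D - 2)) ∨ (D' = D ∧ (S' = S + 2 ∨ S' = S - 2)))
    (n1 : ¬ ((s₁ < S ∧ S < s₂) ∧ d₁ < D ∧ D < d₂))
    (n2 : ¬ ((s₁ < S' ∧ S' < s₂) ∧ d₁ < D' ∧ D' < d₂)) : False := by
  rcases h with ⟨h, h'⟩ | ⟨h, h'⟩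
  · rw [h, or_self] at f5 f6
    rw [h] at n2
    replace n1 : ¬ (d₁ < D ∧ D < d₂) := fun h => n1 ⟨⟨f5, f6⟩, h⟩
    replace n2 : ¬ (d₁ < D' ∧ D' < d₂) := fun h => n2 ⟨⟨f5, f6⟩, h⟩
    clear h f5 f6
    -- Both ends are outside the interval while some end is above the lower bound and some end is
    -- below the upper bound. They would have to lie on different sides of an interval of length at
    -- least 4, although they are 2 apart.
    omega
  · rw [h, or_self] at f7 f8
    rw [h] at n2
    replace n1 : ¬ (s₁ < S ∧ S < s₂) := fun h => n1 ⟨h, f7, f8⟩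
    replace n2 : ¬ (s₁ < S' ∧ S' < s₂) := fun h => n2 ⟨h, f7, f8⟩
    clear h f7 f8
    omega

/-- A horizontal or vertical segment of length `2` that meets an open octagon has an endpoint in
the block. -/
theorem straight_avoids {s₁ s₂ d₁ d₂ S D A B C E p : ℤ} (hs : s₁ + 4 ≤ s₂) (hd : d₁ + 4 ≤ d₂)
    (ps₁ : (s₁ - p) % 2 = 0) (ps₂ : (s₂ - p) % 2 = 0) (pd₁ : (d₁ - p) % 2 = 0)
    (pd₂ : (d₂ - p) % 2 = 0) (hS : (S - p) % 2 = 1) (hD : (D - p) % 2 = 1)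
    (f5 : s₁ < A ∨ s₁ < C) (f6 : A < s₂ ∨ C < s₂) (f7 : d₁ < B ∨ d₁ < E)
    (f8 : B < d₂ ∨ E < d₂)
    (h : ((A = S + 1 ∧ C = S - 1) ∧ (B = D - 1 ∧ E = D + 1) ∧
      s₁ + d₁ + 2 < S + D ∧ S + D < s₂ + d₂ - 2) ∨ ((A = S + 1 ∧ C = S - 1) ∧
      (B = D + 1 ∧ E = D - 1) ∧ s₁ - d₂ + 2 < S - D ∧ S - D < s₂ - d₁ - 2))
    (n1 : ¬ ((s₁ < A ∧ A < s₂) ∧ d₁ < B ∧ B < d₂))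
    (n2 : ¬ ((s₁ < C ∧ C < s₂) ∧ d₁ < E ∧ E < d₂)) : False := by
  rcases h with ⟨⟨rfl, rfl⟩, ⟨rfl, rfl⟩, h1, h2⟩ | ⟨⟨rfl, rfl⟩, ⟨rfl, rfl⟩, h1, h2⟩
  all_goals
    -- The midpoint has the other parity, so each bound met by one end is strict at the midpoint. If
    -- both ends miss the block, the widths force the segment to lie along a horizontal or vertical
    -- side of the octagon, which the bounds on `S + D` or `S - D` exclude.
    replace f5 : s₁ < S := by clear n1 n2 f6 f7 f8; omega
    replace f6 : S < s₂ := by clear n1 n2 f7 f8; omega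
    replace f7 : d₁ < D := by clear n1 n2 f8; omega
    replace f8 : D < d₂ := by clear n1 n2; omega
    omega

/-- A segment that meets the open octagon has an endpoint in the block, but active segments have
active ends and the block is inactive. -/
theorem notMem_activeSegments_of_mem_octInt {B : Block} (hB : IsBlock m n c B)
    (h0 : ∀ x y, B.Mem x y → ext u x y = 0) {z : ℝ × ℝ} (hz : z ∈ B.octInt) : z ∉ activeSegments u := by
  intro hs
  have hnot : ∀ x y, ext u x y = 1 → ¬ B.Mem x y := fun x y h1 h2 =>
    zero_ne_one ((h0 x y h2).symm.trans h1)
  obtain ⟨ps₁, ps₂, pd₁, pd₂, hs₁, hd₁, -, -, -, -, -, -, -, -⟩ := hB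
  rcases mem_activeSegments u hs with ⟨a, b, a', b', e1, e2, e3, e4, hseg⟩ |
    ⟨a, b, dx, dy, hd, -, e1, e2, -, -, hseg⟩
  · obtain ⟨-, -, -, -, f5, f6, f7, f8⟩ := Block.of_mem_segment_octInt hz hseg
    exact diagonal_avoids hs₁ hd₁ f5 f6 f7 f8 (by omega) (hnot _ _ e1) (hnot _ _ e2)
  · obtain ⟨f1, f2, f3, f4, f5, f6, f7, f8⟩ := Block.of_mem_segment_octInt hz hseg
    have c1 := (exists_of_ext_ne u (e1.trans_ne one_ne_zero)).2
    have n1 := hnot _ _ e1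
    have n2 := hnot _ _ e2
    rcases hd with ⟨rfl, rfl | rfl⟩ | ⟨rfl, rfl | rfl⟩
    · refine straight_avoids (S := a + b) (D := a - b) (p := c.parity) hs₁ hd₁ ps₁ ps₂ pd₁ pd₂
        (by omega) (by omega) f5 f6 f7 f8 (Or.inl ⟨?_, ?_, ?_, ?_⟩) n1 n2 <;> omega
    · refine straight_avoids (S := a + b) (D := a - b) (p := c.parity) hs₁ hd₁ ps₁ ps₂ pd₁ pd₂
        (by omega) (by omega) f5.symm f6.symm f7.symm f8.symm (Or.inl ⟨?_, ?_, ?_, ?_⟩) n2 n1 <;>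
        omega
    · refine straight_avoids (S := a + b) (D := a - b) (p := c.parity) hs₁ hd₁ ps₁ ps₂ pd₁ pd₂
        (by omega) (by omega) f5 f6 f7 f8 (Or.inr ⟨?_, ?_, ?_, ?_⟩) n1 n2 <;> omega
    · refine straight_avoids (S := a + b) (D := a - b) (p := c.parity) hs₁ hd₁ ps₁ ps₂ pd₁ pd₂
        (by omega) (by omega) f5.symm f6.symm f7.symm f8.symm (Or.inr ⟨?_, ?_, ?_, ?_⟩) n2 n1 <;>
        omega

/-- With two opposite active neighbours, the kernel equation at the midpoint makes the lateral
neighbours equal, so it is enough to know that one of them is inactive. -/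
theorem mem_activeSegments_of_straight (hu : u ∈ kernel m n c) {x y dx dy : ℤ} {z : ℝ × ℝ}
    (hdd : dx = 0 ∧ dy = 1 ∨ dx = 1 ∧ dy = 0) (hr : InRect m n x y)
    (hc : (x + y - c.parity) % 2 = 1) (e1 : ext u (x + dx) (y + dy) = 1)
    (e2 : ext u (x - dx) (y - dy) = 1)
    (e3 : ext u (x + dy) (y + dx) = 0 ∨ ext u (x - dy) (y - dx) = 0)
    (hseg : z ∈ segment ℝ (((x + dx : ℤ) : ℝ), ((y + dy : ℤ) : ℝ))
      (((x - dx : ℤ) : ℝ), ((y - dy : ℤ) : ℝ))) : z ∈ activeSegments u := by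
  have hk := (mem_kernel_iff u).1 hu x y hr hc
  have e4 : ext u (x + dy) (y + dx) = 0 ∧ ext u (x - dy) (y - dx) = 0 := by
    have hk' : ext u (x + dx) (y + dy) + ext u (x - dx) (y - dy) + ext u (x + dy) (y + dx) +
        ext u (x - dy) (y - dx) = 0 := by
      rcases hdd with ⟨rfl, rfl⟩ | ⟨rfl, rfl⟩
      · simp only [add_zero, sub_zero] at *
        rw [← hk]; ring
      · simp only [add_zero, sub_zero] at *
        exact hk
    rw [e1, e2, show (1 + 1 : ZMod 2) = 0 from rfl, zero_add] at hk'
    rcases e3 with e3 | e3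
    · rw [e3, zero_add] at hk'; exact ⟨e3, hk'⟩
    · rw [e3, add_zero] at hk'; exact ⟨hk', e3⟩
  exact segment_straight_subset u (by omega) hr e1 e2 e4.1 e4.2 hseg

/-- The truncation of the corners leaves, on each sloped side, only the points at least two away
from the corners in the other coordinate. The lattice points among them in the rectangle belong to
the octagon but not to the block, hence are active. -/
theorem mem_activeSegments_of_sloped_side (hm : 2 ≤ m) (hu : u ∈ kernel m n c) {B : Block} (hB : IsBlock m n c B)
    (h1 : ∀ x y : ℤ, InRect m n x y → (x + y - c.parity) % 2 = 0 → ((x : ℝ), (y : ℝ)) ∈ B.oct →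
      ¬ B.Mem x y → ext u x y = 1)
    {z : ℝ × ℝ} (hzo : z ∈ B.oct) (hz : z ∈ interior (rect m n))
    (h : z.1 + z.2 = B.s₁ ∨ z.1 + z.2 = B.s₂ ∨ z.1 - z.2 = B.d₁ ∨ z.1 - z.2 = B.d₂) :
    z ∈ activeSegments u := by
  obtain ⟨ps₁, ps₂, pd₁, pd₂, hs, hd, left, right, bottom, top, -, -, -, -⟩ := hB
  obtain ⟨⟨k1, k2⟩, ⟨k3, k4⟩, ⟨k5, k6⟩, k7, k8⟩ := hzo
  simp only [Block.intCast_mem_oct, Block.Mem] at h1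
  clear left right bottom top
  rcases h with l5 | l6 | l7 | l8
  · apply mem_activeSegments_of_antidiagonal hm hu hz (s := B.s₁) (lo := B.d₁ + 2)
      (hi := B.d₂ - 2) (by omega) (by omega) l5 (by push_cast; linarith) (by push_cast; linarith)
    intro x y hr e1 e2 e3
    exact h1 x y hr (by omega) (by omega) (by omega)
  · apply mem_activeSegments_of_antidiagonal hm hu hz (s := B.s₂) (lo := B.d₁ + 2)
      (hi := B.d₂ - 2) (by omega) (by omega) l6 (by push_cast; linarith) (by push_cast; linarith)
    intro x y hr e1 e2 e3
    exact h1 x y hr (by omega) (by omega) (by omega)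
  · apply mem_activeSegments_of_diagonal hm hu hz (d := B.d₁) (lo := B.s₁ + 2)
      (hi := B.s₂ - 2) (by omega) (by omega) l7 (by push_cast; linarith) (by push_cast; linarith)
    intro x y hr e1 e2 e3
    exact h1 x y hr (by omega) (by omega) (by omega)
  · apply mem_activeSegments_of_diagonal hm hu hz (d := B.d₂) (lo := B.s₁ + 2)
      (hi := B.s₂ - 2) (by omega) (by omega) l8 (by push_cast; linarith) (by push_cast; linarith)
    intro x y hr e1 e2 e3
    exact h1 x y hr (by omega) (by omega) (by omega)

theorem mem_activeSegments_of_left_side (hu : u ∈ kernel m n c) {B : Block}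
    (hB : IsBlock m n c B) (h0 : ∀ x y, B.Mem x y → ext u x y = 0)
    (h1 : ∀ x y : ℤ, InRect m n x y → (x + y - c.parity) % 2 = 0 → ((x : ℝ), (y : ℝ)) ∈ B.oct →
      ¬ B.Mem x y → ext u x y = 1)
    {z : ℝ × ℝ} (hzo : z ∈ B.oct) (hz : z ∈ interior (rect m n)) (l1 : B.s₁ + B.d₁ + 2 = 2 * z.1) :
    z ∈ activeSegments u := by
  obtain ⟨ps₁, ps₂, pd₁, pd₂, hs, hd, left, right, bottom, top, -, -, -, -⟩ := hB
  obtain ⟨⟨k1, k2⟩, ⟨k3, k4⟩, ⟨k5, k6⟩, k7, k8⟩ := hzo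
  simp only [Block.intCast_mem_oct, Block.Mem] at h1
  simp only [Block.Mem] at h0
  obtain ⟨⟨r1, r2⟩, r3, r4⟩ := mem_interior_rect.1 hz
  -- The point `(x, y)` is the midpoint of the vertical side, a point of the opposite colour. The
  -- ends of the side are its vertical neighbours, and its neighbour `(x + 1, y)` is in the block.
  -- The other three sides are treated in the same way.
  obtain ⟨x, hx⟩ : ∃ x, 2 * x = B.s₁ + B.d₁ + 2 := ⟨(B.s₁ + B.d₁ + 2) / 2, by omega⟩
  obtain ⟨y, hy⟩ : ∃ y, 2 * y = B.s₁ - B.d₁ := ⟨(B.s₁ - B.d₁) / 2, by omega⟩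
  have hx' : 2 * (x : ℝ) = B.s₁ + B.d₁ + 2 := by exact_mod_cast hx
  have hy' : 2 * (y : ℝ) = B.s₁ - B.d₁ := by exact_mod_cast hy
  have b1 : 0 < x := by
    have : (0 : ℝ) < x := by linarith
    exact_mod_cast this
  have b2 : x < (m : ℤ) - 1 := by
    have : (x : ℝ) < m - 1 := by linarith
    exact_mod_cast this
  have b3 : 0 < y + 1 := by
    have : (0 : ℝ) < y + 1 := by linarith
    exact_mod_cast this
  have b4 : y - 1 < (n : ℤ) - 1 := by
    have : (y : ℝ) - 1 < n - 1 := by linarith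
    exact_mod_cast this
  apply mem_activeSegments_of_straight hu (x := x) (y := y) (dx := 0) (dy := 1) (by omega) (by unfold InRect; omega) (by omega)
    (h1 _ _ (by unfold InRect; omega) (by omega) (by omega) (by omega))
    (h1 _ _ (by unfold InRect; omega) (by omega) (by omega) (by omega))
    (Or.inl (h0 _ _ (by omega)))
  apply mem_segment_of ((y + 1 - z.2) / 2) <;> push_cast <;> linarith

theorem mem_activeSegments_of_right_side (hu : u ∈ kernel m n c) {B : Block}
    (hB : IsBlock m n c B) (h0 : ∀ x y, B.Mem x y → ext u x y = 0)
    (h1 : ∀ x y : ℤ, InRect m n x y → (x + y - c.parity) % 2 = 0 → ((x : ℝ), (y : ℝ)) ∈ B.oct →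
      ¬ B.Mem x y → ext u x y = 1)
    {z : ℝ × ℝ} (hzo : z ∈ B.oct) (hz : z ∈ interior (rect m n)) (l2 : 2 * z.1 = B.s₂ + B.d₂ - 2) :
    z ∈ activeSegments u := by
  obtain ⟨ps₁, ps₂, pd₁, pd₂, hs, hd, left, right, bottom, top, -, -, -, -⟩ := hB
  obtain ⟨⟨k1, k2⟩, ⟨k3, k4⟩, ⟨k5, k6⟩, k7, k8⟩ := hzo
  simp only [Block.intCast_mem_oct, Block.Mem] at h1
  simp only [Block.Mem] at h0
  obtain ⟨⟨r1, r2⟩, r3, r4⟩ := mem_interior_rect.1 hz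
  obtain ⟨x, hx⟩ : ∃ x, 2 * x = B.s₂ + B.d₂ - 2 := ⟨(B.s₂ + B.d₂ - 2) / 2, by omega⟩
  obtain ⟨y, hy⟩ : ∃ y, 2 * y = B.s₂ - B.d₂ := ⟨(B.s₂ - B.d₂) / 2, by omega⟩
  have hx' : 2 * (x : ℝ) = B.s₂ + B.d₂ - 2 := by exact_mod_cast hx
  have hy' : 2 * (y : ℝ) = B.s₂ - B.d₂ := by exact_mod_cast hy
  have b1 : 0 < x := by
    have : (0 : ℝ) < x := by linarith
    exact_mod_cast this
  have b2 : x < (m : ℤ) - 1 := by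
    have : (x : ℝ) < m - 1 := by linarith
    exact_mod_cast this
  have b3 : 0 < y + 1 := by
    have : (0 : ℝ) < y + 1 := by linarith
    exact_mod_cast this
  have b4 : y - 1 < (n : ℤ) - 1 := by
    have : (y : ℝ) - 1 < n - 1 := by linarith
    exact_mod_cast this
  apply mem_activeSegments_of_straight hu (x := x) (y := y) (dx := 0) (dy := 1) (by omega) (by unfold InRect; omega) (by omega)
    (h1 _ _ (by unfold InRect; omega) (by omega) (by omega) (by omega))
    (h1 _ _ (by unfold InRect; omega) (by omega) (by omega) (by omega))
    (Or.inr (h0 _ _ (by omega)))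
  apply mem_segment_of ((y + 1 - z.2) / 2) <;> push_cast <;> linarith

theorem mem_activeSegments_of_bottom_side (hu : u ∈ kernel m n c) {B : Block}
    (hB : IsBlock m n c B) (h0 : ∀ x y, B.Mem x y → ext u x y = 0)
    (h1 : ∀ x y : ℤ, InRect m n x y → (x + y - c.parity) % 2 = 0 → ((x : ℝ), (y : ℝ)) ∈ B.oct →
      ¬ B.Mem x y → ext u x y = 1)
    {z : ℝ × ℝ} (hzo : z ∈ B.oct) (hz : z ∈ interior (rect m n)) (l3 : B.s₁ - B.d₂ + 2 = 2 * z.2) :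
    z ∈ activeSegments u := by
  obtain ⟨ps₁, ps₂, pd₁, pd₂, hs, hd, left, right, bottom, top, -, -, -, -⟩ := hB
  obtain ⟨⟨k1, k2⟩, ⟨k3, k4⟩, ⟨k5, k6⟩, k7, k8⟩ := hzo
  simp only [Block.intCast_mem_oct, Block.Mem] at h1
  simp only [Block.Mem] at h0
  obtain ⟨⟨r1, r2⟩, r3, r4⟩ := mem_interior_rect.1 hz
  obtain ⟨x, hx⟩ : ∃ x, 2 * x = B.s₁ + B.d₂ := ⟨(B.s₁ + B.d₂) / 2, by omega⟩
  obtain ⟨y, hy⟩ : ∃ y, 2 * y = B.s₁ - B.d₂ + 2 := ⟨(B.s₁ - B.d₂ + 2) / 2, by omega⟩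
  have hx' : 2 * (x : ℝ) = B.s₁ + B.d₂ := by exact_mod_cast hx
  have hy' : 2 * (y : ℝ) = B.s₁ - B.d₂ + 2 := by exact_mod_cast hy
  have b1 : 0 < x + 1 := by
    have : (0 : ℝ) < x + 1 := by linarith
    exact_mod_cast this
  have b2 : x - 1 < (m : ℤ) - 1 := by
    have : (x : ℝ) - 1 < m - 1 := by linarith
    exact_mod_cast this
  have b3 : 0 < y := by
    have : (0 : ℝ) < y := by linarith
    exact_mod_cast this
  have b4 : y < (n : ℤ) - 1 := by
    have : (y : ℝ) < n - 1 := by linarith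
    exact_mod_cast this
  apply mem_activeSegments_of_straight hu (x := x) (y := y) (dx := 1) (dy := 0) (by omega) (by unfold InRect; omega) (by omega)
    (h1 _ _ (by unfold InRect; omega) (by omega) (by omega) (by omega))
    (h1 _ _ (by unfold InRect; omega) (by omega) (by omega) (by omega))
    (Or.inl (h0 _ _ (by omega)))
  apply mem_segment_of ((x + 1 - z.1) / 2) <;> push_cast <;> linarith

theorem mem_activeSegments_of_top_side (hu : u ∈ kernel m n c) {B : Block}
    (hB : IsBlock m n c B) (h0 : ∀ x y, B.Mem x y → ext u x y = 0)
    (h1 : ∀ x y : ℤ, InRect m n x y → (x + y - c.parity) % 2 = 0 → ((x : ℝ), (y : ℝ)) ∈ B.oct →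
      ¬ B.Mem x y → ext u x y = 1)
    {z : ℝ × ℝ} (hzo : z ∈ B.oct) (hz : z ∈ interior (rect m n)) (l4 : 2 * z.2 = B.s₂ - B.d₁ - 2) :
    z ∈ activeSegments u := by
  obtain ⟨ps₁, ps₂, pd₁, pd₂, hs, hd, left, right, bottom, top, -, -, -, -⟩ := hB
  obtain ⟨⟨k1, k2⟩, ⟨k3, k4⟩, ⟨k5, k6⟩, k7, k8⟩ := hzo
  simp only [Block.intCast_mem_oct, Block.Mem] at h1
  simp only [Block.Mem] at h0
  obtain ⟨⟨r1, r2⟩, r3, r4⟩ := mem_interior_rect.1 hz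
  obtain ⟨x, hx⟩ : ∃ x, 2 * x = B.s₂ + B.d₁ := ⟨(B.s₂ + B.d₁) / 2, by omega⟩
  obtain ⟨y, hy⟩ : ∃ y, 2 * y = B.s₂ - B.d₁ - 2 := ⟨(B.s₂ - B.d₁ - 2) / 2, by omega⟩
  have hx' : 2 * (x : ℝ) = B.s₂ + B.d₁ := by exact_mod_cast hx
  have hy' : 2 * (y : ℝ) = B.s₂ - B.d₁ - 2 := by exact_mod_cast hy
  have b1 : 0 < x + 1 := by
    have : (0 : ℝ) < x + 1 := by linarith
    exact_mod_cast this
  have b2 : x - 1 < (m : ℤ) - 1 := by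
    have : (x : ℝ) - 1 < m - 1 := by linarith
    exact_mod_cast this
  have b3 : 0 < y := by
    have : (0 : ℝ) < y := by linarith
    exact_mod_cast this
  have b4 : y < (n : ℤ) - 1 := by
    have : (y : ℝ) < n - 1 := by linarith
    exact_mod_cast this
  apply mem_activeSegments_of_straight hu (x := x) (y := y) (dx := 1) (dy := 0) (by omega) (by unfold InRect; omega) (by omega)
    (h1 _ _ (by unfold InRect; omega) (by omega) (by omega) (by omega))
    (h1 _ _ (by unfold InRect; omega) (by omega) (by omega) (by omega))
    (Or.inr (h0 _ _ (by omega)))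
  apply mem_segment_of ((x + 1 - z.1) / 2) <;> push_cast <;> linarith

/-- A point of the tile that is inside `R` but not inside the tile satisfies one of the eight bounds
of the octagon with equality, hence lies on one of its sides. -/
theorem fits_block (hm : 2 ≤ m) (hu : u ∈ kernel m n c) {B : Block} (hB : IsBlock m n c B)
    (h0 : ∀ x y, B.Mem x y → ext u x y = 0)
    (h1 : ∀ x y : ℤ, InRect m n x y → (x + y - c.parity) % 2 = 0 → ((x : ℝ), (y : ℝ)) ∈ B.oct →
      ¬ B.Mem x y → ext u x y = 1) : Fits u (B.oct ∩ rect m n) := by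
  refine ⟨Set.inter_subset_right, hB.isColouredTile, ?_, ?_⟩
  · intro z hz
    rw [interior_inter, B.interior_oct] at hz
    exact notMem_activeSegments_of_mem_octInt hB h0 hz.1
  · rintro z ⟨hzo, hzr⟩ hzi hz
    rw [interior_inter, B.interior_oct] at hzi
    by_contra hc
    obtain ⟨⟨k1, k2⟩, ⟨k3, k4⟩, ⟨k5, k6⟩, k7, k8⟩ := id hzo
    refine hzi ⟨⟨⟨k1.lt_of_ne fun h => hc ?_, k2.lt_of_ne fun h => hc ?_⟩,
      ⟨k3.lt_of_ne fun h => hc ?_, k4.lt_of_ne fun h => hc ?_⟩,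
      ⟨k5.lt_of_ne' fun h => hc ?_, k6.lt_of_ne fun h => hc ?_⟩,
      k7.lt_of_ne' fun h => hc ?_, k8.lt_of_ne fun h => hc ?_⟩, hz⟩
    · exact mem_activeSegments_of_left_side hu hB h0 h1 hzo hz h
    · exact mem_activeSegments_of_right_side hu hB h0 h1 hzo hz h
    · exact mem_activeSegments_of_bottom_side hu hB h0 h1 hzo hz h
    · exact mem_activeSegments_of_top_side hu hB h0 h1 hzo hz h
    · exact mem_activeSegments_of_sloped_side hm hu hB h1 hzo hz (by tauto)
    · exact mem_activeSegments_of_sloped_side hm hu hB h1 hzo hz (by tauto)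
    · exact mem_activeSegments_of_sloped_side hm hu hB h1 hzo hz (by tauto)
    · exact mem_activeSegments_of_sloped_side hm hu hB h1 hzo hz (by tauto)

end fits

/-! ### Folding the integers onto an interval -/

/-- The folding of `ℤ` onto `[0, M]` that identifies `k`, `-k` and `k + 2 * M`. -/
def fold (M k : ℤ) : ℤ := if k % (2 * M) ≤ M then k % (2 * M) else 2 * M - k % (2 * M)

section fold
variable {M : ℤ}

theorem fold_eq {r q k : ℤ} (h0 : 0 ≤ r) (h1 : r ≤ M) (hM : 0 < M)
    (hk : k = 2 * M * q + r ∨ k = 2 * M * q - r) : fold M k = r := by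
  unfold fold
  rcases hk with rfl | rfl
  · rw [Int.mul_add_emod_self_left, Int.emod_eq_of_lt h0 (by omega), if_pos h1]
  · rcases h0.eq_or_lt with rfl | h0
    · simp [hM.le]
    · have e : 2 * M * q - r = 2 * M * (q - 1) + (2 * M - r) := by ring
      rw [e, Int.mul_add_emod_self_left, Int.emod_eq_of_lt (by omega) (by omega)]
      split_ifs <;> omega

theorem exists_fold (hM : 0 < M) (k : ℤ) : (0 ≤ fold M k ∧ fold M k ≤ M) ∧
    ∃ q, k = 2 * M * q + fold M k ∨ k = 2 * M * q - fold M k := by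
  have h1 := Int.emod_nonneg k (b := 2 * M) (by omega)
  have h2 := Int.emod_lt_of_pos k (b := 2 * M) (by omega)
  have h3 := Int.emod_add_mul_ediv k (2 * M)
  unfold fold
  split_ifs with h
  · exact ⟨⟨h1, h⟩, k / (2 * M), Or.inl (by omega)⟩
  · refine ⟨⟨by omega, by omega⟩, k / (2 * M) + 1, Or.inr ?_⟩
    rw [mul_add, mul_one]
    omega

theorem fold_nonneg (hM : 0 < M) (k : ℤ) : 0 ≤ fold M k := (exists_fold hM k).1.1

theorem fold_le (hM : 0 < M) (k : ℤ) : fold M k ≤ M := (exists_fold hM k).1.2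

theorem fold_neg (hM : 0 < M) (k : ℤ) : fold M (-k) = fold M k := by
  obtain ⟨⟨h0, h1⟩, q, h⟩ := exists_fold hM k
  refine fold_eq (q := -q) h0 h1 hM ?_
  rw [mul_neg]
  omega

theorem fold_add_two_mul (hM : 0 < M) (k t : ℤ) : fold M (k + 2 * M * t) = fold M k := by
  obtain ⟨⟨h0, h1⟩, q, h⟩ := exists_fold hM k
  refine fold_eq (q := q + t) h0 h1 hM ?_
  rw [mul_add]
  omega

theorem fold_of_mem {k : ℤ} (h0 : 0 ≤ k) (h1 : k ≤ M) (hM : 0 < M) : fold M k = k :=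
  fold_eq (q := 0) h0 h1 hM (by simp)

theorem fold_parity (hM : 0 < M) (k : ℤ) : (fold M k - k) % 2 = 0 := by
  obtain ⟨-, q, h⟩ := exists_fold hM k
  rw [mul_assoc] at h
  omega

/-- Away from the mirrors folding keeps or swaps the two neighbours; at a mirror it identifies them,
so that they will cancel modulo 2. -/
theorem fold_step (hM : 0 < M) (k : ℤ) :
    (0 < fold M k ∧ fold M k < M ∧
      ((fold M (k + 1) = fold M k + 1 ∧ fold M (k - 1) = fold M k - 1) ∨
        (fold M (k + 1) = fold M k - 1 ∧ fold M (k - 1) = fold M k + 1))) ∨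
    ((fold M k = 0 ∨ fold M k = M) ∧ fold M (k + 1) = fold M (k - 1)) := by
  obtain ⟨⟨h0, h1⟩, q, h⟩ := exists_fold hM k
  set r := fold M k
  rcases h0.eq_or_lt with h0 | h0
  · right
    refine ⟨Or.inl h0.symm, ?_⟩
    rw [fold_eq (r := 1) (q := q) (by omega) (by omega) hM (by omega),
      fold_eq (r := 1) (q := q) (by omega) (by omega) hM (by omega)]
  rcases h1.eq_or_lt with h1 | h1
  · right
    refine ⟨Or.inr h1, ?_⟩
    rcases h with h | h
    · rw [fold_eq (r := M - 1) (q := q + 1) (by omega) (by omega) hM (by rw [mul_add]; omega),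
        fold_eq (r := M - 1) (q := q) (by omega) (by omega) hM (by omega)]
    · rw [fold_eq (r := M - 1) (q := q) (by omega) (by omega) hM (by omega),
        fold_eq (r := M - 1) (q := q - 1) (by omega) (by omega) hM (by rw [mul_sub]; omega)]
  left
  refine ⟨h0, h1, ?_⟩
  rcases h with h | h
  · left
    exact ⟨fold_eq (q := q) (by omega) (by omega) hM (by omega),
      fold_eq (q := q) (by omega) (by omega) hM (by omega)⟩
  · right
    exact ⟨fold_eq (q := q) (by omega) (by omega) hM (by omega),
      fold_eq (q := q) (by omega) (by omega) hM (by omega)⟩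

end fold

/-! ### Profiles -/

/-- Discrete d'Alembert formula: the increment in the second variable does not depend on the first
variable. -/
theorem add_eq_of_mixed_difference {f : ℤ → ℤ → ZMod 2}
    (h : ∀ i j, f (i + 1) (j + 1) + f i j + f (i + 1) j + f i (j + 1) = 0) (i j : ℤ) :
    f i j = f i 0 + f 0 j + f 0 0 := by
  have h2 : ∀ a : ZMod 2, a + a = 0 := CharTwo.add_self_eq_zero
  have e1 : ∀ j i, f i (j + 1) + f i j = f 0 (j + 1) + f 0 j := by
    intro j i
    induction i using Int.induction_on with
    | zero => rfl
    | succ i ih =>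
      rw [← ih]
      linear_combination h i j - h2 (f i (j + 1)) - h2 (f i j)
    | pred i ih =>
      rw [← ih]
      have := h (-i - 1) j
      rw [sub_add_cancel] at this
      linear_combination this - h2 (f (-i) (j + 1)) - h2 (f (-i) j)
  induction j using Int.induction_on with
  | zero => linear_combination - h2 (f 0 0)
  | succ j ih => linear_combination e1 j i + ih + h2 (f 0 j) - h2 (f i j)
  | pred j ih =>
    have := e1 (-j - 1) i
    rw [sub_add_cancel] at this
    linear_combination this + ih + h2 (f 0 (-j)) - h2 (f i (-j))

/-- A function on the integers of the parity of `c` that is even and has periods `2 * (m + 1)` and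
`2 * (n + 1)`. -/
structure IsProfile (m n : ℕ) (c : Colour) (γ : ℤ → ZMod 2) : Prop where
  neg : ∀ k : ℤ, (k - c.parity) % 2 = 0 → γ (-k) = γ k
  add_m : ∀ k : ℤ, (k - c.parity) % 2 = 0 → γ (k + 2 * (m + 1)) = γ k
  add_n : ∀ k : ℤ, (k - c.parity) % 2 = 0 → γ (k + 2 * (n + 1)) = γ k

section profile
variable {m n : ℕ} {c : Colour} (u : Pt m n c → ZMod 2)

/-- The extension of `u` to the plane by reflections; the lines `X = 0`, `X = m + 1`, `Y = 0`,
`Y = n + 1` bound the rectangle. -/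
noncomputable def unfolded (X Y : ℤ) : ZMod 2 := ext u (fold (m + 1) X - 1) (fold (n + 1) Y - 1)

/-- The profile of `u`. -/
noncomputable def profile (k : ℤ) : ZMod 2 := unfolded u ((k + 1) / 2) (k / 2)

theorem unfolded_eq_zero_left {X : ℤ} (h : fold (m + 1) X = 0 ∨ fold (m + 1) X = m + 1) (Y : ℤ) :
    unfolded u X Y = 0 := by
  apply ext_eq_zero_of_not
  unfold InRect
  omega

theorem unfolded_eq_zero_right {Y : ℤ} (h : fold (n + 1) Y = 0 ∨ fold (n + 1) Y = n + 1) (X : ℤ) :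
    unfolded u X Y = 0 := by
  apply ext_eq_zero_of_not
  unfold InRect
  omega

theorem unfolded_eq_ext {x y : ℤ} (h1 : -1 ≤ x) (h2 : x ≤ m) (h3 : -1 ≤ y) (h4 : y ≤ n) :
    unfolded u (x + 1) (y + 1) = ext u x y := by
  unfold unfolded
  rw [fold_of_mem (by omega) (by omega) (by omega), fold_of_mem (by omega) (by omega) (by omega),
    add_sub_cancel_right, add_sub_cancel_right]

variable {u}

/-- Off the mirror lines this is a row of the kernel equation at the folded position, up to swapping
opposite neighbours. On a mirror line two neighbours lie on the line and vanish, and the other two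
are mirror images whose values cancel in characteristic 2. -/
theorem unfolded_sum_eq_zero (hu : u ∈ kernel m n c) {X Y : ℤ} (h : (X + Y - c.parity) % 2 = 1) :
    unfolded u (X + 1) Y + unfolded u (X - 1) Y + unfolded u X (Y + 1) + unfolded u X (Y - 1) =
      0 := by
  have hM : (0 : ℤ) < m + 1 := by omega
  have hN : (0 : ℤ) < n + 1 := by omega
  rcases fold_step hM X with ⟨a1, a2, a3⟩ | ⟨a1, a2⟩
  swap
  · rw [unfolded_eq_zero_left u a1, unfolded_eq_zero_left u a1, add_zero, add_zero]
    unfold unfolded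
    rw [a2, CharTwo.add_self_eq_zero]
  rcases fold_step hN Y with ⟨b1, b2, b3⟩ | ⟨b1, b2⟩
  swap
  · rw [unfolded_eq_zero_right u b1, unfolded_eq_zero_right u b1, add_zero, zero_add]
    unfold unfolded
    rw [b2, CharTwo.add_self_eq_zero]
  have p1 := fold_parity hM X
  have p2 := fold_parity hN Y
  have hk := (mem_kernel_iff u).1 hu (fold (m + 1) X - 1) (fold (n + 1) Y - 1)
    (by unfold InRect; omega) (by omega)
  unfold unfolded
  rw [← hk]
  rcases a3 with ⟨a3, a4⟩ | ⟨a3, a4⟩ <;> rcases b3 with ⟨b3, b4⟩ | ⟨b3, b4⟩ <;>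
    rw [a3, a4, b3, b4] <;> ring_nf

/-- In the coordinates `X + Y` and `X - Y`, halved, the four neighbours of a point of the opposite
colour are the corners of a unit square, so the mixed difference vanishes. A priori there are two
functions of one variable; reflection in `Y = 0` shows that they coincide. -/
theorem unfolded_eq_add (hu : u ∈ kernel m n c) {X Y : ℤ} (h : (X + Y - c.parity) % 2 = 0) :
    unfolded u X Y = profile u (X + Y) + profile u (X - Y) := by
  have hM : (0 : ℤ) < m + 1 := by omega
  have hN : (0 : ℤ) < n + 1 := by omega
  set π := c.parity with hπ
  have hc : π = 0 ∨ π = 1 := c.parity_cases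
  have hf := add_eq_of_mixed_difference (f := fun i j => unfolded u (i + j + π) (i - j)) (by
    intro i j
    have := unfolded_sum_eq_zero hu (X := i + j + 1 + π) (Y := i - j) (by omega)
    rw [← this]
    rw [show i + 1 + (j + 1) + π = i + j + 1 + π + 1 by ring,
      show i + 1 - (j + 1) = i - j by ring, show i + j + 1 + π - 1 = i + j + π by ring,
      show i + 1 + j + π = i + j + 1 + π by ring, show i + 1 - j = i - j + 1 by ring,
      show i + (j + 1) + π = i + j + 1 + π by ring, show i - (j + 1) = i - j - 1 by ring])
  obtain ⟨i, hi⟩ : ∃ i, X + Y = 2 * i + π := ⟨(X + Y - π) / 2, by omega⟩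
  obtain ⟨j, hj⟩ : ∃ j, X - Y = 2 * j + π := ⟨(X - Y - π) / 2, by omega⟩
  have hp : ∀ i, profile u (2 * i + π) = unfolded u (i + π) i := by
    intro i
    unfold profile
    rw [show (2 * i + π + 1) / 2 = i + π by omega, show (2 * i + π) / 2 = i by omega]
  have := hf i j
  simp only [add_zero, zero_add, sub_zero, zero_sub] at this
  rw [show i + j + π = X by omega, show i - j = Y by omega] at this
  have hneg : unfolded u (j + π) (-j) = unfolded u (j + π) j := by
    unfold unfolded
    rw [fold_neg hN]
  have h0 : unfolded u π 0 = 0 :=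
    unfolded_eq_zero_right u (Or.inl (fold_of_mem le_rfl (by omega) hN)) _
  rw [this, hi, hj, hp, hp, hneg, h0, add_zero]

theorem eq_of_add_eq_zero {a b : ZMod 2} (h : a + b = 0) : a = b := by
  revert a b; decide

/-- Each symmetry is the vanishing on one mirror line: `X = 0` gives evenness, `X = m + 1` and `Y =
n + 1` give, together with evenness where needed, the two periods. -/
theorem isProfile_profile (hu : u ∈ kernel m n c) : IsProfile m n c (profile u) := by
  have hM : (0 : ℤ) < m + 1 := by omega
  have hN : (0 : ℤ) < n + 1 := by omega
  have hneg : ∀ k : ℤ, (k - c.parity) % 2 = 0 → profile u (-k) = profile u k := by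
    intro k hk
    have := unfolded_eq_add hu (X := 0) (Y := k) (by omega)
    rw [unfolded_eq_zero_left u (Or.inl (fold_of_mem le_rfl (by omega) hM)), zero_add,
      zero_sub] at this
    exact (eq_of_add_eq_zero this.symm).symm
  refine ⟨hneg, ?_, ?_⟩
  · intro k hk
    have := unfolded_eq_add hu (X := m + 1) (Y := k + (m + 1)) (by omega)
    rw [unfolded_eq_zero_left u (Or.inr (fold_of_mem (by omega) le_rfl hM))] at this
    rw [show k + 2 * ((m : ℤ) + 1) = m + 1 + (k + (m + 1)) by ring,
      eq_of_add_eq_zero this.symm, show (m : ℤ) + 1 - (k + (m + 1)) = -k by ring, hneg k hk]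
  · intro k hk
    have := unfolded_eq_add hu (X := k + (n + 1)) (Y := n + 1) (by omega)
    rw [unfolded_eq_zero_right u (Or.inr (fold_of_mem (by omega) le_rfl hN))] at this
    rw [show k + 2 * ((n : ℤ) + 1) = k + (n + 1) + (n + 1) by ring,
      eq_of_add_eq_zero this.symm, add_sub_cancel_right]

/-- The asymmetry `x + y + 2` against `x - y` comes from the shift of both coordinates by one. The
formula remains valid on the frame one step outside the rectangle. -/
theorem ext_eq_profile (hu : u ∈ kernel m n c) {x y : ℤ} (h1 : -1 ≤ x) (h2 : x ≤ m) (h3 : -1 ≤ y)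
    (h4 : y ≤ n) (h : (x + y - c.parity) % 2 = 0) :
    ext u x y = profile u (x + y + 2) + profile u (x - y) := by
  rw [← unfolded_eq_ext u h1 h2 h3 h4, unfolded_eq_add hu (by omega)]
  congr 2 <;> ring

end profile

/-! ### Runs of a profile -/

/-- `k` with `a < k < b` is a maximal interval, in the integers of the parity of `c`, on which `γ`
takes the value `ε`. -/
structure IsRun (c : Colour) (γ : ℤ → ZMod 2) (ε : ZMod 2) (a b : ℤ) : Prop where
  pa : (a - c.parity) % 2 = 0
  pb : (b - c.parity) % 2 = 0
  ha : γ a ≠ ε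
  hb : γ b ≠ ε
  h : ∀ k, a < k → k < b → (k - c.parity) % 2 = 0 → γ k = ε

section runs
variable {m n : ℕ} {c : Colour} {γ : ℤ → ZMod 2} {ε : ZMod 2} {a b a' b' : ℤ}

/-- If the runs overlapped without coinciding, an endpoint of one would be inside the other and take
the value `ε`. This rigidity is the source of the symmetry of blocks at the boundary of `R`. -/
theorem IsRun.eq (h : IsRun c γ ε a b) (h' : IsRun c γ ε a' b') (h1 : a < b') (h2 : a' < b) :
    a = a' ∧ b = b' := by
  constructor
  · rcases lt_trichotomy a a' with hl | hl | hl
    · exact absurd (h.h a' hl h2 h'.pa) h'.ha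
    · exact hl
    · exact absurd (h'.h a hl h1 h.pa) h.ha
  · rcases lt_trichotomy b b' with hl | hl | hl
    · exact absurd (h'.h b h2 hl h.pb) h.hb
    · exact hl
    · exact absurd (h.h b' h1 hl h'.pb) h'.hb

theorem IsRun.neg (hγ : IsProfile m n c γ) (h : IsRun c γ ε a b) : IsRun c γ ε (-b) (-a) := by
  have hc := c.parity_cases
  obtain ⟨pa, pb, ha, hb, h⟩ := h
  refine ⟨by omega, by omega, by rwa [hγ.neg b pb], by rwa [hγ.neg a pa], fun k h1 h2 h3 => ?_⟩
  rw [← hγ.neg k h3]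
  exact h _ (by omega) (by omega) (by omega)

theorem IsRun.add_m (hγ : IsProfile m n c γ) (h : IsRun c γ ε a b) :
    IsRun c γ ε (a + 2 * (m + 1)) (b + 2 * (m + 1)) := by
  obtain ⟨pa, pb, ha, hb, h⟩ := h
  refine ⟨by omega, by omega, by rwa [hγ.add_m a pa], by rwa [hγ.add_m b pb],
    fun k h1 h2 h3 => ?_⟩
  rw [← h (k - 2 * (m + 1)) (by omega) (by omega) (by omega),
    ← hγ.add_m (k - 2 * (m + 1)) (by omega), sub_add_cancel]

theorem IsRun.add_n (hγ : IsProfile m n c γ) (h : IsRun c γ ε a b) :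
    IsRun c γ ε (a + 2 * (n + 1)) (b + 2 * (n + 1)) := by
  obtain ⟨pa, pb, ha, hb, h⟩ := h
  refine ⟨by omega, by omega, by rwa [hγ.add_n a pa], by rwa [hγ.add_n b pb],
    fun k h1 h2 h3 => ?_⟩
  rw [← h (k - 2 * (n + 1)) (by omega) (by omega) (by omega),
    ← hγ.add_n (k - 2 * (n + 1)) (by omega), sub_add_cancel]

theorem IsProfile.add_mul (hγ : IsProfile m n c γ) {k : ℤ} (hk : (k - c.parity) % 2 = 0) (t : ℕ) :
    γ (k + 2 * (m + 1) * t) = γ k := by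
  induction t with
  | zero => simp
  | succ t ih =>
    rw [← ih, ← hγ.add_m (k + 2 * (m + 1) * t) (by rw [mul_assoc]; omega)]
    congr 1
    push_cast
    ring

theorem IsProfile.exists_next (hγ : IsProfile m n c γ) {k₀ k₁ : ℤ} (h₁ : (k₁ - c.parity) % 2 = 0)
    (hne : γ k₁ ≠ ε) : ∃ b, k₀ < b ∧ (b - c.parity) % 2 = 0 ∧ γ b ≠ ε ∧
      ∀ k, k₀ < k → k < b → (k - c.parity) % 2 = 0 → γ k = ε := by
  obtain ⟨b, ⟨h1, h2, h3⟩, hmin⟩ := Int.exists_least_of_bdd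
    (P := fun b => k₀ < b ∧ (b - c.parity) % 2 = 0 ∧ γ b ≠ ε) ⟨k₀, fun z hz => hz.1.le⟩ (by
      -- Enough periods are added to `k₁` to move it beyond `k₀`.
      refine ⟨k₁ + 2 * (m + 1) * ((k₀ - k₁).toNat + 1 : ℕ), ?_, ?_, ?_⟩
      · have : (k₀ - k₁).toNat + 1 ≤ (m + 1) * ((k₀ - k₁).toNat + 1) :=
          Nat.le_mul_of_pos_left _ (by omega)
        have h' : (((k₀ - k₁).toNat + 1 : ℕ) : ℤ) ≤ (m + 1) * ((k₀ - k₁).toNat + 1 : ℕ) := by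
          exact_mod_cast this
        rw [mul_assoc]
        omega
      · rw [mul_assoc]; omega
      · rwa [hγ.add_mul h₁])
  refine ⟨b, h1, h2, h3, fun k hk1 hk2 hk3 => ?_⟩
  by_contra hc
  have := hmin k ⟨hk1, hk3, hc⟩
  omega

theorem IsProfile.exists_run (hγ : IsProfile m n c γ) {k₀ k₁ : ℤ} (h₀ : (k₀ - c.parity) % 2 = 0)
    (h₁ : (k₁ - c.parity) % 2 = 0) (hne : γ k₁ ≠ γ k₀) :
    ∃ a b, a < k₀ ∧ k₀ < b ∧ IsRun c γ (γ k₀) a b := by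
  have hc := c.parity_cases
  obtain ⟨b, b1, b2, b3, b4⟩ := hγ.exists_next (k₀ := k₀) h₁ hne
  -- By evenness, the left end of the run around `k₀` is minus the right end of the run around
  -- `-k₀`.
  obtain ⟨a, a1, a2, a3, a4⟩ := hγ.exists_next (k₀ := -k₀) h₁ hne
  refine ⟨-a, b, by omega, b1, by omega, b2, by rwa [hγ.neg a a2], b3, fun k h1 h2 h3 => ?_⟩
  rcases lt_trichotomy k k₀ with h | rfl | h
  · rw [← hγ.neg k h3]
    exact a4 _ (by omega) (by omega) (by omega)
  · rfl
  · exact b4 k h h2 h3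

end runs

/-! ### The components of a kernel vector form a coloured tiling -/

section mapsTo
variable {m n : ℕ} {c : Colour} {u : Pt m n c → ZMod 2} {γ : ℤ → ZMod 2} {ε : ZMod 2} {B : Block}

/-- If a side of `R` cuts the octagon, the run of `x + y + 2` overlaps the image of the run of `x -
y` under the symmetry of the profile attached to that side. Both carry the value `ε`, so they
coincide, which is the required symmetry of the block. -/
theorem isBlock_of_isRun (hγ : IsProfile m n c γ) (hI : IsRun c γ ε (B.s₁ + 2) (B.s₂ + 2))
    (hJ : IsRun c γ ε B.d₁ B.d₂) (hs : B.s₁ + 4 ≤ B.s₂) (hd : B.d₁ + 4 ≤ B.d₂)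
    (nd₁ : 4 ≤ B.s₂ + B.d₂) (nd₂ : B.s₁ + B.d₁ + 6 ≤ 2 * m) (nd₃ : 4 ≤ B.s₂ - B.d₁)
    (nd₄ : B.s₁ - B.d₂ + 6 ≤ 2 * n) : IsBlock m n c B := by
  have h1 := hI.pa
  have h2 := hI.pb
  refine ⟨by omega, by omega, hJ.pa, hJ.pb, hs, hd, ?_, ?_, ?_, ?_, nd₁, nd₂, nd₃, nd₄⟩
  · by_contra hc
    push Not at hc
    have := hI.eq (hJ.neg hγ) (by omega) (by omega)
    omega
  · by_contra hc
    push Not at hc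
    have := hI.eq ((hJ.neg hγ).add_m hγ) (by omega) (by omega)
    omega
  · by_contra hc
    push Not at hc
    have := hI.eq hJ (by omega) (by omega)
    omega
  · by_contra hc
    push Not at hc
    have := hI.eq (hJ.add_n hγ) (by omega) (by omega)
    omega

theorem eq_add_one_of_ne {a b : ZMod 2} (h : a ≠ b) : a = b + 1 := by
  revert a b; decide

/-- In the block both profile values are `ε` and cancel. At a point of the octagon outside the block
exactly one of them has changed, because the truncation removes the corners, where both would
change. -/
theorem fits_of_isRun (hm : 2 ≤ m) (hu : u ∈ kernel m n c)
    (hI : IsRun c (profile u) ε (B.s₁ + 2) (B.s₂ + 2)) (hJ : IsRun c (profile u) ε B.d₁ B.d₂)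
    (hB : IsBlock m n c B) : Fits u (B.oct ∩ rect m n) := by
  have hI₁ := hI.pa
  have hJ₁ := hJ.pa
  have ps := hB.ps₂
  have pd := hB.pd₂
  have h2 : ε + ε = 0 := CharTwo.add_self_eq_zero ε
  apply fits_block hm hu hB
  · rintro x y ⟨⟨a1, a2⟩, a3, a4⟩
    by_cases hr : InRect m n x y
    swap
    · exact ext_eq_zero_of_not u hr
    by_cases hc : (x + y - c.parity) % 2 = 0
    swap
    · exact ext_eq_zero_of_colour u hc
    obtain ⟨r1, r2, r3, r4⟩ := hr
    rw [ext_eq_profile hu (by omega) (by omega) (by omega) (by omega) hc,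
      hI.h _ (by omega) (by omega) (by omega), hJ.h _ a3 a4 (by omega), h2]
  · rintro x y ⟨r1, r2, r3, r4⟩ hc ho hn
    rw [Block.intCast_mem_oct] at ho
    unfold Block.Mem at hn
    have hs := hB.hs
    have hd := hB.hd
    rw [ext_eq_profile hu (by omega) (by omega) (by omega) (by omega) hc]
    by_cases e1 : B.s₁ < x + y ∧ x + y < B.s₂
    · rw [hI.h _ (by omega) (by omega) (by omega)]
      have : x - y = B.d₁ ∨ x - y = B.d₂ := by omega
      rcases this with h | h
      · rw [h, eq_add_one_of_ne hJ.ha]; linear_combination h2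
      · rw [h, eq_add_one_of_ne hJ.hb]; linear_combination h2
    · have e2 : B.d₁ < x - y ∧ x - y < B.d₂ := by omega
      rw [hJ.h _ e2.1 e2.2 (by omega)]
      have : x + y = B.s₁ ∨ x + y = B.s₂ := by omega
      rcases this with h | h
      · rw [h, eq_add_one_of_ne hI.ha]; linear_combination h2
      · rw [h, eq_add_one_of_ne hI.hb]; linear_combination h2

/-- A constant profile would give the zero vector; hence runs are bounded for `u ≠ 0`. -/
theorem exists_profile_ne (hu : u ∈ kernel m n c) (h : u ≠ 0) (k : ℤ) :
    ∃ k₁, (k₁ - c.parity) % 2 = 0 ∧ profile u k₁ ≠ profile u k := by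
  have hpar := c.parity_cases
  obtain ⟨b, hb⟩ : ∃ b, u b ≠ 0 := by
    by_contra hc
    push Not at hc
    exact h (funext hc)
  obtain ⟨r1, r2, r3, r4⟩ := b.coord_inRect
  have hc := b.coord_colour
  rw [← ext_coord u b, ext_eq_profile hu (by omega) (by omega) (by omega) (by omega) hc] at hb
  by_contra hcon
  push Not at hcon
  apply hb
  rw [hcon (b.coord.1 + b.coord.2 + 2) (by omega), hcon (b.coord.1 - b.coord.2) (by omega),
    CharTwo.add_self_eq_zero]

/-- Every inactive point of the closed frame of the rectangle lies in a block of inactive points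
that is bounded by active ones. -/
theorem exists_isRun_of_ext_eq_zero (hu : u ∈ kernel m n c) (h : u ≠ 0) {x y : ℤ} (h1 : -1 ≤ x)
    (h2 : x ≤ m) (h3 : -1 ≤ y) (h4 : y ≤ n) (hc : (x + y - c.parity) % 2 = 0)
    (h0 : ext u x y = 0) : ∃ (B : Block) (ε : ZMod 2), B.Mem x y ∧
      IsRun c (profile u) ε (B.s₁ + 2) (B.s₂ + 2) ∧ IsRun c (profile u) ε B.d₁ B.d₂ := by
  rw [ext_eq_profile hu h1 h2 h3 h4 hc] at h0
  have he := eq_of_add_eq_zero h0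
  obtain ⟨k₁, hk₁, hne⟩ := exists_profile_ne hu h (x - y)
  obtain ⟨a, b, a1, a2, a3⟩ := (isProfile_profile hu).exists_run (k₀ := x - y) (by omega) hk₁ hne
  obtain ⟨a', b', a1', a2', a3'⟩ := (isProfile_profile hu).exists_run (k₀ := x + y + 2) (by omega)
    hk₁ (by rwa [he])
  refine ⟨⟨a' - 2, b' - 2, a, b⟩, profile u (x - y), ?_, ?_, a3⟩
  · unfold Block.Mem
    simp only
    omega
  · simp only [sub_add_cancel]
    rwa [he] at a3'

/-- The right isosceles triangle with legs of length one on the grid lines at a point of the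
opposite colour is contained in a tile. -/
theorem exists_fits_of_quarter (hm : 2 ≤ m) (hu : u ∈ kernel m n c) (h : u ≠ 0) {x y e f : ℤ}
    (he : e = 1 ∨ e = -1) (hf : f = 1 ∨ f = -1) (hc : (x + y - c.parity) % 2 = 1)
    (hw : InRect m n x y) (h1 : InRect m n (x + e) y) (h2 : InRect m n x (y + f)) {α β : ℝ}
    (hα : 0 ≤ α) (hβ : 0 ≤ β) (hαβ : α + β ≤ 1) {z : ℝ × ℝ} (hz₁ : z.1 = x + e * α)
    (hz₂ : z.2 = y + f * β) (hz : z ∈ rect m n) : ∃ t, Fits u t ∧ z ∈ t := by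
  obtain ⟨w1, w2, w3, w4⟩ := hw
  obtain ⟨v1, v2, v3, v4⟩ := h1
  obtain ⟨t1, t2, t3, t4⟩ := h2
  have hpro := isProfile_profile hu
  have hpar := c.parity_cases
  -- an inactive endpoint of a leg
  have near : ∀ x' y' : ℤ, InRect m n x' y' → (x' + y' - c.parity) % 2 = 0 → ext u x' y' = 0 →
      ((x' : ℝ) - 1 ≤ z.1 ∧ z.1 ≤ x' + 1 ∧ (y' : ℝ) - 1 ≤ z.2 ∧ z.2 ≤ y' + 1) →
      ∃ t, Fits u t ∧ z ∈ t := by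
    rintro x' y' ⟨r1, r2, r3, r4⟩ hc' h0 ⟨z1, z2, z3, z4⟩
    obtain ⟨B, ε, ⟨⟨m1, m2⟩, m3, m4⟩, hI, hJ⟩ := exists_isRun_of_ext_eq_zero hu h (by omega)
      (by omega) (by omega) (by omega) hc' h0
    have p1 := hI.pa
    have p2 := hI.pb
    have p3 := hJ.pa
    have p4 := hJ.pb
    have hB := isBlock_of_isRun hpro hI hJ (by omega) (by omega) (by omega) (by omega) (by omega)
      (by omega)
    refine ⟨_, fits_of_isRun hm hu hI hJ hB, ?_, hz⟩
    -- By parity a point of the block is at least two away from every bound, so the octagon contains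
    -- the whole square of side two centred at that point.
    have q1 : (B.s₁ : ℝ) + 2 ≤ x' + y' := by exact_mod_cast (show B.s₁ + 2 ≤ x' + y' by omega)
    have q2 : (x' : ℝ) + y' + 2 ≤ B.s₂ := by exact_mod_cast (show x' + y' + 2 ≤ B.s₂ by omega)
    have q3 : (B.d₁ : ℝ) + 2 ≤ x' - y' := by exact_mod_cast (show B.d₁ + 2 ≤ x' - y' by omega)
    have q4 : (x' : ℝ) - y' + 2 ≤ B.d₂ := by exact_mod_cast (show x' - y' + 2 ≤ B.d₂ by omega)
    refine ⟨⟨?_, ?_⟩, ⟨?_, ?_⟩, ⟨?_, ?_⟩, ?_, ?_⟩ <;> linarith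
  rcases zmod2_cases (ext u (x + e) y) with e1 | e1
  · apply near (x + e) y ⟨v1, v2, v3, v4⟩ (by omega) e1
    rw [hz₁, hz₂]
    rcases he with rfl | rfl <;> rcases hf with rfl | rfl <;> push_cast <;>
      refine ⟨?_, ?_, ?_, ?_⟩ <;> linarith
  rcases zmod2_cases (ext u x (y + f)) with e2 | e2
  · apply near x (y + f) ⟨t1, t2, t3, t4⟩ (by omega) e2
    rw [hz₁, hz₂]
    rcases he with rfl | rfl <;> rcases hf with rfl | rfl <;> push_cast <;>
      refine ⟨?_, ?_, ?_, ?_⟩ <;> linarith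
  -- Both ends of the legs are active from here on, so the other two neighbours of the right-angle
  -- vertex agree: if both are active the tile is a diamond, otherwise it is a truncated octagon.
  have hk : ext u (x - e) y = ext u x (y - f) := by
    have hk := (mem_kernel_iff u).1 hu x y ⟨w1, w2, w3, w4⟩ hc
    apply eq_of_add_eq_zero
    have h2 : (1 : ZMod 2) + 1 = 0 := rfl
    rcases he with rfl | rfl <;> rcases hf with rfl | rfl <;>
      (try simp only [← sub_eq_add_neg, sub_neg_eq_add] at *) <;>
      linear_combination hk - e1 - e2 - h2
  rcases zmod2_cases (ext u (x - e) y) with e3 | e3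
  swap
  · have e4 := hk ▸ e3
    refine ⟨diamond x y, ?_, ?_⟩
    · apply fits_diamond hc <;> rcases he with rfl | rfl <;> rcases hf with rfl | rfl <;>
        (try simp only [← sub_eq_add_neg, sub_neg_eq_add] at *) <;> assumption
    · unfold diamond
      rw [Set.mem_ofPred_eq, hz₁, hz₂]
      rcases he with rfl | rfl <;> rcases hf with rfl | rfl <;> push_cast <;>
        refine ⟨⟨?_, ?_⟩, ?_, ?_⟩ <;> linarith
  have e4 := hk ▸ e3
  obtain ⟨B, ε, ⟨⟨m1, m2⟩, m3, m4⟩, hI, hJ⟩ := exists_isRun_of_ext_eq_zero hu h (by omega)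
    (by omega) (by omega) (by omega) (by omega) e3
  have p1 := hI.pa
  have p2 := hI.pb
  have p3 := hJ.pa
  have p4 := hJ.pb
  have f1 := ext_eq_profile hu (x := x + e) (y := y) (by omega) (by omega) (by omega) (by omega)
    (by omega)
  have f2 := ext_eq_profile hu (x := x) (y := y + f) (by omega) (by omega) (by omega) (by omega)
    (by omega)
  have f3 := ext_eq_profile hu (x := x - e) (y := y) (by omega) (by omega) (by omega) (by omega)
    (by omega)
  have f4 := ext_eq_profile hu (x := x) (y := y - f) (by omega) (by omega) (by omega) (by omega)
    (by omega)
  rw [e1] at f1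
  rw [e2] at f2
  rw [e3] at f3
  rw [e4] at f4
  replace f3 := eq_of_add_eq_zero f3.symm
  replace f4 := eq_of_add_eq_zero f4.symm
  have g3 : profile u (x - e - y) = ε := hJ.h _ m3 m4 (by omega)
  rw [g3] at f3
  have fin : B.s₁ + 4 ≤ B.s₂ → B.d₁ + 4 ≤ B.d₂ →
      4 ≤ B.s₂ + B.d₂ → B.s₁ + B.d₁ + 6 ≤ 2 * m → 4 ≤ B.s₂ - B.d₁ → B.s₁ - B.d₂ + 6 ≤ 2 * n →
      z ∈ B.oct → ∃ t, Fits u t ∧ z ∈ t := fun i1 i2 i3 i4 i5 i6 hzB =>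
    ⟨_, fits_of_isRun hm hu hI hJ (isBlock_of_isRun hpro hI hJ i1 i2 i3 i4 i5 i6), hzB, hz⟩
  -- When `f = e`, the two inactive neighbours share the value of `x + y` and lie in one block,
  -- while the two active ones lie on one of its side lines `x + y = const`. The hypotenuse is then
  -- on a sloped side of the octagon. When `f = -e`, the roles of sum and difference are exchanged.
  by_cases hef : f = e
  · subst hef

    rw [show x + (y - f) + 2 = x - f + y + 2 by ring, f3] at f4
    rw [← show x + f - y = x - (y - f) by ring] at f4
    have n1 : x + f - y ≠ B.d₁ := fun hh => hJ.ha (hh ▸ f4.symm)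
    have n2 : x + f - y ≠ B.d₂ := fun hh => hJ.hb (hh ▸ f4.symm)
    rw [← f4] at f1
    have n3 : ¬ (B.s₁ + 2 < x + f + y + 2 ∧ x + f + y + 2 < B.s₂ + 2) := fun hh => by
      rw [hI.h _ hh.1 hh.2 (by omega), CharTwo.add_self_eq_zero] at f1
      exact one_ne_zero f1
    rcases he with rfl | rfl
    · have q1 : (B.s₁ : ℝ) + 3 ≤ x + y := by exact_mod_cast (show B.s₁ + 3 ≤ x + y by omega)
      have q2 : (x : ℝ) + y + 1 ≤ B.s₂ := by exact_mod_cast (show x + y + 1 ≤ B.s₂ by omega)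
      have q3 : (B.d₁ : ℝ) + 3 ≤ x - y := by exact_mod_cast (show B.d₁ + 3 ≤ x - y by omega)
      have q4 : (x : ℝ) - y + 3 ≤ B.d₂ := by exact_mod_cast (show x - y + 3 ≤ B.d₂ by omega)
      push_cast at hz₁ hz₂
      apply fin <;> first | omega | skip
      refine ⟨⟨?_, ?_⟩, ⟨?_, ?_⟩, ⟨?_, ?_⟩, ?_, ?_⟩ <;> linarith
    · have q1 : (B.s₁ : ℝ) + 1 ≤ x + y := by exact_mod_cast (show B.s₁ + 1 ≤ x + y by omega)
      have q2 : (x : ℝ) + y + 3 ≤ B.s₂ := by exact_mod_cast (show x + y + 3 ≤ B.s₂ by omega)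
      have q3 : (B.d₁ : ℝ) + 3 ≤ x - y := by exact_mod_cast (show B.d₁ + 3 ≤ x - y by omega)
      have q4 : (x : ℝ) - y + 3 ≤ B.d₂ := by exact_mod_cast (show x - y + 3 ≤ B.d₂ by omega)
      push_cast at hz₁ hz₂
      apply fin <;> first | omega | skip
      refine ⟨⟨?_, ?_⟩, ⟨?_, ?_⟩, ⟨?_, ?_⟩, ?_, ?_⟩ <;> linarith
  · obtain rfl : f = -e := by omega
    rw [show x - (y - -e) = x - e - y by ring, g3,
      show x + (y - -e) + 2 = x + e + y + 2 by ring] at f4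
    have n1 : x + e + y + 2 ≠ B.s₁ + 2 := fun hh => hI.ha (hh ▸ f4)
    have n2 : x + e + y + 2 ≠ B.s₂ + 2 := fun hh => hI.hb (hh ▸ f4)
    rw [f4] at f1
    have n3 : ¬ (B.d₁ < x + e - y ∧ x + e - y < B.d₂) := fun hh => by
      rw [hJ.h _ hh.1 hh.2 (by omega), CharTwo.add_self_eq_zero] at f1
      exact one_ne_zero f1
    rcases he with rfl | rfl
    · have q1 : (B.s₁ : ℝ) + 3 ≤ x + y := by exact_mod_cast (show B.s₁ + 3 ≤ x + y by omega)
      have q2 : (x : ℝ) + y + 3 ≤ B.s₂ := by exact_mod_cast (show x + y + 3 ≤ B.s₂ by omega)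
      have q3 : (B.d₁ : ℝ) + 3 ≤ x - y := by exact_mod_cast (show B.d₁ + 3 ≤ x - y by omega)
      have q4 : (x : ℝ) - y + 1 ≤ B.d₂ := by exact_mod_cast (show x - y + 1 ≤ B.d₂ by omega)
      push_cast at hz₁ hz₂
      apply fin <;> first | omega | skip
      refine ⟨⟨?_, ?_⟩, ⟨?_, ?_⟩, ⟨?_, ?_⟩, ?_, ?_⟩ <;> linarith
    · have q1 : (B.s₁ : ℝ) + 3 ≤ x + y := by exact_mod_cast (show B.s₁ + 3 ≤ x + y by omega)
      have q2 : (x : ℝ) + y + 3 ≤ B.s₂ := by exact_mod_cast (show x + y + 3 ≤ B.s₂ by omega)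
      have q3 : (B.d₁ : ℝ) + 1 ≤ x - y := by exact_mod_cast (show B.d₁ + 1 ≤ x - y by omega)
      have q4 : (x : ℝ) - y + 3 ≤ B.d₂ := by exact_mod_cast (show x - y + 3 ≤ B.d₂ by omega)
      push_cast at hz₁ hz₂
      apply fin <;> first | omega | skip
      refine ⟨⟨?_, ?_⟩, ⟨?_, ?_⟩, ⟨?_, ?_⟩, ?_, ?_⟩ <;> linarith

theorem exists_unit_interval {k : ℕ} (hk : 2 ≤ k) {r : ℝ} (h0 : 0 ≤ r) (h1 : r ≤ (k : ℝ) - 1) :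
    ∃ i : ℤ, 0 ≤ i ∧ i + 2 ≤ k ∧ (i : ℝ) ≤ r ∧ r ≤ i + 1 := by
  have f1 := Int.floor_le r
  have f2 := (Int.lt_floor_add_one r).le
  have f3 : 0 ≤ ⌊r⌋ := Int.floor_nonneg.2 h0
  by_cases h : ⌊r⌋ + 2 ≤ k
  · exact ⟨⌊r⌋, f3, h, f1, f2⟩
  -- Here `r` is the right end `k - 1`, which belongs to the last unit interval.
  · have h' : (k : ℝ) ≤ ⌊r⌋ + 1 := by exact_mod_cast (show (k : ℤ) ≤ ⌊r⌋ + 1 by omega)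
    refine ⟨k - 2, by omega, by omega, ?_, ?_⟩ <;> push_cast <;> linarith

/-- The unit square around the point is divided by its diagonal between the corners of colour `c`;
each half is a right triangle whose right angle is at a point of the opposite colour. -/
theorem exists_fits_mem (hm : 2 ≤ m) (hn : 2 ≤ n) (hu : u ∈ kernel m n c) (h : u ≠ 0) {z : ℝ × ℝ}
    (hz : z ∈ rect m n) : ∃ t, Fits u t ∧ z ∈ t := by
  obtain ⟨⟨z1, z2⟩, z3, z4⟩ := id hz
  obtain ⟨i, i1, i2, i3, i4⟩ := exists_unit_interval hm z1 z2
  obtain ⟨j, j1, j2, j3, j4⟩ := exists_unit_interval hn z3 z4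
  have hpar := c.parity_cases
  rcases Int.emod_two_eq_zero_or_one (i + j - c.parity) with hc | hc
  · rcases le_total (z.2 - j) (z.1 - i) with hl | hl
    · apply exists_fits_of_quarter hm hu h (x := i + 1) (y := j) (e := -1) (f := 1)
        (α := i + 1 - z.1) (β := z.2 - j) (hz := hz) <;> try first | omega | (unfold InRect; omega)
      all_goals push_cast; linarith
    · apply exists_fits_of_quarter hm hu h (x := i) (y := j + 1) (e := 1) (f := -1)
        (α := z.1 - i) (β := j + 1 - z.2) (hz := hz) <;> try first | omega | (unfold InRect; omega)
      all_goals push_cast; linarith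
  · rcases le_total (z.1 - i + (z.2 - j)) 1 with hl | hl
    · apply exists_fits_of_quarter hm hu h (x := i) (y := j) (e := 1) (f := 1)
        (α := z.1 - i) (β := z.2 - j) (hz := hz) <;> try first | omega | (unfold InRect; omega)
      all_goals push_cast; linarith
    · apply exists_fits_of_quarter hm hu h (x := i + 1) (y := j + 1) (e := -1) (f := -1)
        (α := i + 1 - z.1) (β := j + 1 - z.2) (hz := hz) <;> try first | omega | (unfold InRect; omega)
      all_goals push_cast; linarith

theorem Phi_eq_setOf_fits (hm : 2 ≤ m) (hn : 2 ≤ n) (hu : u ∈ kernel m n c) (h : u ≠ 0) :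
    Phi u = {t | Fits u t} := by
  apply Phi_eq_of_fits
  · exact fun t ht => ht
  · intro z hz
    obtain ⟨t, ht, hzt⟩ := exists_fits_mem hm hn hu h hz
    exact ⟨t, ht, hzt⟩

theorem Phi_mem_tilings (hm : 2 ≤ m) (hn : 2 ≤ n) (hu : u ∈ kernel m n c) (h : u ≠ 0) :
    Phi u ∈ tilings m n c := by
  rw [Phi_eq_setOf_fits hm hn hu h]
  refine ⟨⟨fun t ht => ht.isColouredTile.isTile, ?_, ?_⟩, fun t ht => ht.isColouredTile⟩
  · intro t ht t' ht' hne
    exact Set.disjoint_left.2 fun x hx hx' => hne (ht.eq_of_mem_interior ht' hx hx')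
  · apply Set.Subset.antisymm
    · exact Set.sUnion_subset fun t ht => ht.subset
    · intro z hz
      obtain ⟨t, ht, hzt⟩ := exists_fits_mem hm hn hu h hz
      exact ⟨t, ht, hzt⟩

end mapsTo

/-! ### Injectivity: recovering the vector from the tiling -/

section injective
variable {m n : ℕ} {c : Colour} {u u' : Pt m n c → ZMod 2}

theorem isClosed_activeSegments : IsClosed (activeSegments u) := by
  unfold activeSegments
  refine isClosed_iUnion_of_finite fun b₁ => isClosed_iUnion_of_finite fun b₂ =>
    isClosed_iUnion_of_finite fun _ => ?_
  rw [← closure_openSegment]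
  exact isClosed_closure

/-- Inside `R` the active segments can be read off from the tiling. Segments contained in the
boundary of `R` leave no trace, which is the difficulty in what follows. -/
theorem mem_activeSegments_iff_of_mem_interior (hm : 2 ≤ m) (hn : 2 ≤ n) (hu : u ∈ kernel m n c)
    (h : u ≠ 0) {z : ℝ × ℝ} (hz : z ∈ interior (rect m n)) :
    z ∈ activeSegments u ↔ ∀ t ∈ Phi u, z ∉ interior t := by
  rw [Phi_eq_setOf_fits hm hn hu h]
  constructor
  · exact fun hs t ht hzt => ht.notMem z hzt hs
  · intro H
    obtain ⟨t, ht, hzt⟩ := exists_fits_mem hm hn hu h (interior_subset hz)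
    exact ht.mem z hzt (H t ht) hz

/-- The only points of colour `c` on an active segment are its two ends, since the midpoint of a
straight segment has the opposite colour. -/
theorem ext_eq_one_of_intCast_mem {x y : ℤ} (hc : (x + y - c.parity) % 2 = 0)
    (h : ((x : ℝ), (y : ℝ)) ∈ activeSegments u) : ext u x y = 1 := by
  have between : ∀ {a b r : ℤ} {α β : ℝ}, 0 ≤ α → 0 ≤ β → α + β = 1 → (r : ℝ) = α * a + β * b →
      (r ≤ a ∨ r ≤ b) ∧ (a ≤ r ∨ b ≤ r) := by
    intro a b r α β h1 h2 h3 e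
    have f1 := lt_or_lt_of_lt_combo (K := r - 1) h1 h2 h3 (by push_cast; linarith) e
    have f2 := lt_or_lt_of_combo_lt (K := r + 1) h1 h2 h3 (by push_cast; linarith) e
    omega
  rcases mem_activeSegments u h with ⟨a, b, a', b', h1, h2, ha, hb, hz⟩ |
    ⟨a, b, d, e, hd, hw, h1, h2, -, -, hz⟩
  · obtain ⟨α, β, k1, k2, k3, e1, e2⟩ := exists_of_mem_segment hz
    have f1 := between k1 k2 k3 e1
    have f2 := between k1 k2 k3 e2
    have c1 := (exists_of_ext_ne u (h1.trans_ne one_ne_zero)).2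
    have : (x = a ∧ y = b) ∨ (x = a' ∧ y = b') := by omega
    rcases this with ⟨rfl, rfl⟩ | ⟨rfl, rfl⟩ <;> assumption
  · obtain ⟨α, β, k1, k2, k3, e1, e2⟩ := exists_of_mem_segment hz
    have f1 := between k1 k2 k3 e1
    have f2 := between k1 k2 k3 e2
    have c1 := (exists_of_ext_ne u (h1.trans_ne one_ne_zero)).2
    have : (x = a + d ∧ y = b + e) ∨ (x = a - d ∧ y = b - e) := by omega
    rcases this with ⟨rfl, rfl⟩ | ⟨rfl, rfl⟩ <;> assumption

theorem combo_pos {α β a b : ℝ} (hα : 0 < α) (hβ : 0 < β) (ha : 0 ≤ a) (hb : 0 ≤ b)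
    (h : 0 < a ∨ 0 < b) : 0 < α * a + β * b := by
  rcases h with h | h
  · exact add_pos_of_pos_of_nonneg (mul_pos hα h) (mul_nonneg hβ.le hb)
  · exact add_pos_of_nonneg_of_pos (mul_nonneg hα.le ha) (mul_pos hβ h)

/-- An endpoint of an active segment that runs through the interior of the rectangle is determined
by the active segments in the interior of the rectangle. -/
theorem ext_eq_one_of_segment_subset
    (H : ∀ z ∈ interior (rect m n), z ∈ activeSegments u → z ∈ activeSegments u') {x y x' y' : ℤ}
    (hc : (x + y - c.parity) % 2 = 0) (h : InRect m n x y) (h' : InRect m n x' y')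
    (h1 : 0 < x ∨ 0 < x') (h2 : x + 1 < m ∨ x' + 1 < m) (h3 : 0 < y ∨ 0 < y')
    (h4 : y + 1 < n ∨ y' + 1 < n)
    (hs : segment ℝ ((x : ℝ), (y : ℝ)) ((x' : ℝ), (y' : ℝ)) ⊆ activeSegments u) :
    ext u' x y = 1 := by
  apply ext_eq_one_of_intCast_mem hc
  -- The open segment is inside `R` because at least one end is off each of the four sides; the
  -- endpoint, possibly on the boundary, is then reached since the union of the active segments is
  -- closed.
  have hsub : openSegment ℝ ((x : ℝ), (y : ℝ)) ((x' : ℝ), (y' : ℝ)) ⊆ activeSegments u' := by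
    intro z hz
    refine H z ?_ (hs (openSegment_subset_segment ℝ _ _ hz))
    obtain ⟨α, β, k1, k2, k3, rfl⟩ := hz
    obtain ⟨r1, r2, r3, r4⟩ := h
    obtain ⟨r1', r2', r3', r4'⟩ := h'
    rw [mem_interior_rect]
    simp only [Prod.smul_mk, Prod.mk_add_mk, smul_eq_mul]
    refine ⟨⟨combo_pos k1 k2 (by exact_mod_cast r1) (by exact_mod_cast r1') (by exact_mod_cast h1),
      ?_⟩, combo_pos k1 k2 (by exact_mod_cast r3) (by exact_mod_cast r3') (by exact_mod_cast h3),
      ?_⟩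
    · have := combo_pos (a := (m - 1 - x : ℤ)) (b := (m - 1 - x' : ℤ)) k1 k2
        (Int.cast_nonneg_iff.2 (by omega)) (Int.cast_nonneg_iff.2 (by omega))
        (by simp only [Int.cast_pos]; omega)
      push_cast at this
      linear_combination this + ((m : ℝ) - 1) * k3
    · have := combo_pos (a := (n - 1 - y : ℤ)) (b := (n - 1 - y' : ℤ)) k1 k2
        (Int.cast_nonneg_iff.2 (by omega)) (Int.cast_nonneg_iff.2 (by omega))
        (by simp only [Int.cast_pos]; omega)
      push_cast at this
      linear_combination this + ((n : ℝ) - 1) * k3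
  have := closure_mono hsub
  rw [closure_openSegment, isClosed_activeSegments.closure_eq] at this
  exact this (left_mem_segment ℝ _ _)

theorem kernel_eq (hu : u ∈ kernel m n c) {x y e f : ℤ} (h : InRect m n x y)
    (hc : (x + y - c.parity) % 2 = 1) (he : e = 1 ∨ e = -1) (hf : f = 1 ∨ f = -1) :
    ext u (x + e) y + ext u (x - e) y + ext u x (y + f) + ext u x (y - f) = 0 := by
  have hk := (mem_kernel_iff u).1 hu x y h hc
  rcases he with rfl | rfl <;> rcases hf with rfl | rfl <;>
    (try simp only [← sub_eq_add_neg, sub_neg_eq_add]) <;> linear_combination hk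

/-- A point that is active for `u` only is a corner of the rectangle. -/
theorem corner_of_ext_ne (hm : 2 ≤ m) (hn : 2 ≤ n) (hu : u ∈ kernel m n c)
    (H : ∀ z ∈ interior (rect m n), z ∈ activeSegments u → z ∈ activeSegments u') {x y : ℤ}
    (h1 : ext u x y = 1) (h0 : ext u' x y = 0) :
    (∀ e f : ℤ, (e = 1 ∨ e = -1) → (f = 1 ∨ f = -1) → ext u (x + e) (y + f) = 0) ∧
    (∃ e, (e = 1 ∧ x = 0 ∨ e = -1 ∧ x + 1 = m) ∧ ext u (x + 2 * e) y = 1) ∧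
    (∃ f, (f = 1 ∧ y = 0 ∨ f = -1 ∧ y + 1 = n) ∧ ext u x (y + 2 * f) = 1) := by
  have h0' : ext u' x y ≠ 1 := fun h => zero_ne_one (h0.symm.trans h)
  obtain ⟨⟨r1, r2, r3, r4⟩, hc⟩ := exists_of_ext_ne u (h1.trans_ne one_ne_zero)
  have hpar := c.parity_cases
  -- A diagonal segment within the rectangle always runs through its interior, so an active diagonal
  -- neighbour would make the point active for `u'` too.
  have hdiag : ∀ e f : ℤ, (e = 1 ∨ e = -1) → (f = 1 ∨ f = -1) → ext u (x + e) (y + f) = 0 := by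
    intro e f he hf
    rcases zmod2_cases (ext u (x + e) (y + f)) with h | h
    · exact h
    · exfalso
      obtain ⟨⟨q1, q2, q3, q4⟩, -⟩ := exists_of_ext_ne u (h.trans_ne one_ne_zero)
      exact h0' (ext_eq_one_of_segment_subset H hc ⟨r1, r2, r3, r4⟩ ⟨q1, q2, q3, q4⟩ (by omega)
        (by omega) (by omega) (by omega) (segment_diag_subset u h1 h (by omega) (by omega)))
  -- With the diagonal neighbours inactive, the kernel equation one step away makes the point two
  -- steps away active, and the two are joined. This segment must be invisible, hence lie on a
  -- horizontal side of `R`.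
  have hx : ∀ e : ℤ, (e = 1 ∨ e = -1) → InRect m n (x + e) y →
      ext u (x + 2 * e) y = 1 ∧ (y = 0 ∨ y + 1 = n) := by
    intro e he hr
    have hk := kernel_eq hu (f := 1) hr (by omega) he (Or.inl rfl)
    rw [show x + e + e = x + 2 * e by ring, show x + e - e = x by ring, sub_eq_add_neg,
      hdiag e 1 he (Or.inl rfl), hdiag e (-1) he (Or.inr rfl), h1, add_zero, add_zero] at hk
    have h2 := eq_of_add_eq_zero hk
    refine ⟨h2, ?_⟩
    obtain ⟨⟨q1, q2, q3, q4⟩, -⟩ := exists_of_ext_ne u (h2.trans_ne one_ne_zero)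
    by_contra hy
    refine h0' (ext_eq_one_of_segment_subset H hc ⟨r1, r2, r3, r4⟩ ⟨q1, q2, q3, q4⟩ (by omega)
        (by omega) (by omega) (by omega) ?_)
    have := segment_straight_subset u (x := x + e) (y := y) (dx := -e) (dy := 0) (by omega) hr
      (by rwa [add_neg_cancel_right, add_zero])
      (by rwa [sub_neg_eq_add, sub_zero, show x + e + e = x + 2 * e by ring])
      (by rw [add_zero]; exact hdiag e (-e) he (by omega))
      (by rw [sub_zero, sub_neg_eq_add]; exact hdiag e e he he)
    rwa [add_neg_cancel_right, add_zero, sub_neg_eq_add, sub_zero,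
      show x + e + e = x + 2 * e by ring] at this
  have hy : ∀ f : ℤ, (f = 1 ∨ f = -1) → InRect m n x (y + f) →
      ext u x (y + 2 * f) = 1 ∧ (x = 0 ∨ x + 1 = m) := by
    intro f hf hr
    have hk := kernel_eq hu (e := 1) hr (by omega) (Or.inl rfl) hf
    rw [show y + f + f = y + 2 * f by ring, show y + f - f = y by ring, sub_eq_add_neg,
      hdiag 1 f (Or.inl rfl) hf, hdiag (-1) f (Or.inr rfl) hf, h1, add_zero, zero_add] at hk
    have h2 := eq_of_add_eq_zero hk
    refine ⟨h2, ?_⟩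
    obtain ⟨⟨q1, q2, q3, q4⟩, -⟩ := exists_of_ext_ne u (h2.trans_ne one_ne_zero)
    by_contra hx
    refine h0' (ext_eq_one_of_segment_subset H hc ⟨r1, r2, r3, r4⟩ ⟨q1, q2, q3, q4⟩ (by omega)
        (by omega) (by omega) (by omega) ?_)
    have := segment_straight_subset u (x := x) (y := y + f) (dx := 0) (dy := -f) (by omega) hr
      (by rwa [add_neg_cancel_right, add_zero])
      (by rwa [sub_neg_eq_add, sub_zero, show y + f + f = y + 2 * f by ring])
      (by rw [add_zero]; exact hdiag (-f) f (by omega) hf)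
      (by rw [sub_zero, sub_neg_eq_add]; exact hdiag f f hf hf)
    rwa [add_neg_cancel_right, add_zero, sub_neg_eq_add, sub_zero,
      show y + f + f = y + 2 * f by ring] at this
  obtain ⟨e, he, he'⟩ : ∃ e : ℤ, (e = 1 ∨ e = -1) ∧ 0 ≤ x + e ∧ x + e + 1 ≤ m := by
    by_cases h : x = 0
    · exact ⟨1, by omega⟩
    · exact ⟨-1, by omega⟩
  obtain ⟨f, hf, hf'⟩ : ∃ f : ℤ, (f = 1 ∨ f = -1) ∧ 0 ≤ y + f ∧ y + f + 1 ≤ n := by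
    by_cases h : y = 0
    · exact ⟨1, by omega⟩
    · exact ⟨-1, by omega⟩
  obtain ⟨k1, k2⟩ := hx e he ⟨he'.1, he'.2, r3, r4⟩
  obtain ⟨k3, k4⟩ := hy f hf ⟨r1, r2, hf'.1, hf'.2⟩
  exact ⟨hdiag, ⟨e, by omega, k1⟩, f, by omega, k3⟩

/-- A discrepancy sits at a corner of the rectangle and, by the kernel equations of `u'`, propagates
to the points two steps away along both sides. These are corners again, so the graph is `3 × 3`, and
`u'` vanishes at its corners and its centre. The exclusion of the zero vector is what rules this
case out. -/
theorem eq_zero_of_ext_ne (hm : 2 ≤ m) (hn : 2 ≤ n) (hu : u ∈ kernel m n c)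
    (hu' : u' ∈ kernel m n c)
    (H : ∀ z ∈ interior (rect m n), z ∈ activeSegments u ↔ z ∈ activeSegments u') {x y : ℤ}
    (h1 : ext u x y = 1) (h0 : ext u' x y = 0) : u' = 0 := by
  obtain ⟨⟨r1, r2, r3, r4⟩, hc⟩ := exists_of_ext_ne u (h1.trans_ne one_ne_zero)
  have hpar := c.parity_cases
  obtain ⟨hd, ⟨e, he, k1⟩, f, hf, k2⟩ :=
    corner_of_ext_ne hm hn hu (fun z hz => (H z hz).1) h1 h0
  obtain ⟨⟨q1, q2, -, -⟩, -⟩ := exists_of_ext_ne u (k1.trans_ne one_ne_zero)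
  obtain ⟨⟨-, -, q3, q4⟩, -⟩ := exists_of_ext_ne u (k2.trans_ne one_ne_zero)
  -- This point is in the interior of `R`, where `u` and `u'` have the same active points, and it is
  -- inactive for `u`.
  have hmid : ext u' (x + e) (y + f) = 0 := by
    rcases zmod2_cases (ext u' (x + e) (y + f)) with h | h
    · exact h
    · have hi : (((x + e : ℤ) : ℝ), ((y + f : ℤ) : ℝ)) ∈ interior (rect m n) := by
        rw [intCast_mem_interior_rect]; omega
      have := ext_eq_one_of_intCast_mem (by omega)
        ((H _ hi).2 (intCast_mem_activeSegments hm hu' h))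
      rw [hd e f (by omega) (by omega)] at this
      exact absurd this zero_ne_one
  have g1 : ext u' (x + 2 * e) y = 0 := by
    have hk := kernel_eq hu' (x := x + e) (y := y) (e := e) (f := f)
      ⟨by omega, by omega, by omega, by omega⟩ (by omega) (by omega) (by omega)
    rw [show x + e + e = x + 2 * e by ring, show x + e - e = x by ring, hmid, h0,
      ext_eq_zero_of_not u' (x := x + e) (y := y - f) (by unfold InRect; omega)] at hk
    simpa using hk
  have g2 : ext u' x (y + 2 * f) = 0 := by
    have hk := kernel_eq hu' (x := x) (y := y + f) (e := e) (f := f)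
      ⟨by omega, by omega, by omega, by omega⟩ (by omega) (by omega) (by omega)
    rw [show y + f + f = y + 2 * f by ring, show y + f - f = y by ring, hmid, h0,
      ext_eq_zero_of_not u' (x := x - e) (y := y + f) (by unfold InRect; omega)] at hk
    simpa using hk
  obtain ⟨-, ⟨e', he', -⟩, -⟩ := corner_of_ext_ne hm hn hu (fun z hz => (H z hz).1) k1 g1
  obtain ⟨-, -, f', hf', -⟩ := corner_of_ext_ne hm hn hu (fun z hz => (H z hz).1) k2 g2
  have g3 : ext u' (x + 2 * e) (y + 2 * f) = 0 := by
    have hk := kernel_eq hu' (x := x + 2 * e) (y := y + f) (e := e) (f := f)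
      ⟨by omega, by omega, by omega, by omega⟩ (by omega) (by omega) (by omega)
    rw [show y + f + f = y + 2 * f by ring, show y + f - f = y by ring,
      show x + 2 * e - e = x + e by ring, hmid, g1,
      ext_eq_zero_of_not u' (x := x + 2 * e + e) (y := y + f) (by unfold InRect; omega)] at hk
    simpa using hk
  funext b
  obtain ⟨b1, b2, b3, b4⟩ := b.coord_inRect
  have b5 := b.coord_colour
  rw [← ext_coord u' b]
  have : (b.coord.1 = x ∨ b.coord.1 = x + 2 * e) ∧ (b.coord.2 = y ∨ b.coord.2 = y + 2 * f) ∨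
      b.coord.1 = x + e ∧ b.coord.2 = y + f := by omega
  rcases this with ⟨e1 | e1, e2 | e2⟩ | ⟨e1, e2⟩ <;> rw [e1, e2] <;> assumption

theorem Phi_injOn (hm : 2 ≤ m) (hn : 2 ≤ n) :
    Set.InjOn Phi {u | u ∈ kernel m n c ∧ u ≠ 0} := by
  rintro u ⟨hu, h⟩ u' ⟨hu', h'⟩ hP
  have H : ∀ z ∈ interior (rect m n), z ∈ activeSegments u ↔ z ∈ activeSegments u' := by
    intro z hz
    rw [mem_activeSegments_iff_of_mem_interior hm hn hu h hz, hP,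
      mem_activeSegments_iff_of_mem_interior hm hn hu' h' hz]
  apply eq_of_ext_eq
  intro x y
  rcases zmod2_cases (ext u x y) with h1 | h1 <;> rcases zmod2_cases (ext u' x y) with h2 | h2
  · rw [h1, h2]
  · exact absurd (eq_zero_of_ext_ne hm hn hu' hu (fun z hz => (H z hz).symm) h2 h1) h
  · exact absurd (eq_zero_of_ext_ne hm hn hu hu' H h1 h2) h'
  · rw [h1, h2]

end injective

/-! ### Test points with coordinates in one third of the integers -/

section thirds
variable {m n : ℕ}

/-- The point with coordinates `X / 3` and `Y / 3`. -/
noncomputable def third (X Y : ℤ) : ℝ × ℝ := ((X : ℝ) / 3, (Y : ℝ) / 3)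

theorem third_three_mul (x y : ℤ) : third (3 * x) (3 * y) = ((x : ℝ), (y : ℝ)) := by
  unfold third
  push_cast
  rw [mul_div_cancel_left₀ _ three_ne_zero, mul_div_cancel_left₀ _ three_ne_zero]

theorem int_le_iff_mul_third {a b : ℤ} {r s : ℝ} (hr : 3 * r = a) (hs : 3 * s = b) :
    r ≤ s ↔ a ≤ b := by
  rw [← @Int.cast_le ℝ, ← hr, ← hs]
  constructor <;> intro h <;> linarith

theorem int_lt_iff_mul_third {a b : ℤ} {r s : ℝ} (hr : 3 * r = a) (hs : 3 * s = b) :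
    r < s ↔ a < b := by
  rw [← @Int.cast_lt ℝ, ← hr, ← hs]
  constructor <;> intro h <;> linarith

theorem third_mem_rect {X Y : ℤ} :
    third X Y ∈ rect m n ↔ 0 ≤ X ∧ X + 3 ≤ 3 * m ∧ 0 ≤ Y ∧ Y + 3 ≤ 3 * n := by
  rw [mem_rect, third]
  rw [int_le_iff_mul_third (a := 0) (b := X) (by simp) (by simp; ring),
    int_le_iff_mul_third (a := X) (b := 3 * m - 3) (by simp; ring) (by push_cast; ring),
    int_le_iff_mul_third (a := 0) (b := Y) (by simp) (by simp; ring),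
    int_le_iff_mul_third (a := Y) (b := 3 * n - 3) (by simp; ring) (by push_cast; ring)]
  omega

theorem third_mem_oct {B : Block} {X Y : ℤ} : third X Y ∈ B.oct ↔
    (3 * (B.s₁ + B.d₁ + 2) ≤ 2 * X ∧ 2 * X ≤ 3 * (B.s₂ + B.d₂ - 2)) ∧
    (3 * (B.s₁ - B.d₂ + 2) ≤ 2 * Y ∧ 2 * Y ≤ 3 * (B.s₂ - B.d₁ - 2)) ∧
    (3 * B.s₁ ≤ X + Y ∧ X + Y ≤ 3 * B.s₂) ∧ 3 * B.d₁ ≤ X - Y ∧ X - Y ≤ 3 * B.d₂ := by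
  rw [third, Block.oct, Set.mem_ofPred_eq]
  refine and_congr (and_congr ?_ ?_) (and_congr (and_congr ?_ ?_) (and_congr (and_congr ?_ ?_)
    (and_congr ?_ ?_))) <;> exact int_le_iff_mul_third (by push_cast; ring) (by push_cast; ring)

theorem third_mem_octInt {B : Block} {X Y : ℤ} : third X Y ∈ B.octInt ↔
    (3 * (B.s₁ + B.d₁ + 2) < 2 * X ∧ 2 * X < 3 * (B.s₂ + B.d₂ - 2)) ∧
    (3 * (B.s₁ - B.d₂ + 2) < 2 * Y ∧ 2 * Y < 3 * (B.s₂ - B.d₁ - 2)) ∧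
    (3 * B.s₁ < X + Y ∧ X + Y < 3 * B.s₂) ∧ 3 * B.d₁ < X - Y ∧ X - Y < 3 * B.d₂ := by
  rw [third, Block.octInt, Set.mem_ofPred_eq]
  refine and_congr (and_congr ?_ ?_) (and_congr (and_congr ?_ ?_) (and_congr (and_congr ?_ ?_)
    (and_congr ?_ ?_))) <;> exact int_lt_iff_mul_third (by push_cast; ring) (by push_cast; ring)

theorem third_mem_diamond {x y X Y : ℤ} : third X Y ∈ diamond x y ↔
    (3 * (x + y - 1) ≤ X + Y ∧ X + Y ≤ 3 * (x + y + 1)) ∧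
    3 * (x - y - 1) ≤ X - Y ∧ X - Y ≤ 3 * (x - y + 1) := by
  rw [third, diamond, Set.mem_ofPred_eq]
  refine and_congr (and_congr ?_ ?_) (and_congr ?_ ?_) <;>
    exact int_le_iff_mul_third (by push_cast; ring) (by push_cast; ring)

end thirds

/-! ### Surjectivity: the vector of a tiling -/

section surjective
variable {m n : ℕ} {c : Colour} {T : Set (Set (ℝ × ℝ))} {S : Set Block}

/-- `S` is a choice of one block for every tile of `T` that is not a tilted square. -/
structure IsBlockSystem (m n : ℕ) (c : Colour) (T : Set (Set (ℝ × ℝ))) (S : Set Block) : Prop where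
  tiling : T ∈ tilings m n c
  isBlock : ∀ B ∈ S, IsBlock m n c B
  mem : ∀ B ∈ S, B.oct ∩ rect m n ∈ T
  inj : ∀ B ∈ S, ∀ B' ∈ S, B.oct ∩ rect m n = B'.oct ∩ rect m n → B = B'
  cases : ∀ t ∈ T, (∃ x y : ℤ, (x + y - c.parity) % 2 = 1 ∧
    (1 ≤ x ∧ x + 2 ≤ m ∧ 1 ≤ y ∧ y + 2 ≤ n) ∧ t = diamond x y ∧ ∀ B ∈ S, B.oct ∩ rect m n ≠ t) ∨
    ∃ B ∈ S, t = B.oct ∩ rect m n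

/-- A tile that is a tilted square is classified as such; for every other tile one block is chosen.
Choosing a single block per tile makes the map from blocks to tiles injective by construction. -/
theorem exists_isBlockSystem (hT : T ∈ tilings m n c) : ∃ S, IsBlockSystem m n c T S := by
  have hsub : ∀ t ∈ T, t ⊆ rect m n := fun t ht => hT.1.cover ▸ Set.subset_sUnion_of_mem ht
  set D := {t | ∃ x y : ℤ, (x + y - c.parity) % 2 = 1 ∧
    (1 ≤ x ∧ x + 2 ≤ m ∧ 1 ≤ y ∧ y + 2 ≤ n) ∧ t = diamond x y} with hD
  have key : ∀ t, ∃ B, t ∈ T → t ∉ D → IsBlock m n c B ∧ t = B.oct ∩ rect m n := by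
    intro t
    by_cases ht : t ∈ T ∧ t ∉ D
    · rcases (hT.2 t ht.1).eq_diamond_or_block (hsub t ht.1) with h | ⟨B, hB⟩
      · exact absurd h ht.2
      · exact ⟨B, fun _ _ => hB⟩
    · exact ⟨⟨0, 0, 0, 0⟩, fun h1 h2 => absurd ⟨h1, h2⟩ ht⟩
  choose f hf using key
  refine ⟨f '' {t | t ∈ T ∧ t ∉ D}, hT, ?_, ?_, ?_, ?_⟩
  · rintro _ ⟨t, ⟨h1, h2⟩, rfl⟩
    exact (hf t h1 h2).1
  · rintro _ ⟨t, ⟨h1, h2⟩, rfl⟩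
    rwa [← (hf t h1 h2).2]
  · rintro _ ⟨t, ⟨h1, h2⟩, rfl⟩ _ ⟨t', ⟨h1', h2'⟩, rfl⟩ h
    rw [← (hf t h1 h2).2, ← (hf t' h1' h2').2] at h
    rw [h]
  · intro t ht
    by_cases h : t ∈ D
    · obtain ⟨x, y, h1, h2, h3⟩ := h
      refine Or.inl ⟨x, y, h1, h2, h3, ?_⟩
      rintro _ ⟨t', ⟨h1', h2'⟩, rfl⟩ e
      rw [← (hf t' h1' h2').2] at e
      exact h2' (e ▸ ⟨x, y, h1, h2, h3⟩)
    · exact Or.inr ⟨f t, ⟨t, ⟨ht, h⟩, rfl⟩, (hf t ht h).2⟩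

/-- A tile with a point in the interior of the octagon of a block is the tile of the block. -/
theorem IsBlockSystem.eq_of_mem_octInt (hS : IsBlockSystem m n c T S) {B : Block} (hB : B ∈ S)
    {t : Set (ℝ × ℝ)} (ht : t ∈ T) {z : ℝ × ℝ} (hz : z ∈ t) (hzB : z ∈ B.octInt) :
    t = B.oct ∩ rect m n := by
  have htile := hS.tiling.1.isTile t ht
  have hsub : t ⊆ rect m n := hS.tiling.1.cover ▸ Set.subset_sUnion_of_mem ht
  rw [← B.interior_oct] at hzB
  rw [← htile.closure_interior] at hz
  obtain ⟨z', h1, h2⟩ := mem_closure_iff.1 hz _ isOpen_interior hzB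
  by_contra hne
  refine Set.disjoint_left.1 (hS.tiling.1.disjoint ht (hS.mem B hB) hne) h2 ?_
  rw [interior_inter]
  exact ⟨h1, interior_mono hsub h2⟩

open Classical in
/-- The vector that vanishes exactly on the blocks. -/
noncomputable def blockVector (m n : ℕ) (c : Colour) (S : Set Block) : Pt m n c → ZMod 2 :=
  fun b => if ∃ B ∈ S, B.Mem b.coord.1 b.coord.2 then 0 else 1

theorem ext_blockVector_eq_zero {B : Block} (hB : B ∈ S) {x y : ℤ} (h : B.Mem x y) :
    ext (blockVector m n c S) x y = 0 := by
  by_contra h0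
  obtain ⟨hr, hc⟩ := exists_of_ext_ne _ h0
  obtain ⟨b, hb⟩ := Pt.exists_coord hr hc
  rw [ext_of_coord _ hb, blockVector, if_pos] at h0
  · exact h0 rfl
  · exact ⟨B, hB, by rwa [hb]⟩

theorem ext_blockVector_eq_one {x y : ℤ} (hr : InRect m n x y) (hc : (x + y - c.parity) % 2 = 0)
    (h : ∀ B ∈ S, ¬ B.Mem x y) : ext (blockVector m n c S) x y = 1 := by
  obtain ⟨b, hb⟩ := Pt.exists_coord hr hc
  rw [ext_of_coord _ hb, blockVector, if_neg]
  rintro ⟨B, hB, hm⟩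
  rw [hb] at hm
  exact h B hB hm

/-- The bounds have the parity of the point, so the strict inequalities that define the block leave
a gap of two, enough to be strictly inside the truncated corners too. -/
theorem IsBlock.intCast_mem_octInt {B : Block} (hB : IsBlock m n c B) {x y : ℤ}
    (hc : (x + y - c.parity) % 2 = 0) (h : B.Mem x y) : ((x : ℝ), (y : ℝ)) ∈ B.octInt := by
  rw [← third_three_mul, third_mem_octInt]
  obtain ⟨p1, p2, p3, p4, -, -, -, -, -, -, -, -, -, -⟩ := hB
  obtain ⟨⟨h1, h2⟩, h3, h4⟩ := h
  omega

/-- If the point belonged to some block of the system, it would be in the open octagon of that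
block. Both tiles would then coincide, and so would the blocks. -/
theorem IsBlockSystem.ext_eq_one_of_mem_oct (hS : IsBlockSystem m n c T S) {B : Block}
    (hB : B ∈ S) {x y : ℤ} (hr : InRect m n x y) (hc : (x + y - c.parity) % 2 = 0)
    (ho : ((x : ℝ), (y : ℝ)) ∈ B.oct) (h : ¬ B.Mem x y) :
    ext (blockVector m n c S) x y = 1 := by
  apply ext_blockVector_eq_one hr hc
  intro B' hB' hm
  have := hS.eq_of_mem_octInt hB' (hS.mem B hB) ⟨ho, intCast_mem_rect.2 hr⟩
    ((hS.isBlock B' hB').intCast_mem_octInt hc hm)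
  exact h (hS.inj B hB B' hB' this ▸ hm)

theorem IsBlockSystem.ext_eq_one_of_mem_diamond (hS : IsBlockSystem m n c T S) {a b : ℤ}
    (hT : diamond a b ∈ T) (hd : ∀ B ∈ S, B.oct ∩ rect m n ≠ diamond a b) {x y : ℤ}
    (hc : (x + y - c.parity) % 2 = 0)
    (ho : ((x : ℝ), (y : ℝ)) ∈ diamond a b) : ext (blockVector m n c S) x y = 1 := by
  have hsub : diamond a b ⊆ rect m n := hS.tiling.1.cover ▸ Set.subset_sUnion_of_mem hT
  apply ext_blockVector_eq_one (intCast_mem_rect.1 (hsub ho)) hc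
  intro B hB hm
  exact hd B hB (hS.eq_of_mem_octInt hB hT ho ((hS.isBlock B hB).intCast_mem_octInt hc hm)).symm

set_option maxHeartbeats 1000000 in
/-- The point of the grid just outside the midpoint of a horizontal or vertical side of the
octagon of a block is inactive. -/
theorem IsBlockSystem.ext_eq_zero_of_notMem_oct (hm : 2 ≤ m) (hn : 2 ≤ n)
    (hS : IsBlockSystem m n c T S) {B : Block}
    (hB : B ∈ S) {x y e f : ℤ} (hd : e = 0 ∧ (f = 1 ∨ f = -1) ∨ f = 0 ∧ (e = 1 ∨ e = -1))
    (hc : (x + y - c.parity) % 2 = 1) (hr : InRect m n x y)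
    (ho : ((x : ℝ), (y : ℝ)) ∈ B.oct) (ho' : (((x + e : ℤ) : ℝ), ((y + f : ℤ) : ℝ)) ∉ B.oct) :
    ext (blockVector m n c S) (x + e) (y + f) = 0 := by
  by_cases hr' : InRect m n (x + e) (y + f)
  swap
  · exact ext_eq_zero_of_not _ hr'
  obtain ⟨r1, r2, r3, r4⟩ := hr
  obtain ⟨r1', r2', r3', r4'⟩ := hr'
  -- The vector `(g, h)` is a unit vector perpendicular to `(e, f)`, with the sign chosen so as to
  -- stay in the rectangle.
  obtain ⟨g, h, hg, q1, q2, q3, q4⟩ : ∃ g h : ℤ, (g = f ∧ h = e ∨ g = -f ∧ h = -e) ∧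
      InRect m n (x + g) (y + h) := by
    unfold InRect
    by_cases hq : 0 ≤ x + f ∧ x + f + 1 ≤ m ∧ 0 ≤ y + e ∧ y + e + 1 ≤ n
    · exact ⟨f, e, Or.inl ⟨rfl, rfl⟩, hq⟩
    · exact ⟨-f, -e, Or.inr ⟨rfl, rfl⟩, by omega⟩
  -- This test point is just outside the side with midpoint `(x, y)`, displaced along the side; its
  -- mirror image in the side, used below, is inside the octagon. Thirds make the needed strict
  -- inequalities hold for both points and keep them within integer arithmetic.
  have hz : third (3 * x + e + g) (3 * y + f + h) ∈ rect m n := by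
    rw [third_mem_rect]
    omega
  obtain ⟨p1, p2, p3, p4, hs, hdd, -, -, -, -, nd₁, nd₂, nd₃, nd₄⟩ := hS.isBlock B hB
  rw [Block.intCast_mem_oct] at ho ho'
  have hzB : third (3 * x + e + g) (3 * y + f + h) ∉ B.oct := by
    rw [third_mem_oct]
    omega
  have hzB' : third (3 * x - e + g) (3 * y - f + h) ∈ B.octInt := by
    rw [third_mem_octInt]
    omega
  have hzR : third (3 * x - e + g) (3 * y - f + h) ∈ rect m n := by
    rw [third_mem_rect]
    omega
  obtain ⟨t, ht, hzt⟩ := hS.tiling.1.cover.symm ▸ hz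
  rcases hS.cases t ht with ⟨a, b, h1, h2, rfl, h4⟩ | ⟨B', hB', rfl⟩
  -- A tilted square containing the outer test point is centred at `(x, y)`, hence contains the
  -- mirror image as well and overlaps the tile of `B`.
  · exfalso
    rw [third_mem_diamond] at hzt
    obtain ⟨rfl, rfl⟩ : a = x ∧ b = y := by omega
    refine h4 B hB (hS.eq_of_mem_octInt hB ht ?_ hzB').symm
    rw [third_mem_diamond]
    omega
  · by_cases hmem : B'.Mem (x + e) (y + f)
    · exact ext_blockVector_eq_zero hB' hmem
    · exfalso
      obtain ⟨p1', p2', p3', p4', hs', hdd', -, -, -, -, -, -, -, -⟩ := hS.isBlock B' hB'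
      have hzt' := hzt.1
      rw [third_mem_oct] at hzt'
      unfold Block.Mem at hmem
      -- If the corner point is not in the block of `B'`, it lies on exactly one of its side lines.
      -- The minimal width 4 then puts the mirror image strictly inside the octagon of `B'`, so `B'`
      -- and `B` have the same tile, which does not contain the outer test point.
      have : third (3 * x - e + g) (3 * y - f + h) ∈ B'.octInt := by
        clear hzB hzB' hzR ho ho' hz ht hs hdd nd₁ nd₂ nd₃ nd₄ p1 p2 p3 p4 r1 r2 r3 r4 r1' r2' r3'
          r4' q1 q2 q3 q4
        obtain ⟨⟨k1, k2⟩, ⟨k3, k4⟩, ⟨k5, k6⟩, k7, k8⟩ := hzt'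
        rw [third_mem_octInt]
        rcases hd with ⟨rfl, rfl | rfl⟩ | ⟨rfl, rfl | rfl⟩ <;>
          rcases hg with ⟨rfl, rfl⟩ | ⟨rfl, rfl⟩ <;>
          refine ⟨⟨?_, ?_⟩, ⟨?_, ?_⟩, ⟨?_, ?_⟩, ?_, ?_⟩ <;> omega
      have := hS.eq_of_mem_octInt hB' (hS.mem B hB) ⟨?_, hzR⟩ this
      · rw [← this] at hzt
        exact hzB hzt.1
      · rw [← Block.interior_oct] at hzB'
        exact interior_subset hzB'

-- Separation of variables near a block. A neighbour on no side line is in the block, one on a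
-- single side line is active, or absent from the rectangle in a way the symmetry of the block rules
-- out, and one on two side lines is a cut-off corner, which is inactive in accordance with `1 + 1 =
-- 0`.
set_option maxHeartbeats 1000000 in
theorem IsBlockSystem.ext_neighbour (hm : 2 ≤ m) (hn : 2 ≤ n) (hS : IsBlockSystem m n c T S)
    {B : Block} (hB : B ∈ S) {x y e f : ℤ}
    (hd : e = 0 ∧ (f = 1 ∨ f = -1) ∨ f = 0 ∧ (e = 1 ∨ e = -1))
    (hc : (x + y - c.parity) % 2 = 1) (hr : InRect m n x y)
    (ho : ((x : ℝ), (y : ℝ)) ∈ B.oct) :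
    ext (blockVector m n c S) (x + e) (y + f) =
      (if x + y + (e + f) = B.s₁ ∨ x + y + (e + f) = B.s₂ then 1 else 0) +
      (if x - y + (e - f) = B.d₁ ∨ x - y + (e - f) = B.d₂ then 1 else 0) := by
  have hoz := hS.ext_eq_zero_of_notMem_oct hm hn hB hd hc hr ho
  have hmz := ext_blockVector_eq_zero (m := m) (n := n) (c := c) hB (x := x + e) (y := y + f)
  have hone := hS.ext_eq_one_of_mem_oct hB (x := x + e) (y := y + f)
  obtain ⟨p1, p2, p3, p4, hs, hdd, left, right, bottom, top, nd₁, nd₂, nd₃, nd₄⟩ := hS.isBlock B hB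
  rw [Block.intCast_mem_oct] at ho hoz hone
  obtain ⟨⟨k1, k2⟩, ⟨k3, k4⟩, ⟨k5, k6⟩, k7, k8⟩ := ho
  obtain ⟨r1, r2, r3, r4⟩ := hr
  unfold Block.Mem InRect at *
  split_ifs with h1 h2 h2
  · rw [hoz]
    · rfl
    · clear hoz hmz hone
      rcases hd with ⟨rfl, rfl | rfl⟩ | ⟨rfl, rfl | rfl⟩ <;> omega
  · rw [hone, add_zero]
    all_goals clear hoz hmz hone
    all_goals rcases hd with ⟨rfl, rfl | rfl⟩ | ⟨rfl, rfl | rfl⟩ <;> omega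
  · rw [hone, zero_add]
    all_goals clear hoz hmz hone
    all_goals rcases hd with ⟨rfl, rfl | rfl⟩ | ⟨rfl, rfl | rfl⟩ <;> omega
  · rw [hmz, add_zero]
    clear hoz hmz hone
    rcases hd with ⟨rfl, rfl | rfl⟩ | ⟨rfl, rfl | rfl⟩ <;> omega

theorem IsBlockSystem.blockVector_mem_kernel (hm : 2 ≤ m) (hn : 2 ≤ n)
    (hS : IsBlockSystem m n c T S) : blockVector m n c S ∈ kernel m n c := by
  rw [mem_kernel_iff]
  intro x y hr hc
  obtain ⟨t, ht, hzt⟩ := hS.tiling.1.cover.symm ▸ intCast_mem_rect.2 hr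
  rcases hS.cases t ht with ⟨a, b, h1, h2, rfl, h4⟩ | ⟨B, hB, rfl⟩
  · rw [← third_three_mul, third_mem_diamond] at hzt
    -- The centre is the only point of the opposite colour in a tilted square; its four neighbours
    -- are the vertices, all active.
    obtain ⟨rfl, rfl⟩ : a = x ∧ b = y := by omega
    have key : ∀ e f : ℤ, (e = 0 ∧ (f = 1 ∨ f = -1) ∨ f = 0 ∧ (e = 1 ∨ e = -1)) →
        ext (blockVector m n c S) (a + e) (b + f) = 1 := by
      intro e f hd
      apply hS.ext_eq_one_of_mem_diamond ht h4
      · omega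
      · rw [← third_three_mul, third_mem_diamond]
        omega
    have k1 := key 1 0 (by omega)
    have k2 := key (-1) 0 (by omega)
    have k3 := key 0 1 (by omega)
    have k4 := key 0 (-1) (by omega)
    simp only [add_zero, ← sub_eq_add_neg] at k1 k2 k3 k4
    rw [k1, k2, k3, k4]
    rfl
  · have k1 := hS.ext_neighbour hm hn hB (e := 1) (f := 0) (by omega) hc hr hzt.1
    have k2 := hS.ext_neighbour hm hn hB (e := -1) (f := 0) (by omega) hc hr hzt.1
    have k3 := hS.ext_neighbour hm hn hB (e := 0) (f := 1) (by omega) hc hr hzt.1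
    have k4 := hS.ext_neighbour hm hn hB (e := 0) (f := -1) (by omega) hc hr hzt.1
    simp only [add_zero, zero_add, sub_zero, zero_sub, neg_neg, ← sub_eq_add_neg] at k1 k2 k3 k4
    rw [k1, k2, k3, k4]
    -- Each of the four indicators occurs for exactly two of the four neighbours, so the sum
    -- vanishes modulo 2.
    generalize (if x + y + 1 = B.s₁ ∨ x + y + 1 = B.s₂ then (1 : ZMod 2) else 0) = q1
    generalize (if x + y - 1 = B.s₁ ∨ x + y - 1 = B.s₂ then (1 : ZMod 2) else 0) = q2
    generalize (if x - y + 1 = B.d₁ ∨ x - y + 1 = B.d₂ then (1 : ZMod 2) else 0) = q3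
    generalize (if x - y - 1 = B.d₁ ∨ x - y - 1 = B.d₂ then (1 : ZMod 2) else 0) = q4
    revert q1 q2 q3 q4
    decide

theorem IsBlock.exists_notMem {B : Block} (hB : IsBlock m n c B) : ∃ x y : ℤ, InRect m n x y ∧
    (x + y - c.parity) % 2 = 0 ∧ ((x : ℝ), (y : ℝ)) ∈ B.oct ∧ ¬ B.Mem x y := by
  have hpar := c.parity_cases
  obtain ⟨p1, p2, p3, p4, hs, hdd, left, right, bottom, top, nd₁, nd₂, nd₃, nd₄⟩ := hB
  simp only [Block.intCast_mem_oct]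
  unfold InRect Block.Mem
  -- The witness is an end of the right vertical side of the octagon, or of the left one if `R` cuts
  -- off the right part; the lower end is taken unless `R` cuts off the bottom.
  by_cases hr : B.s₂ + B.d₂ ≤ 2 * m <;> by_cases hb : 0 ≤ B.s₁ - B.d₂ + 2
  · exact ⟨(B.s₂ + B.d₂ - 2) / 2, (B.s₂ - B.d₂ - 2) / 2, by omega⟩
  · exact ⟨(B.s₂ + B.d₂ - 2) / 2, (B.s₂ - B.d₂ + 2) / 2, by omega⟩
  · exact ⟨(B.s₁ + B.d₁ + 2) / 2, (B.s₁ - B.d₁ - 2) / 2, by omega⟩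
  · exact ⟨(B.s₁ + B.d₁ + 2) / 2, (B.s₁ - B.d₁ + 2) / 2, by omega⟩

theorem IsBlockSystem.blockVector_ne_zero (hm : 2 ≤ m) (hn : 2 ≤ n)
    (hS : IsBlockSystem m n c T S) : blockVector m n c S ≠ 0 := by
  obtain ⟨x, y, h⟩ : ∃ x y, ext (blockVector m n c S) x y = 1 := by
    obtain ⟨t, ht, hzt⟩ := hS.tiling.1.cover.symm ▸
      (intCast_mem_rect (m := m) (n := n) (x := 0) (y := 0)).2 (by unfold InRect; omega)
    rcases hS.cases t ht with ⟨a, b, h1, h2, rfl, h4⟩ | ⟨B, hB, rfl⟩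
    · refine ⟨a + 1, b, hS.ext_eq_one_of_mem_diamond ht h4 (by omega) ?_⟩
      rw [← third_three_mul, third_mem_diamond]
      omega
    · obtain ⟨x, y, h1, h2, h3, h4⟩ := (hS.isBlock B hB).exists_notMem
      exact ⟨x, y, hS.ext_eq_one_of_mem_oct hB h1 h2 h3 h4⟩
  intro h0
  obtain ⟨hr, hc⟩ := exists_of_ext_ne _ (h.trans_ne one_ne_zero)
  obtain ⟨b, hb⟩ := Pt.exists_coord hr hc
  rw [ext_of_coord _ hb, h0] at h
  exact zero_ne_one h

theorem IsBlockSystem.Phi_blockVector (hm : 2 ≤ m) (hn : 2 ≤ n)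
    (hS : IsBlockSystem m n c T S) : Phi (blockVector m n c S) = T := by
  have hu := hS.blockVector_mem_kernel hm hn
  apply Phi_eq_of_fits
  · intro t ht
    rcases hS.cases t ht with ⟨a, b, h1, h2, rfl, h4⟩ | ⟨B, hB, rfl⟩
    · apply fits_diamond h1 <;> apply hS.ext_eq_one_of_mem_diamond ht h4 <;>
        first | omega | (rw [← third_three_mul, third_mem_diamond]; omega)
    · exact fits_block hm hu (hS.isBlock B hB) (fun x y h => ext_blockVector_eq_zero hB h)
        fun x y => hS.ext_eq_one_of_mem_oct hB
  · exact hS.tiling.1.cover.ge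

theorem Phi_bijOn (hm : 2 ≤ m) (hn : 2 ≤ n) :
    Set.BijOn Phi {u | u ∈ kernel m n c ∧ u ≠ 0} (tilings m n c) := by
  refine ⟨fun u hu => Phi_mem_tilings hm hn hu.1 hu.2, Phi_injOn hm hn, fun T hT => ?_⟩
  obtain ⟨S, hS⟩ := exists_isBlockSystem hT
  exact ⟨blockVector m n c S,
    ⟨hS.blockVector_mem_kernel hm hn, hS.blockVector_ne_zero hm hn⟩, hS.Phi_blockVector hm hn⟩

end surjective

/-! ### Counting kernel vectors through their profiles -/

section counting
variable {m n : ℕ} {c : Colour} {γ : ℤ → ZMod 2}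

theorem add_zmul_of_add {p : ℤ} (h : ∀ k : ℤ, (k - c.parity) % 2 = 0 → γ (k + 2 * p) = γ k) (t : ℤ)
    {k : ℤ} (hk : (k - c.parity) % 2 = 0) : γ (k + 2 * (p * t)) = γ k := by
  induction t using Int.induction_on with
  | zero => simp
  | succ t ih =>
    rw [← ih, ← h (k + 2 * (p * t)) (by omega)]
    congr 1
    ring
  | pred t ih =>
    rw [← ih, ← h (k + 2 * (p * (-t - 1))) (by omega)]
    congr 1
    ring

/-- Bézout: the greatest common divisor is an integral combination of the two half periods `m + 1`
and `n + 1`. -/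
theorem IsProfile.add_gcd (hγ : IsProfile m n c γ) {k : ℤ} (hk : (k - c.parity) % 2 = 0) (t : ℤ) :
    γ (k + 2 * (((m + 1).gcd (n + 1) : ℕ) : ℤ) * t) = γ k := by
  rw [Nat.gcd_eq_gcd_ab, mul_assoc]
  refine add_zmul_of_add (fun k hk => ?_) t hk
  rw [mul_add, ← add_assoc, add_zmul_of_add (γ := γ) (c := c) (p := ((n + 1 : ℕ) : ℤ)) _ _ (by omega),
    add_zmul_of_add (γ := γ) (c := c) (p := ((m + 1 : ℕ) : ℤ)) _ _ hk]
  · intro k hk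
    exact_mod_cast hγ.add_m k hk
  · intro k hk
    exact_mod_cast hγ.add_n k hk

/-- Evenness and the period just found make a profile factor through the folding onto `[0, G]`,
where `G` is the greatest common divisor. Conversely every function on that interval gives a
profile, by `isProfile_fold`. -/
theorem IsProfile.apply_fold (hγ : IsProfile m n c γ) {k : ℤ} (hk : (k - c.parity) % 2 = 0) :
    γ (fold ((m + 1).gcd (n + 1) : ℕ) k) = γ k := by
  have hG : 0 < (m + 1).gcd (n + 1) := Nat.gcd_pos_of_pos_left _ (Nat.succ_pos m)
  obtain ⟨-, q, h⟩ := exists_fold (M := ((m + 1).gcd (n + 1) : ℕ)) (by omega) k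
  have hp := fold_parity (M := ((m + 1).gcd (n + 1) : ℕ)) (by omega) k
  set r := fold ((m + 1).gcd (n + 1) : ℕ) k
  rcases h with h | h
  · rw [h, add_comm, hγ.add_gcd (by omega)]
  · rw [h, sub_eq_neg_add, hγ.add_gcd (by omega), hγ.neg r (by omega)]

/-- The vector with the given profile. -/
def ofProfile (m n : ℕ) (c : Colour) (γ : ℤ → ZMod 2) : Pt m n c → ZMod 2 :=
  fun b => γ (b.coord.1 + b.coord.2 + 2) + γ (b.coord.1 - b.coord.2)

/-- On the frame one step outside the rectangle, the symmetries of the profile make the two terms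
equal. They cancel, in agreement with the extension by zero. -/
theorem ext_ofProfile (hγ : IsProfile m n c γ) {x y : ℤ} (h1 : -1 ≤ x) (h2 : x ≤ m) (h3 : -1 ≤ y)
    (h4 : y ≤ n) (h : (x + y - c.parity) % 2 = 0) :
    ext (ofProfile m n c γ) x y = γ (x + y + 2) + γ (x - y) := by
  have hpar := c.parity_cases
  by_cases hr : InRect m n x y
  · obtain ⟨b, hb⟩ := Pt.exists_coord hr h
    rw [ext_of_coord _ hb, ofProfile, hb]
  · rw [ext_eq_zero_of_not _ hr]
    suffices γ (x + y + 2) = γ (x - y) by rw [this, CharTwo.add_self_eq_zero]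
    unfold InRect at hr
    have : x = -1 ∨ x = m ∨ y = -1 ∨ y = n := by omega
    rcases this with rfl | rfl | rfl | rfl
    · rw [← hγ.neg _ (by omega)]
      congr 1
      ring
    · rw [← hγ.neg (m - y) (by omega), ← hγ.add_m (-(m - y)) (by omega)]
      congr 1
      ring
    · congr 1
      ring
    · rw [← hγ.add_n (x - n) (by omega)]
      congr 1
      ring

theorem ofProfile_mem_kernel (hγ : IsProfile m n c γ) : ofProfile m n c γ ∈ kernel m n c := by
  rw [mem_kernel_iff]
  rintro x y ⟨r1, r2, r3, r4⟩ hc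
  rw [ext_ofProfile hγ (by omega) (by omega) (by omega) (by omega) (by omega),
    ext_ofProfile hγ (by omega) (by omega) (by omega) (by omega) (by omega),
    ext_ofProfile hγ (by omega) (by omega) (by omega) (by omega) (by omega),
    ext_ofProfile hγ (by omega) (by omega) (by omega) (by omega) (by omega),
    show x + (y + 1) + 2 = x + 1 + y + 2 by ring, show x - (y - 1) = x + 1 - y by ring,
    show x + (y - 1) + 2 = x - 1 + y + 2 by ring, show x - (y + 1) = x - 1 - y by ring]
  -- The four neighbours give eight terms, in which each of four profile values occurs twice.
  generalize γ (x + 1 + y + 2) = q1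
  generalize γ (x + 1 - y) = q2
  generalize γ (x - 1 + y + 2) = q3
  generalize γ (x - 1 - y) = q4
  revert q1 q2 q3 q4
  decide

theorem isProfile_fold (g : ℤ → ZMod 2) :
    IsProfile m n c fun k => g (fold ((m + 1).gcd (n + 1) : ℕ) k) := by
  have hG : (0 : ℤ) < ((m + 1).gcd (n + 1) : ℕ) := by
    exact_mod_cast Nat.gcd_pos_of_pos_left _ (Nat.succ_pos m)
  refine ⟨fun k _ => ?_, fun k _ => ?_, fun k _ => ?_⟩
  · rw [fold_neg hG]
  · obtain ⟨t, ht⟩ := Nat.gcd_dvd_left (m + 1) (n + 1)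
    have : (m : ℤ) + 1 = ((m + 1).gcd (n + 1) : ℕ) * t := by exact_mod_cast ht
    rw [this, ← mul_assoc, fold_add_two_mul hG]
  · obtain ⟨t, ht⟩ := Nat.gcd_dvd_right (m + 1) (n + 1)
    have : (n : ℤ) + 1 = ((m + 1).gcd (n + 1) : ℕ) * t := by exact_mod_cast ht
    rw [this, ← mul_assoc, fold_add_two_mul hG]

/-- At `(i + π, i)`, with `π` the parity of the colour, the vector is `γ (2 * i + 2 + π) + γ π`.
Vanishing at these points makes the profile constant on its parity class in `[0, G]`, hence
everywhere, and a constant profile gives zero. -/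
theorem eq_zero_of_diagonal (hm : 2 ≤ m) (hn : 2 ≤ n) {u : Pt m n c → ZMod 2}
    (hu : u ∈ kernel m n c)
    (h : ∀ i : ℤ, 0 ≤ i → 2 * i + 2 + c.parity ≤ ((m + 1).gcd (n + 1) : ℕ) →
      ext u (i + c.parity) i = 0) : u = 0 := by
  have hG : (0 : ℤ) < ((m + 1).gcd (n + 1) : ℕ) := by
    exact_mod_cast Nat.gcd_pos_of_pos_left _ (Nat.succ_pos m)
  have hGm : (((m + 1).gcd (n + 1) : ℕ) : ℤ) ≤ m + 1 := by
    exact_mod_cast Nat.gcd_le_left _ (Nat.succ_pos m)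
  have hGn : (((m + 1).gcd (n + 1) : ℕ) : ℤ) ≤ n + 1 := by
    exact_mod_cast Nat.gcd_le_right _ (Nat.succ_pos n)
  have hpar := c.parity_cases
  have hγ := isProfile_profile hu
  have key : ∀ k, (k - c.parity) % 2 = 0 → profile u k = profile u c.parity := by
    intro k hk
    rw [← hγ.apply_fold hk]
    have f1 := fold_nonneg hG k
    have f2 := fold_le hG k
    have f3 := fold_parity hG k
    set r := fold ((m + 1).gcd (n + 1) : ℕ) k
    by_cases hr : r = c.parity
    · rw [hr]
    · have h1 := h ((r - c.parity) / 2 - 1) (by omega) (by omega)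
      rw [ext_eq_profile hu (by omega) (by omega) (by omega) (by omega) (by omega)] at h1
      convert eq_of_add_eq_zero h1 using 2 <;> omega
  funext b
  obtain ⟨b1, b2, b3, b4⟩ := b.coord_inRect
  have b5 := b.coord_colour
  rw [← ext_coord u b, ext_eq_profile hu (by omega) (by omega) (by omega) (by omega) b5,
    key (b.coord.1 + b.coord.2 + 2) (by omega), key (b.coord.1 - b.coord.2) (by omega),
    CharTwo.add_self_eq_zero]
  rfl

/-- Evaluation of kernel vectors at the first points of a diagonal of the rectangle. -/
noncomputable def diagonalValues (m n : ℕ) (c : Colour) (K : ℕ) (u : kernel m n c) :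
    Fin K → ZMod 2 := fun i => ext u.1 ((i : ℕ) + c.parity) (i : ℕ)

/-- The two bounds say that `K` is the number of integers of the parity of `c` in `[0, G]`, minus
one. One value is lost because adding a constant to the profile does not change the vector. -/
theorem bijective_diagonalValues (hm : 2 ≤ m) (hn : 2 ≤ n) {K : ℕ}
    (hK : 2 * (K : ℤ) + c.parity ≤ ((m + 1).gcd (n + 1) : ℕ))
    (hK' : (((m + 1).gcd (n + 1) : ℕ) : ℤ) ≤ 2 * K + c.parity + 1) :
    Function.Bijective (diagonalValues m n c K) := by
  have hG : (0 : ℤ) < ((m + 1).gcd (n + 1) : ℕ) := by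
    exact_mod_cast Nat.gcd_pos_of_pos_left _ (Nat.succ_pos m)
  have hGm : (((m + 1).gcd (n + 1) : ℕ) : ℤ) ≤ m + 1 := by
    exact_mod_cast Nat.gcd_le_left _ (Nat.succ_pos m)
  have hGn : (((m + 1).gcd (n + 1) : ℕ) : ℤ) ≤ n + 1 := by
    exact_mod_cast Nat.gcd_le_right _ (Nat.succ_pos n)
  have hpar := c.parity_cases
  constructor
  · rintro ⟨u, hu⟩ ⟨v, hv⟩ h
    have h0 : u + v = 0 := by
      refine eq_zero_of_diagonal hm hn (add_mem hu hv) fun i h1 h2 => ?_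
      lift i to ℕ using h1
      have := congrFun h ⟨i, by omega⟩
      simp only [diagonalValues] at this
      rw [ext_add, this, CharTwo.add_self_eq_zero]
    apply Subtype.ext
    funext b
    exact eq_of_add_eq_zero (congrFun h0 b)
  · intro a
    -- The profile is normalised to be zero at the smallest argument `c.parity` and to take the
    -- value `a i` at `2 * i + 2 + c.parity`. The smallest argument has to be excluded explicitly,
    -- because its index `-1` is truncated to `0`.
    set g : ℤ → ZMod 2 := fun r =>
      if h : ((r - c.parity) / 2 - 1).toNat < K ∧ r ≠ c.parity
      then a ⟨((r - c.parity) / 2 - 1).toNat, h.1⟩ else 0 with hg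
    refine ⟨⟨_, ofProfile_mem_kernel (isProfile_fold g)⟩, ?_⟩
    funext i
    have hi := i.2
    simp only [diagonalValues]
    rw [ext_ofProfile (isProfile_fold g) (by omega) (by omega) (by omega) (by omega) (by omega),
      fold_of_mem (by omega) (by omega) hG, fold_of_mem (by omega) (by omega) hG, hg]
    dsimp only
    rw [dif_pos, dif_neg, add_zero]
    · congr 1
      ext
      simp only
      omega
    · simp
    · omega

theorem card_kernel (hm : 2 ≤ m) (hn : 2 ≤ n) {K : ℕ}
    (hK : 2 * (K : ℤ) + c.parity ≤ ((m + 1).gcd (n + 1) : ℕ))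
    (hK' : (((m + 1).gcd (n + 1) : ℕ) : ℤ) ≤ 2 * K + c.parity + 1) :
    Nat.card (kernel m n c) = 2 ^ K := by
  rw [Nat.card_eq_of_bijective _ (bijective_diagonalValues hm hn hK hK'), Nat.card_fun]
  simp

theorem tilings_finite (hm : 2 ≤ m) (hn : 2 ≤ n) : (tilings m n c).Finite := by
  rw [← (Phi_bijOn hm hn).image_eq]
  exact (Set.toFinite _).image _

theorem ncard_tilings (hm : 2 ≤ m) (hn : 2 ≤ n) {K : ℕ}
    (hK : 2 * (K : ℤ) + c.parity ≤ ((m + 1).gcd (n + 1) : ℕ))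
    (hK' : (((m + 1).gcd (n + 1) : ℕ) : ℤ) ≤ 2 * K + c.parity + 1) :
    (tilings m n c).ncard = 2 ^ K - 1 := by
  rw [← (Phi_bijOn hm hn).image_eq, (Phi_bijOn hm hn).injOn.ncard_image,
    ← card_kernel hm hn hK hK', show Nat.card (kernel m n c) =
      (kernel m n c : Set (Pt m n c → ZMod 2)).ncard from Nat.card_coe_set_eq _, ← Set.ncard_sdiff_singleton_of_mem
      (show (0 : Pt m n c → ZMod 2) ∈ (kernel m n c : Set _) from zero_mem _)]
  rfl

end counting

end RectTiling

theorem theorem3 (m n : ℕ) (hm : 2 ≤ m) (hn : 2 ≤ n) :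
    Set.BijOn RectTiling.Phi {u | u ∈ RectTiling.kerBW m n ∧ u ≠ 0} (RectTiling.tilingsB m n) ∧
    Set.BijOn RectTiling.Phi {u | u ∈ RectTiling.kerWB m n ∧ u ≠ 0} (RectTiling.tilingsW m n) ∧
    (RectTiling.tilingsB m n).Finite ∧
    (RectTiling.tilingsW m n).Finite ∧
    (RectTiling.tilingsB m n).ncard = 2 ^ ⌈((Nat.gcd (m + 1) (n + 1) - 1 : ℕ) : ℚ) / 2⌉₊ - 1 ∧
    (RectTiling.tilingsW m n).ncard = 2 ^ ⌊((Nat.gcd (m + 1) (n + 1) - 1 : ℕ) : ℚ) / 2⌋₊ - 1 := by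
  have hG : 0 < (m + 1).gcd (n + 1) := Nat.gcd_pos_of_pos_left _ (Nat.succ_pos m)
  refine ⟨RectTiling.Phi_bijOn hm hn, RectTiling.Phi_bijOn hm hn, RectTiling.tilings_finite hm hn,
    RectTiling.tilings_finite hm hn, RectTiling.ncard_tilings hm hn ?_ ?_,
    RectTiling.ncard_tilings hm hn ?_ ?_⟩
  all_goals simp only [RectTiling.Colour.parity]
  all_goals set G := (m + 1).gcd (n + 1)
  -- For black the number of free values is the integer part of `G / 2`, which is the ceiling of `(G
  -- - 1) / 2`; for white it is the integer part of `(G - 1) / 2`.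
  · have h : ⌈((G - 1 : ℕ) : ℚ) / 2⌉₊ ≤ G / 2 := by
      rw [Nat.ceil_le, div_le_iff₀ two_pos]
      exact_mod_cast (by omega)
    omega
  · have h := Nat.le_ceil (((G - 1 : ℕ) : ℚ) / 2)
    rw [div_le_iff₀ two_pos] at h
    have h' : G - 1 ≤ ⌈((G - 1 : ℕ) : ℚ) / 2⌉₊ * 2 := by exact_mod_cast h
    omega
  · rw [show ((2 : ℚ)) = ((2 : ℕ) : ℚ) by norm_num, Nat.floor_div_eq_div]
    omega
  · rw [show ((2 : ℚ)) = ((2 : ℕ) : ℚ) by norm_num, Nat.floor_div_eq_div]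
    omega
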